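/- Let $\mathbb K$ be a field of characteristic $0$. Graded means $\mathbb Z$-graded over $\mathbb K$, all signs follow the Koszul rule, and $\mathbf s$ is the suspension, which raises degrees by $1$. An $\mathbf S$-coalgebra is a pair $(V,A)$ of graded vector spaces with the following structure, written on the desuspensions $C=\mathbf s^{-2}V$ and $D=\mathbf s^{-1}A$. There are linear maps $\Delta_{\mathfrak c}\colon C\to C\otimes C$, $\delta_{\mathfrak c}\colon C\to C\otimes C$, $\Delta_{\mathfrak o}\colon D\to D\otimes D$ and $\rho\colon D\to C$ of degrees $0,-1,0,0$ such that, with $\sigma$ denoting the graded switch of tensor factors and $\zeta$ the cyclic permutation of $C^{\otimes 3}$ with its Koszul sign: - $C$ is a Gerstenhaber coalgebra: $\Delta_{\mathfrak c}$ is coassociative and $\sigma\Delta_{\mathfrak c}=\Delta_{\mathfrak c}$; moreover $\sigma\delta_{\mathfrak c}=\delta_{\mathfrak c}$, $(1+\zeta+\zeta^2)(\delta_{\mathfrak c}\otimes 1)\delta_{\mathfrak c}=0$ and $(1\otimes\Delta_{\mathfrak c})\delta_{\mathfrak c}=(\delta_{\mathfrak c}\otimes1)\Delta_{\mathfrak c}+(\sigma\otimes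 1)(1\otimes\delta_{\mathfrak c})\Delta_{\mathfrak c}$; - $\Delta_{\mathfrak o}$ is coassociative; - $\delta_{\mathfrak c}\rho=0$, $\ \Delta_{\mathfrak c}\rho=(\rho\otimes\rho)\Delta_{\mathfrak o}$ and $(\rho\otimes 1)\Delta_{\mathfrak o}=\sigma(1\otimes\rho)\Delta_{\mathfrak o}$. Morphisms of $\mathbf S$-coalgebras are pairs of degree $0$ linear maps commuting with the four cooperations. For a pair $(V,A)$ of graded vector spaces let $\mathbf S(V,A)$ be the cofree (conilpotent) $\mathbf S$-coalgebra cogenerated by $(V,A)$; in particular $V$ and $A$ are contained in its two components as the cogenerators. Let now $(V,A)$ be a pair of cochain complexes. A $\mathbf{Ger}^+_\infty$-algebra structure on $(V,A)$ is a degree $1$ codifferential $\hat Q$ on $\mathbf S(V,A)$, that is, a degree $1$ coderivation with respect to all four cooperations with $\hat Q^2=0$, which extends the differentials of $V$ and $A$. A $\mathbf{Ger}^+_\infty$-morphism $(V,A,\hat Q)\to(V',A',\hat Q')$ is a morphism $\hat T\colon\mathbf S(V,A)\to\mathbf S(V',A')$ of $\mathbf S$-coalgebras with $\hat T\hat Q=\hat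 Q'\hat T$. It restricts to chain maps $V\to V'$ and $A\to A'$, and is a $\mathbf{Ger}^+_\infty$ quasi-isomorphism if both restrictions are quasi-isomorphisms. **Theorem 4.8.** Let $f\colon V\to V'$ and $g\colon A\to A'$ be quasi-isomorphisms of cochain complexes, and let $\hat Q'$ be a $\mathbf{Ger}^+_\infty$-algebra structure on $(V',A')$. Then there exist a $\mathbf{Ger}^+_\infty$-algebra structure $\hat Q$ on $(V,A)$ and a $\mathbf{Ger}^+_\infty$ quasi-isomorphism $\hat T\colon(V,A,\hat Q)\to(V',A',\hat Q')$ which extends $f$ and $g$, i.e. whose restrictions to $V$ and $A$ are $f$ and $g$. -/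

import Mathlib

open CategoryTheory
open scoped DirectSum TensorProduct

universe v u

noncomputable section

namespace GerPlus

/-! ### Graded vector spaces -/

/-- A `ℤ`-graded vector space over `K`. -/
abbrev GrSpace (K : Type v) [Field K] := ℤ → ModuleCat.{u} K

/-- The total space `⨁ n, C n` of a graded vector space. -/
abbrev Tot {K : Type v} [Field K] (C : GrSpace.{v, u} K) : Type u := ⨁ n : ℤ, C n

/-- The inclusion of the degree `n` component. -/
abbrev inj {K : Type v} [Field K] (C : GrSpace.{v, u} K) (n : ℤ) : C n →ₗ[K] Tot C :=
  DirectSum.lof K ℤ (fun n => C n) n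

/-- The sign operator, multiplication by `(-1) ^ n` in degree `n`. By the Koszul sign rule,
`id ⊗ f` for an operator `f` of odd degree is `TensorProduct.map (sgn C) f`. -/
def sgn {K : Type v} [Field K] (C : GrSpace.{v, u} K) : Tot C →ₗ[K] Tot C :=
  DirectSum.toModule K ℤ (Tot C) fun n => (n.negOnePow : ℤ) • inj C n

/-- The symmetry `x ⊗ y ↦ (-1) ^ (|x| |y|) y ⊗ x`. -/
def swap {K : Type v} [Field K] (C D : GrSpace.{v, u} K) :
    Tot C ⊗[K] Tot D →ₗ[K] Tot D ⊗[K] Tot C :=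
  (TensorProduct.gradedComm K (fun n => C n) (fun n => D n)).toLinearMap

/-- Linear maps which are homogeneous of degree `d`. -/
def HasDegree {K : Type v} [Field K] {C D : GrSpace.{v, u} K} (d : ℤ)
    (f : Tot C →ₗ[K] Tot D) : Prop :=
  ∀ (n : ℤ) (x : C n), ∃ y : D (n + d), f (inj C n x) = inj D (n + d) y

/-- The degree `n` component `⨁_{p + q = n} C p ⊗ D q` of the tensor product. -/
def tensorDeg {K : Type v} [Field K] (C D : GrSpace.{v, u} K) (n : ℤ) :
    Submodule K (Tot C ⊗[K] Tot D) :=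
  ⨆ (p : ℤ) (q : ℤ) (_ : p + q = n), LinearMap.range (TensorProduct.map (inj C p) (inj D q))

/-! ### `S`-coalgebras -/

/-- Two graded vector spaces `C` (color `c`) and `D` (color `o`) with cooperations
`Δc`, `δc` on `C`, `Δo` on `D`, and `ρ : D → C`, not yet subject to any relation.

Degrees are those after desuspension: `C` stands for `s⁻² V` and `D` for `s⁻¹ A` if `(V, A)`
is the `S`-coalgebra. So `Δc`, `Δo` and `ρ` have degree `0` and `δc` has degree `-1`. -/
structure Cooperations (K : Type v) [Field K] where
  /-- the component of color `c` -/
  C : GrSpace.{v, u} K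
  /-- the component of color `o` -/
  D : GrSpace.{v, u} K
  /-- the comultiplication of color `c` -/
  Δc : Tot C →ₗ[K] Tot C ⊗[K] Tot C
  /-- the cobracket -/
  δc : Tot C →ₗ[K] Tot C ⊗[K] Tot C
  /-- the comultiplication of color `o` -/
  Δo : Tot D →ₗ[K] Tot D ⊗[K] Tot D
  /-- the unary cooperation -/
  ρ : Tot D →ₗ[K] Tot C

/-- The permutation of the first two factors of `C ⊗ C ⊗ C`, with Koszul sign. -/
def swap12 {K : Type v} [Field K] (C : GrSpace.{v, u} K) :
    (Tot C ⊗[K] Tot C) ⊗[K] Tot C →ₗ[K] (Tot C ⊗[K] Tot C) ⊗[K] Tot C :=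
  (swap C C).rTensor (Tot C)

/-- The permutation of the last two factors of `C ⊗ C ⊗ C`, with Koszul sign. -/
def swap23 {K : Type v} [Field K] (C : GrSpace.{v, u} K) :
    (Tot C ⊗[K] Tot C) ⊗[K] Tot C →ₗ[K] (Tot C ⊗[K] Tot C) ⊗[K] Tot C :=
  (TensorProduct.assoc K (Tot C) (Tot C) (Tot C)).symm.toLinearMap ∘ₗ
    (swap C C).lTensor (Tot C) ∘ₗ (TensorProduct.assoc K (Tot C) (Tot C) (Tot C)).toLinearMap

/-- The cyclic permutation `x ⊗ y ⊗ z ↦ ± y ⊗ z ⊗ x` of `C ⊗ C ⊗ C`, with Koszul sign. -/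
def cyc {K : Type v} [Field K] (C : GrSpace.{v, u} K) :
    (Tot C ⊗[K] Tot C) ⊗[K] Tot C →ₗ[K] (Tot C ⊗[K] Tot C) ⊗[K] Tot C :=
  swap23 C ∘ₗ swap12 C

/-- The relations of color `c`, at an element `x`: those of a Gerstenhaber coalgebra. -/
structure Cooperations.RelC {K : Type v} [Field K] (M : Cooperations.{v, u} K)
    (x : Tot M.C) : Prop where
  /-- `Δc` is (graded) cocommutative -/
  comm : swap M.C M.C (M.Δc x) = M.Δc x
  /-- `Δc` is coassociative -/
  assoc : TensorProduct.assoc K _ _ _ (M.Δc.rTensor (Tot M.C) (M.Δc x)) =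
    M.Δc.lTensor (Tot M.C) (M.Δc x)
  /-- the cobracket, which is of degree `-1`, is symmetric -/
  symm : swap M.C M.C (M.δc x) = M.δc x
  /-- the co-Jacobi identity -/
  jacobi : M.δc.rTensor (Tot M.C) (M.δc x) + cyc M.C (M.δc.rTensor (Tot M.C) (M.δc x)) +
    cyc M.C (cyc M.C (M.δc.rTensor (Tot M.C) (M.δc x))) = 0
  /-- the co-Leibniz identity
  `(id ⊗ Δc) δc = (δc ⊗ id) Δc + (swap ⊗ id) (id ⊗ δc) Δc` -/
  leibniz : (TensorProduct.assoc K _ _ _).symm (M.Δc.lTensor (Tot M.C) (M.δc x)) =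
    M.δc.rTensor (Tot M.C) (M.Δc x) +
      swap12 M.C ((TensorProduct.assoc K _ _ _).symm
        (TensorProduct.map (sgn M.C) M.δc (M.Δc x)))

/-- The relations of color `o`, at an element `y`. -/
structure Cooperations.RelO {K : Type v} [Field K] (M : Cooperations.{v, u} K)
    (y : Tot M.D) : Prop where
  /-- `Δo` is coassociative -/
  assoc : TensorProduct.assoc K _ _ _ (M.Δo.rTensor (Tot M.D) (M.Δo y)) =
    M.Δo.lTensor (Tot M.D) (M.Δo y)
  /-- `δc ∘ ρ = 0` -/
  bracket : M.δc (M.ρ y) = 0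
  /-- `ρ` is a map of coalgebras -/
  mul : M.Δc (M.ρ y) = TensorProduct.map M.ρ M.ρ (M.Δo y)
  /-- `(ρ ⊗ id) Δo = swap (id ⊗ ρ) Δo` -/
  central : M.ρ.rTensor (Tot M.D) (M.Δo y) = swap M.D M.C (M.ρ.lTensor (Tot M.D) (M.Δo y))

/-- An `S`-coalgebra (in desuspended form): `C` is a Gerstenhaber coalgebra, `D` is a
coassociative coalgebra, and `ρ : D → C` satisfies the compatibility conditions. -/
structure SCoalgebra (K : Type v) [Field K] extends Cooperations.{v, u} K where
  deg_Δc : ∀ (n : ℤ) (x : C n), Δc (inj C n x) ∈ tensorDeg C C n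
  deg_δc : ∀ (n : ℤ) (x : C n), δc (inj C n x) ∈ tensorDeg C C (n - 1)
  deg_Δo : ∀ (n : ℤ) (y : D n), Δo (inj D n y) ∈ tensorDeg D D n
  deg_ρ : HasDegree 0 ρ
  relC : ∀ x, toCooperations.RelC x
  relO : ∀ y, toCooperations.RelO y

/-- A codifferential of degree `1` on an `S`-coalgebra: a degree `1` coderivation (with respect
to all cooperations, with Koszul signs) of square zero. -/
structure Codifferential {K : Type v} [Field K] (S : SCoalgebra.{v, u} K) where
  /-- the component of color `c` -/
  Qc : Tot S.C →ₗ[K] Tot S.C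
  /-- the component of color `o` -/
  Qo : Tot S.D →ₗ[K] Tot S.D
  deg_Qc : HasDegree 1 Qc
  deg_Qo : HasDegree 1 Qo
  coder_Δc : S.Δc ∘ₗ Qc = (Qc.rTensor (Tot S.C) + TensorProduct.map (sgn S.C) Qc) ∘ₗ S.Δc
  coder_δc : S.δc ∘ₗ Qc = -((Qc.rTensor (Tot S.C) + TensorProduct.map (sgn S.C) Qc) ∘ₗ S.δc)
  coder_Δo : S.Δo ∘ₗ Qo = (Qo.rTensor (Tot S.D) + TensorProduct.map (sgn S.D) Qo) ∘ₗ S.Δo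
  coder_ρ : S.ρ ∘ₗ Qo = Qc ∘ₗ S.ρ
  sq_c : Qc ∘ₗ Qc = 0
  sq_o : Qo ∘ₗ Qo = 0

/-- A morphism of `S`-coalgebras. -/
structure SCoalgebra.Hom {K : Type v} [Field K] (S S' : SCoalgebra.{v, u} K) where
  /-- the component of color `c` -/
  Tc : Tot S.C →ₗ[K] Tot S'.C
  /-- the component of color `o` -/
  To : Tot S.D →ₗ[K] Tot S'.D
  deg_Tc : HasDegree 0 Tc
  deg_To : HasDegree 0 To
  map_Δc : S'.Δc ∘ₗ Tc = TensorProduct.map Tc Tc ∘ₗ S.Δc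
  map_δc : S'.δc ∘ₗ Tc = TensorProduct.map Tc Tc ∘ₗ S.δc
  map_Δo : S'.Δo ∘ₗ To = TensorProduct.map To To ∘ₗ S.Δo
  map_ρ : S'.ρ ∘ₗ To = Tc ∘ₗ S.ρ

/-! ### Trees: the cofree object without relations -/

/-- Shapes of trees of color `c`: a leaf labelled by the degree of an element of `V`, or a
vertex for `Δc` or for `δc` with two subtrees. -/
inductive CTree : Type
  | leaf (i : ℤ) : CTree
  | prod (l r : CTree) : CTree
  | brac (l r : CTree) : CTree
  deriving DecidableEq

/-- Shapes of trees of color `o`: a leaf labelled by the degree of an element of `A`, a vertex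
for `Δo` with two subtrees, or a vertex for `ρ` with a subtree of color `c`. -/
inductive OTree : Type
  | leaf (i : ℤ) : OTree
  | prod (l r : OTree) : OTree
  | rho (t : CTree) : OTree
  deriving DecidableEq

/-- The degree of a tree; its leaves are elements of `s⁻² V`, and a vertex for `δc`, which is
a cooperation of degree `-1`, raises the degree by one. -/
def CTree.deg : CTree → ℤ
  | leaf i => i - 2
  | prod l r => l.deg + r.deg
  | brac l r => l.deg + r.deg + 1

/-- The degree of a tree of color `o`; its leaves are elements of `s⁻² V` and `s⁻¹ A`. -/
def OTree.deg : OTree → ℤ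
  | leaf i => i - 1
  | prod l r => l.deg + r.deg
  | rho t => t.deg

/-- The tensor product over the leaves of a tree. -/
def CTree.tens {K : Type v} [Field K] (V : GrSpace.{v, u} K) : CTree → ModuleCat.{u} K
  | leaf i => V i
  | prod l r => ModuleCat.of K (l.tens V ⊗[K] r.tens V)
  | brac l r => ModuleCat.of K (l.tens V ⊗[K] r.tens V)

/-- The tensor product over the leaves of a tree. -/
def OTree.tens {K : Type v} [Field K] (V A : GrSpace.{v, u} K) : OTree → ModuleCat.{u} K
  | leaf i => A i
  | prod l r => ModuleCat.of K (l.tens V A ⊗[K] r.tens V A)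
  | rho t => t.tens V

/-- The graded space of all trees of color `c` decorated by `V`. -/
def treesC {K : Type v} [Field K] (V : GrSpace.{v, u} K) : GrSpace.{v, u} K := fun n =>
  ModuleCat.of K (⨁ t : {t : CTree // t.deg = n}, t.1.tens V)

/-- The graded space of all trees of color `o` decorated by `V` and `A`. -/
def treesO {K : Type v} [Field K] (V A : GrSpace.{v, u} K) : GrSpace.{v, u} K := fun n =>
  ModuleCat.of K (⨁ t : {t : OTree // t.deg = n}, t.1.tens V A)

/-- The inclusion of the decorations of one tree, of degree `n`. -/
def treeC {K : Type v} [Field K] (V : GrSpace.{v, u} K) (t : CTree) (n : ℤ) (h : t.deg = n) :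
    t.tens V →ₗ[K] treesC V n :=
  DirectSum.lof K {t : CTree // t.deg = n} (fun t => t.1.tens V) ⟨t, h⟩

/-- The inclusion of the decorations of one tree, of degree `n`. -/
def treeO {K : Type v} [Field K] (V A : GrSpace.{v, u} K) (t : OTree) (n : ℤ)
    (h : t.deg = n) : t.tens V A →ₗ[K] treesO V A n :=
  DirectSum.lof K {t : OTree // t.deg = n} (fun t => t.1.tens V A) ⟨t, h⟩

/-- The inclusion of the decorations of one tree into the total space. -/
def embC {K : Type v} [Field K] (V : GrSpace.{v, u} K) (t : CTree) :
    t.tens V →ₗ[K] Tot (treesC V) :=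
  inj (treesC V) t.deg ∘ₗ treeC V t t.deg rfl

/-- The inclusion of the decorations of one tree into the total space. -/
def embO {K : Type v} [Field K] (V A : GrSpace.{v, u} K) (t : OTree) :
    t.tens V A →ₗ[K] Tot (treesO V A) :=
  inj (treesO V A) t.deg ∘ₗ treeO V A t t.deg rfl

/-- `Δc` on one tree: cut the root if it is a vertex for `Δc`. -/
def cutΔc {K : Type v} [Field K] (V : GrSpace.{v, u} K) :
    (t : CTree) → t.tens V →ₗ[K] Tot (treesC V) ⊗[K] Tot (treesC V)
  | .leaf _ => 0
  | .prod l r => TensorProduct.map (embC V l) (embC V r)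
  | .brac _ _ => 0

/-- `δc` on one tree: cut the root if it is a vertex for `δc`. -/
def cutδc {K : Type v} [Field K] (V : GrSpace.{v, u} K) :
    (t : CTree) → t.tens V →ₗ[K] Tot (treesC V) ⊗[K] Tot (treesC V)
  | .leaf _ => 0
  | .prod _ _ => 0
  | .brac l r => TensorProduct.map (embC V l) (embC V r)

/-- `Δo` on one tree: cut the root if it is a vertex for `Δo`. -/
def cutΔo {K : Type v} [Field K] (V A : GrSpace.{v, u} K) :
    (t : OTree) → t.tens V A →ₗ[K] Tot (treesO V A) ⊗[K] Tot (treesO V A)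
  | .leaf _ => 0
  | .prod l r => TensorProduct.map (embO V A l) (embO V A r)
  | .rho _ => 0

/-- `ρ` on one tree: remove the root if it is a vertex for `ρ`. -/
def cutρ {K : Type v} [Field K] (V A : GrSpace.{v, u} K) :
    (t : OTree) → t.tens V A →ₗ[K] Tot (treesC V)
  | .leaf _ => 0
  | .prod _ _ => 0
  | .rho t => embC V t

/-- The cooperation `Δc` on the space of all trees. -/
def treesΔc {K : Type v} [Field K] (V : GrSpace.{v, u} K) :
    Tot (treesC V) →ₗ[K] Tot (treesC V) ⊗[K] Tot (treesC V) :=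
  DirectSum.toModule K ℤ _ fun n =>
    DirectSum.toModule K {t : CTree // t.deg = n} _ fun t => cutΔc V t.1

theorem treesΔc_tree {K : Type v} [Field K] (V : GrSpace.{v, u} K) (t : CTree) (n : ℤ)
    (h : t.deg = n) (x : t.tens V) :
    treesΔc V (inj (treesC V) n (treeC V t n h x)) = cutΔc V t x :=
  (DirectSum.toModule_lof K _ _).trans (DirectSum.toModule_lof K _ _)

/-- The cooperation `δc` on the space of all trees. -/
def treesδc {K : Type v} [Field K] (V : GrSpace.{v, u} K) :
    Tot (treesC V) →ₗ[K] Tot (treesC V) ⊗[K] Tot (treesC V) :=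
  DirectSum.toModule K ℤ _ fun n =>
    DirectSum.toModule K {t : CTree // t.deg = n} _ fun t => cutδc V t.1

theorem treesδc_tree {K : Type v} [Field K] (V : GrSpace.{v, u} K) (t : CTree) (n : ℤ)
    (h : t.deg = n) (x : t.tens V) :
    treesδc V (inj (treesC V) n (treeC V t n h x)) = cutδc V t x :=
  (DirectSum.toModule_lof K _ _).trans (DirectSum.toModule_lof K _ _)

/-- The cooperation `Δo` on the space of all trees. -/
def treesΔo {K : Type v} [Field K] (V A : GrSpace.{v, u} K) :
    Tot (treesO V A) →ₗ[K] Tot (treesO V A) ⊗[K] Tot (treesO V A) :=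
  DirectSum.toModule K ℤ _ fun n =>
    DirectSum.toModule K {t : OTree // t.deg = n} _ fun t => cutΔo V A t.1

theorem treesΔo_tree {K : Type v} [Field K] (V A : GrSpace.{v, u} K) (t : OTree) (n : ℤ)
    (h : t.deg = n) (x : t.tens V A) :
    treesΔo V A (inj (treesO V A) n (treeO V A t n h x)) = cutΔo V A t x :=
  (DirectSum.toModule_lof K _ _).trans (DirectSum.toModule_lof K _ _)

/-- The cooperation `ρ` on the space of all trees. -/
def treesρ {K : Type v} [Field K] (V A : GrSpace.{v, u} K) :
    Tot (treesO V A) →ₗ[K] Tot (treesC V) :=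
  DirectSum.toModule K ℤ _ fun n =>
    DirectSum.toModule K {t : OTree // t.deg = n} _ fun t => cutρ V A t.1

theorem treesρ_tree {K : Type v} [Field K] (V A : GrSpace.{v, u} K) (t : OTree) (n : ℤ)
    (h : t.deg = n) (x : t.tens V A) :
    treesρ V A (inj (treesO V A) n (treeO V A t n h x)) = cutρ V A t x :=
  (DirectSum.toModule_lof K _ _).trans (DirectSum.toModule_lof K _ _)

/-- The cofree (conilpotent) object with four cooperations and no relations cogenerated by the
pair `(s⁻² V, s⁻¹ A)`: decorated trees, with the cooperations given by cutting at the root. -/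
abbrev trees {K : Type v} [Field K] (V A : GrSpace.{v, u} K) : Cooperations.{v, u} K where
  C := treesC V
  D := treesO V A
  Δc := treesΔc V
  δc := treesδc V
  Δo := treesΔo V A
  ρ := treesρ V A

/-! ### Subcoalgebras -/

/-- A family of subspaces as a graded vector space. -/
abbrev sub {K : Type v} [Field K] {C : GrSpace.{v, u} K} (N : ∀ n, Submodule K (C n)) :
    GrSpace.{v, u} K := fun n => ModuleCat.of K (N n)

/-- The inclusion of a graded subspace. -/
def incl {K : Type v} [Field K] {C : GrSpace.{v, u} K} (N : ∀ n, Submodule K (C n)) :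
    Tot (sub N) →ₗ[K] Tot C :=
  DirectSum.lmap fun n => (N n).subtype

/-- The degree `n` part of `N ⊗ N` inside `C ⊗ C`. -/
def subDeg {K : Type v} [Field K] {C : GrSpace.{v, u} K} (N : ∀ n, Submodule K (C n)) (n : ℤ) :
    Submodule K (Tot C ⊗[K] Tot C) :=
  (tensorDeg (sub N) (sub N) n).map (TensorProduct.map (incl N) (incl N))

/-- The pair of graded subspaces `(N, P)` is closed under the cooperations, and the defining
relations of `S`-coalgebras hold on it. -/
structure Cooperations.IsSub {K : Type v} [Field K] (M : Cooperations.{v, u} K)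
    (N : ∀ n, Submodule K (M.C n)) (P : ∀ n, Submodule K (M.D n)) : Prop where
  Δc_mem : ∀ n, ∀ x ∈ N n, M.Δc (inj M.C n x) ∈ subDeg N n
  δc_mem : ∀ n, ∀ x ∈ N n, M.δc (inj M.C n x) ∈ subDeg N (n - 1)
  Δo_mem : ∀ n, ∀ y ∈ P n, M.Δo (inj M.D n y) ∈ subDeg P n
  ρ_mem : ∀ n, ∀ y ∈ P n, M.ρ (inj M.D n y) ∈ (N n).map (inj M.C n)
  relC : ∀ n, ∀ x ∈ N n, M.RelC (inj M.C n x)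
  relO : ∀ n, ∀ y ∈ P n, M.RelO (inj M.D n y)

/-- The component of color `c` of the largest `S`-coalgebra contained in `M`. -/
def Cooperations.maxC {K : Type v} [Field K] (M : Cooperations.{v, u} K) (n : ℤ) :
    Submodule K (M.C n) :=
  sSup {X | ∃ N P, M.IsSub N P ∧ X = N n}

/-- The component of color `o` of the largest `S`-coalgebra contained in `M`. -/
def Cooperations.maxO {K : Type v} [Field K] (M : Cooperations.{v, u} K) (n : ℤ) :
    Submodule K (M.D n) :=
  sSup {X | ∃ N P, M.IsSub N P ∧ X = P n}

theorem tensorDeg_mono_map {K : Type v} [Field K] {C D : GrSpace.{v, u} K}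
    {f : Tot C →ₗ[K] Tot D} (hf : HasDegree 0 f) (n : ℤ) :
    (tensorDeg C C n).map (TensorProduct.map f f) ≤ tensorDeg D D n := by
  have key : ∀ p (x : C p), ∃ y : D p, f (inj C p x) = inj D p y := by
    intro p x
    have h := hf p x
    rwa [add_zero] at h
  unfold tensorDeg
  simp only [Submodule.map_iSup, iSup_le_iff]
  intro p q hpq
  rintro _ ⟨_, ⟨z, rfl⟩, rfl⟩
  induction z using TensorProduct.induction_on with
  | zero => simp
  | add a b ha hb => simpa only [map_add] using Submodule.add_mem _ ha hb
  | tmul a b =>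
    obtain ⟨a', ha⟩ := key p a
    obtain ⟨b', hb⟩ := key q b
    refine Submodule.mem_iSup_of_mem p (Submodule.mem_iSup_of_mem q
      (Submodule.mem_iSup_of_mem hpq ⟨a' ⊗ₜ b', ?_⟩))
    simp only [TensorProduct.map_tmul]
    rw [ha, hb]

theorem incl_inj {K : Type v} [Field K] {C : GrSpace.{v, u} K}
    (N : ∀ n, Submodule K (C n)) (n : ℤ) (x : N n) :
    incl N (inj (sub N) n x) = inj C n x.1 :=
  DirectSum.lmap_lof (fun n => (N n).subtype) n x

theorem incl_injective {K : Type v} [Field K] {C : GrSpace.{v, u} K}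
    (N : ∀ n, Submodule K (C n)) : Function.Injective (incl N) :=
  (DirectSum.lmap_injective _).2 fun n => (N n).injective_subtype

theorem incl_incl_injective {K : Type v} [Field K] {C D : GrSpace.{v, u} K}
    (N : ∀ n, Submodule K (C n)) (P : ∀ n, Submodule K (D n)) :
    Function.Injective (TensorProduct.map (incl N) (incl P)) :=
  TensorProduct.map_injective_of_flat_flat _ _ (incl_injective N) (incl_injective P)

theorem subDeg_mono {K : Type v} [Field K] {C : GrSpace.{v, u} K}
    {N P : ∀ n, Submodule K (C n)} (h : ∀ n, N n ≤ P n) (n : ℤ) :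
    subDeg N n ≤ subDeg P n := by
  let j : Tot (sub N) →ₗ[K] Tot (sub P) := DirectSum.lmap fun n => Submodule.inclusion (h n)
  have hj : incl P ∘ₗ j = incl N := by
    apply DirectSum.linearMap_ext
    intro n
    ext x
    simp [incl, j, DirectSum.lmap_lof]
  have hd : HasDegree 0 j := by
    intro n x
    rw [add_zero]
    exact ⟨_, DirectSum.lmap_lof (fun n => Submodule.inclusion (h n)) n x⟩
  unfold subDeg
  rw [← hj, TensorProduct.map_comp, Submodule.map_comp]
  exact Submodule.map_mono (tensorDeg_mono_map hd n)

theorem Cooperations.RelC.add {K : Type v} [Field K] {M : Cooperations.{v, u} K}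
    {x y : Tot M.C} (hx : M.RelC x) (hy : M.RelC y) : M.RelC (x + y) where
  comm := by simp only [map_add, hx.comm, hy.comm]
  assoc := by simp only [map_add, hx.assoc, hy.assoc]
  symm := by simp only [map_add, hx.symm, hy.symm]
  jacobi := by
    have h := congrArg₂ (· + ·) hx.jacobi hy.jacobi
    simp only [map_add, add_zero] at h ⊢
    rw [← h]; abel
  leibniz := by simp only [map_add, hx.leibniz, hy.leibniz]; abel

theorem Cooperations.RelC.zero {K : Type v} [Field K] {M : Cooperations.{v, u} K} :
    M.RelC 0 := by
  constructor <;> simp only [map_zero, add_zero]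

theorem Cooperations.RelO.add {K : Type v} [Field K] {M : Cooperations.{v, u} K}
    {x y : Tot M.D} (hx : M.RelO x) (hy : M.RelO y) : M.RelO (x + y) where
  assoc := by simp only [map_add, hx.assoc, hy.assoc]
  bracket := by simp only [map_add, hx.bracket, hy.bracket, add_zero]
  mul := by simp only [map_add, hx.mul, hy.mul]
  central := by simp only [map_add, hx.central, hy.central]

theorem Cooperations.RelO.zero {K : Type v} [Field K] {M : Cooperations.{v, u} K} :
    M.RelO 0 := by
  constructor <;> simp only [map_zero]

theorem Cooperations.IsSub.le_maxC {K : Type v} [Field K] {M : Cooperations.{v, u} K}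
    {N : ∀ n, Submodule K (M.C n)} {P : ∀ n, Submodule K (M.D n)} (h : M.IsSub N P) (n : ℤ) :
    N n ≤ M.maxC n :=
  le_sSup ⟨N, P, h, rfl⟩

theorem Cooperations.IsSub.le_maxO {K : Type v} [Field K] {M : Cooperations.{v, u} K}
    {N : ∀ n, Submodule K (M.C n)} {P : ∀ n, Submodule K (M.D n)} (h : M.IsSub N P) (n : ℤ) :
    P n ≤ M.maxO n :=
  le_sSup ⟨N, P, h, rfl⟩

theorem Cooperations.maxC_induction {K : Type v} [Field K] (M : Cooperations.{v, u} K) {n : ℤ}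
    {p : M.C n → Prop} (h : ∀ N P, M.IsSub N P → ∀ x ∈ N n, p x) (h0 : p 0)
    (ha : ∀ x y, p x → p y → p (x + y)) : ∀ x ∈ M.maxC n, p x := by
  intro x hx
  rw [Cooperations.maxC, sSup_eq_iSup'] at hx
  refine Submodule.iSup_induction _ (motive := p) hx ?_ h0 ha
  rintro ⟨_, N, P, hN, rfl⟩ y hy
  exact h N P hN y hy

theorem Cooperations.maxO_induction {K : Type v} [Field K] (M : Cooperations.{v, u} K) {n : ℤ}
    {p : M.D n → Prop} (h : ∀ N P, M.IsSub N P → ∀ x ∈ P n, p x) (h0 : p 0)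
    (ha : ∀ x y, p x → p y → p (x + y)) : ∀ x ∈ M.maxO n, p x := by
  intro x hx
  rw [Cooperations.maxO, sSup_eq_iSup'] at hx
  refine Submodule.iSup_induction _ (motive := p) hx ?_ h0 ha
  rintro ⟨_, N, P, hN, rfl⟩ y hy
  exact h N P hN y hy

theorem Cooperations.isSub_max {K : Type v} [Field K] (M : Cooperations.{v, u} K) :
    M.IsSub M.maxC M.maxO where
  Δc_mem n := M.maxC_induction
    (fun N P h x hx => subDeg_mono h.le_maxC _ (h.Δc_mem n x hx))
    (by simp only [map_zero]; exact Submodule.zero_mem _)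
    (fun x y hx hy => by simp only [map_add]; exact Submodule.add_mem _ hx hy)
  δc_mem n := M.maxC_induction
    (fun N P h x hx => subDeg_mono h.le_maxC _ (h.δc_mem n x hx))
    (by simp only [map_zero]; exact Submodule.zero_mem _)
    (fun x y hx hy => by simp only [map_add]; exact Submodule.add_mem _ hx hy)
  Δo_mem n := M.maxO_induction
    (fun N P h x hx => subDeg_mono h.le_maxO _ (h.Δo_mem n x hx))
    (by simp only [map_zero]; exact Submodule.zero_mem _)
    (fun x y hx hy => by simp only [map_add]; exact Submodule.add_mem _ hx hy)
  ρ_mem n := M.maxO_induction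
    (fun N P h x hx => Submodule.map_mono (h.le_maxC n) (h.ρ_mem n x hx))
    (by simp only [map_zero]; exact Submodule.zero_mem _)
    (fun x y hx hy => by simp only [map_add]; exact Submodule.add_mem _ hx hy)
  relC n := M.maxC_induction (fun N P h x hx => h.relC n x hx)
    (by simp only [map_zero]; exact .zero)
    (fun x y hx hy => by simp only [map_add]; exact hx.add hy)
  relO n := M.maxO_induction (fun N P h x hx => h.relO n x hx)
    (by simp only [map_zero]; exact .zero)
    (fun x y hx hy => by simp only [map_add]; exact hx.add hy)

/-- The restriction of a linear map `f : C → D` to subspaces, embedded by injective maps. -/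
def restrict {K : Type v} [Field K] {E F E' F' : Type u} [AddCommGroup E] [AddCommGroup F]
    [AddCommGroup E'] [AddCommGroup F'] [Module K E] [Module K F] [Module K E'] [Module K F']
    (i : E →ₗ[K] E') (j : F →ₗ[K] F') (hj : Function.Injective j) (f : E' →ₗ[K] F')
    (h : ∀ x, f (i x) ∈ LinearMap.range j) : E →ₗ[K] F :=
  (LinearEquiv.ofInjective j hj).symm.toLinearMap ∘ₗ
    (f ∘ₗ i).codRestrict (LinearMap.range j) h

theorem restrict_spec {K : Type v} [Field K] {E F E' F' : Type u} [AddCommGroup E]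
    [AddCommGroup F] [AddCommGroup E'] [AddCommGroup F'] [Module K E] [Module K F]
    [Module K E'] [Module K F']
    (i : E →ₗ[K] E') (j : F →ₗ[K] F') (hj : Function.Injective j) (f : E' →ₗ[K] F')
    (h : ∀ x, f (i x) ∈ LinearMap.range j) (x : E) : j (restrict i j hj f h x) = f (i x) := by
  have h1 := congrArg Subtype.val (LinearEquiv.apply_symm_apply (LinearEquiv.ofInjective j hj)
    ((f ∘ₗ i).codRestrict (LinearMap.range j) h x))
  simp [restrict] at h1 ⊢

theorem mem_range_of_inj {K : Type v} [Field K] {C : GrSpace.{v, u} K}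
    (N : ∀ n, Submodule K (C n)) {F F' : Type u} [AddCommGroup F] [AddCommGroup F']
    [Module K F] [Module K F'] (j : F →ₗ[K] F') (f : Tot C →ₗ[K] F')
    (h : ∀ n, ∀ x ∈ N n, f (inj C n x) ∈ LinearMap.range j) (x : Tot (sub N)) :
    f (incl N x) ∈ LinearMap.range j := by
  induction x using DirectSum.induction_on with
  | zero => simp
  | add a b ha hb => simpa only [map_add] using Submodule.add_mem _ ha hb
  | of n x =>
    have h1 := incl_inj N n x
    rw [show DirectSum.of (fun n => sub N n) n x = inj (sub N) n x from rfl, h1]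
    exact h n _ x.2

theorem swap_map {K : Type v} [Field K] {C D C' D' : GrSpace.{v, u} K}
    (f : ∀ n, C n →ₗ[K] C' n) (g : ∀ n, D n →ₗ[K] D' n) (z : Tot C ⊗[K] Tot D) :
    swap C' D' (TensorProduct.map (DirectSum.lmap f) (DirectSum.lmap g) z) =
      TensorProduct.map (DirectSum.lmap g) (DirectSum.lmap f) (swap C D z) := by
  have h : swap C' D' ∘ₗ TensorProduct.map (DirectSum.lmap f) (DirectSum.lmap g) =
      TensorProduct.map (DirectSum.lmap g) (DirectSum.lmap f) ∘ₗ swap C D := by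
    ext i a j b
    simp [swap, TensorProduct.gradedComm_of_tmul_of, DirectSum.lmap_lof]
  exact LinearMap.congr_fun h z

theorem sgn_map {K : Type v} [Field K] {C C' : GrSpace.{v, u} K}
    (f : ∀ n, C n →ₗ[K] C' n) (z : Tot C) :
    sgn C' (DirectSum.lmap f z) = DirectSum.lmap f (sgn C z) := by
  have h : sgn C' ∘ₗ DirectSum.lmap f = DirectSum.lmap f ∘ₗ sgn C := by
    ext i a
    simp [sgn, DirectSum.lmap_lof]
  exact LinearMap.congr_fun h z

theorem map_rTensor {K : Type v} [Field K] {E F E' F' G G' : Type u} [AddCommGroup E]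
    [AddCommGroup F] [AddCommGroup E'] [AddCommGroup F'] [AddCommGroup G] [AddCommGroup G']
    [Module K E] [Module K F] [Module K E'] [Module K F'] [Module K G] [Module K G']
    {i : E →ₗ[K] E'} {j : F →ₗ[K] F'} {f : E →ₗ[K] F} {f' : E' →ₗ[K] F'}
    (h : ∀ x, j (f x) = f' (i x)) (k : G →ₗ[K] G') (z : E ⊗[K] G) :
    f'.rTensor G' (TensorProduct.map i k z) = TensorProduct.map j k (f.rTensor G z) := by
  induction z using TensorProduct.induction_on with
  | zero => simp
  | add a b ha hb => simp only [map_add, ha, hb]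
  | tmul a b => simp [h]

theorem map_lTensor {K : Type v} [Field K] {E F E' F' G G' : Type u} [AddCommGroup E]
    [AddCommGroup F] [AddCommGroup E'] [AddCommGroup F'] [AddCommGroup G] [AddCommGroup G']
    [Module K E] [Module K F] [Module K E'] [Module K F'] [Module K G] [Module K G']
    {i : E →ₗ[K] E'} {j : F →ₗ[K] F'} {f : E →ₗ[K] F} {f' : E' →ₗ[K] F'}
    (h : ∀ x, j (f x) = f' (i x)) (k : G →ₗ[K] G') (z : G ⊗[K] E) :
    f'.lTensor G' (TensorProduct.map k i z) = TensorProduct.map k j (f.lTensor G z) := by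
  induction z using TensorProduct.induction_on with
  | zero => simp
  | add a b ha hb => simp only [map_add, ha, hb]
  | tmul a b => simp [h]

theorem map_map_assoc {K : Type v} [Field K] {E F : Type u} [AddCommGroup E]
    [AddCommGroup F] [Module K E] [Module K F] (i : E →ₗ[K] F) (z : (E ⊗[K] E) ⊗[K] E) :
    TensorProduct.assoc K F F F (TensorProduct.map (TensorProduct.map i i) i z) =
      TensorProduct.map i (TensorProduct.map i i) (TensorProduct.assoc K E E E z) :=
  (LinearMap.congr_fun (TensorProduct.map_map_comp_assoc_eq i i i) z).symm

theorem map_map_assoc_symm {K : Type v} [Field K] {E F : Type u} [AddCommGroup E]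
    [AddCommGroup F] [Module K E] [Module K F] (i : E →ₗ[K] F) (z : E ⊗[K] (E ⊗[K] E)) :
    (TensorProduct.assoc K F F F).symm (TensorProduct.map i (TensorProduct.map i i) z) =
      TensorProduct.map (TensorProduct.map i i) i ((TensorProduct.assoc K E E E).symm z) := by
  rw [LinearEquiv.symm_apply_eq, map_map_assoc, LinearEquiv.apply_symm_apply]

theorem swap12_map {K : Type v} [Field K] {C C' : GrSpace.{v, u} K}
    (f : ∀ n, C n →ₗ[K] C' n) (z : (Tot C ⊗[K] Tot C) ⊗[K] Tot C) :
    swap12 C' (TensorProduct.map (TensorProduct.map (DirectSum.lmap f) (DirectSum.lmap f))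
      (DirectSum.lmap f) z) =
    TensorProduct.map (TensorProduct.map (DirectSum.lmap f) (DirectSum.lmap f))
      (DirectSum.lmap f) (swap12 C z) :=
  map_rTensor (fun x => (swap_map f f x).symm) _ z

theorem cyc_map {K : Type v} [Field K] {C C' : GrSpace.{v, u} K}
    (f : ∀ n, C n →ₗ[K] C' n) (z : (Tot C ⊗[K] Tot C) ⊗[K] Tot C) :
    cyc C' (TensorProduct.map (TensorProduct.map (DirectSum.lmap f) (DirectSum.lmap f))
      (DirectSum.lmap f) z) =
    TensorProduct.map (TensorProduct.map (DirectSum.lmap f) (DirectSum.lmap f))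
      (DirectSum.lmap f) (cyc C z) := by
  simp only [cyc, swap23, LinearMap.comp_apply, LinearEquiv.coe_coe]
  rw [swap12_map, map_map_assoc, map_lTensor (fun x => (swap_map f f x).symm),
    map_map_assoc_symm]

/-- The relations can be checked after an injective degree `0` map of cooperations. -/
theorem Cooperations.RelC.of_map {K : Type v} [Field K] {M M' : Cooperations.{v, u} K}
    (f : ∀ n, M'.C n →ₗ[K] M.C n) (hf : Function.Injective (DirectSum.lmap f))
    (hΔ : ∀ x, TensorProduct.map (DirectSum.lmap f) (DirectSum.lmap f) (M'.Δc x) =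
      M.Δc (DirectSum.lmap f x))
    (hδ : ∀ x, TensorProduct.map (DirectSum.lmap f) (DirectSum.lmap f) (M'.δc x) =
      M.δc (DirectSum.lmap f x))
    (x : Tot M'.C) (h : M.RelC (DirectSum.lmap f x)) : M'.RelC x := by
  have i2 := TensorProduct.map_injective_of_flat_flat _ _ hf hf
  have i3 := TensorProduct.map_injective_of_flat_flat _ _ i2 hf
  have i3' := TensorProduct.map_injective_of_flat_flat _ _ hf i2
  have e1 : ∀ z, TensorProduct.map (DirectSum.lmap f)
      (TensorProduct.map (DirectSum.lmap f) (DirectSum.lmap f))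
        (TensorProduct.map (sgn M'.C) M'.δc z) = TensorProduct.map (sgn M.C) M.δc
        (TensorProduct.map (DirectSum.lmap f) (DirectSum.lmap f) z) := by
    intro z
    induction z using TensorProduct.induction_on with
    | zero => simp
    | add a b ha hb => simp only [map_add, ha, hb]
    | tmul a b => simp only [TensorProduct.map_tmul, hδ, sgn_map]
  refine ⟨i2 ?_, i3' ?_, i2 ?_, i3 ?_, i3 ?_⟩
  · rw [← swap_map, hΔ, h.comm]
  · rw [← map_map_assoc, ← map_rTensor hΔ, ← map_lTensor hΔ, hΔ, h.assoc]
  · rw [← swap_map, hδ, h.symm]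
  · simp only [map_add, map_zero, ← cyc_map]
    rw [← map_rTensor hδ, hδ, h.jacobi]
  · simp only [map_add, ← swap12_map, ← map_map_assoc_symm, e1]
    rw [← map_rTensor hδ, ← map_lTensor hΔ, hδ, hΔ, h.leibniz]

/-- The relations can be checked after an injective degree `0` map of cooperations. -/
theorem Cooperations.RelO.of_map {K : Type v} [Field K] {M M' : Cooperations.{v, u} K}
    (f : ∀ n, M'.C n →ₗ[K] M.C n) (hf : Function.Injective (DirectSum.lmap f))
    (g : ∀ n, M'.D n →ₗ[K] M.D n) (hg : Function.Injective (DirectSum.lmap g))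
    (hΔ : ∀ x, TensorProduct.map (DirectSum.lmap f) (DirectSum.lmap f) (M'.Δc x) =
      M.Δc (DirectSum.lmap f x))
    (hδ : ∀ x, TensorProduct.map (DirectSum.lmap f) (DirectSum.lmap f) (M'.δc x) =
      M.δc (DirectSum.lmap f x))
    (hΔo : ∀ y, TensorProduct.map (DirectSum.lmap g) (DirectSum.lmap g) (M'.Δo y) =
      M.Δo (DirectSum.lmap g y))
    (hρ : ∀ y, DirectSum.lmap f (M'.ρ y) = M.ρ (DirectSum.lmap g y))
    (y : Tot M'.D) (h : M.RelO (DirectSum.lmap g y)) : M'.RelO y := by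
  have i2 := TensorProduct.map_injective_of_flat_flat _ _ hf hf
  have i3' := TensorProduct.map_injective_of_flat_flat _ _ hg
    (TensorProduct.map_injective_of_flat_flat _ _ hg hg)
  have i4 := TensorProduct.map_injective_of_flat_flat _ _ hf hg
  have e1 : ∀ z, TensorProduct.map (DirectSum.lmap f) (DirectSum.lmap f)
        (TensorProduct.map M'.ρ M'.ρ z) = TensorProduct.map M.ρ M.ρ
        (TensorProduct.map (DirectSum.lmap g) (DirectSum.lmap g) z) := by
    intro z
    induction z using TensorProduct.induction_on with
    | zero => simp
    | add a b ha hb => simp only [map_add, ha, hb]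
    | tmul a b => simp only [TensorProduct.map_tmul, hρ]
  refine ⟨i3' ?_, i2 ?_, i2 ?_, i4 ?_⟩
  · rw [← map_map_assoc, ← map_rTensor hΔo, ← map_lTensor hΔo, hΔo, h.assoc]
  · rw [hδ, hρ, h.bracket, map_zero]
  · rw [hΔ, hρ, h.mul, e1, hΔo]
  · rw [← swap_map, ← map_rTensor hρ, ← map_lTensor hρ, hΔo, h.central]

theorem subDeg_le_range {K : Type v} [Field K] {C : GrSpace.{v, u} K}
    (N : ∀ n, Submodule K (C n)) (n : ℤ) :
    subDeg N n ≤ LinearMap.range (TensorProduct.map (incl N) (incl N)) :=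
  LinearMap.map_le_range

/-- A pair of graded subspaces closed under the cooperations, with the restricted
cooperations. -/
abbrev Cooperations.IsSub.ops {K : Type v} [Field K] {M : Cooperations.{v, u} K}
    {N : ∀ n, Submodule K (M.C n)} {P : ∀ n, Submodule K (M.D n)} (h : M.IsSub N P) :
    Cooperations.{v, u} K where
  C := sub N
  D := sub P
  Δc := restrict (incl N) (TensorProduct.map (incl N) (incl N)) (incl_incl_injective N N) M.Δc
    (mem_range_of_inj N _ _ fun n x hx => subDeg_le_range N _ (h.Δc_mem n x hx))
  δc := restrict (incl N) (TensorProduct.map (incl N) (incl N)) (incl_incl_injective N N) M.δc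
    (mem_range_of_inj N _ _ fun n x hx => subDeg_le_range N _ (h.δc_mem n x hx))
  Δo := restrict (incl P) (TensorProduct.map (incl P) (incl P)) (incl_incl_injective P P) M.Δo
    (mem_range_of_inj P _ _ fun n y hy => subDeg_le_range P _ (h.Δo_mem n y hy))
  ρ := restrict (incl P) (incl N) (incl_injective N) M.ρ
    (mem_range_of_inj P _ _ fun n y hy => by
      obtain ⟨x, hx, he⟩ := h.ρ_mem n y hy
      exact ⟨inj (sub N) n ⟨x, hx⟩, (incl_inj N n ⟨x, hx⟩).trans he⟩)

theorem Cooperations.IsSub.ops_Δc {K : Type v} [Field K] {M : Cooperations.{v, u} K}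
    {N : ∀ n, Submodule K (M.C n)} {P : ∀ n, Submodule K (M.D n)} (h : M.IsSub N P)
    (x : Tot (sub N)) :
    TensorProduct.map (incl N) (incl N) (h.ops.Δc x) = M.Δc (incl N x) :=
  restrict_spec _ _ _ _ _ x

theorem Cooperations.IsSub.ops_δc {K : Type v} [Field K] {M : Cooperations.{v, u} K}
    {N : ∀ n, Submodule K (M.C n)} {P : ∀ n, Submodule K (M.D n)} (h : M.IsSub N P)
    (x : Tot (sub N)) :
    TensorProduct.map (incl N) (incl N) (h.ops.δc x) = M.δc (incl N x) :=
  restrict_spec _ _ _ _ _ x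

theorem Cooperations.IsSub.ops_Δo {K : Type v} [Field K] {M : Cooperations.{v, u} K}
    {N : ∀ n, Submodule K (M.C n)} {P : ∀ n, Submodule K (M.D n)} (h : M.IsSub N P)
    (y : Tot (sub P)) :
    TensorProduct.map (incl P) (incl P) (h.ops.Δo y) = M.Δo (incl P y) :=
  restrict_spec _ _ _ _ _ y

theorem Cooperations.IsSub.ops_ρ {K : Type v} [Field K] {M : Cooperations.{v, u} K}
    {N : ∀ n, Submodule K (M.C n)} {P : ∀ n, Submodule K (M.D n)} (h : M.IsSub N P)
    (y : Tot (sub P)) : incl N (h.ops.ρ y) = M.ρ (incl P y) :=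
  restrict_spec _ _ _ _ _ y

theorem mem_tensorDeg_of_subDeg {K : Type v} [Field K] {C : GrSpace.{v, u} K}
    {N : ∀ n, Submodule K (C n)} {n : ℤ} {z : Tot (sub N) ⊗[K] Tot (sub N)}
    (h : TensorProduct.map (incl N) (incl N) z ∈ subDeg N n) :
    z ∈ tensorDeg (sub N) (sub N) n := by
  obtain ⟨w, hw, he⟩ := h
  rwa [← incl_incl_injective N N he]

theorem Cooperations.IsSub.relC_incl {K : Type v} [Field K] {M : Cooperations.{v, u} K}
    {N : ∀ n, Submodule K (M.C n)} {P : ∀ n, Submodule K (M.D n)} (h : M.IsSub N P)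
    (x : Tot (sub N)) : M.RelC (incl N x) := by
  induction x using DirectSum.induction_on with
  | zero => rw [map_zero]; exact .zero
  | add a b ha hb => rw [map_add]; exact ha.add hb
  | of n x => exact (incl_inj N n x).symm ▸ h.relC n _ x.2

theorem Cooperations.IsSub.relO_incl {K : Type v} [Field K] {M : Cooperations.{v, u} K}
    {N : ∀ n, Submodule K (M.C n)} {P : ∀ n, Submodule K (M.D n)} (h : M.IsSub N P)
    (y : Tot (sub P)) : M.RelO (incl P y) := by
  induction y using DirectSum.induction_on with
  | zero => rw [map_zero]; exact .zero
  | add a b ha hb => rw [map_add]; exact ha.add hb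
  | of n y => exact (incl_inj P n y).symm ▸ h.relO n _ y.2

/-- A pair of graded subspaces closed under the cooperations on which the relations hold, as
an `S`-coalgebra. -/
def Cooperations.IsSub.toSCoalgebra {K : Type v} [Field K] {M : Cooperations.{v, u} K}
    {N : ∀ n, Submodule K (M.C n)} {P : ∀ n, Submodule K (M.D n)} (h : M.IsSub N P) :
    SCoalgebra.{v, u} K where
  toCooperations := h.ops
  deg_Δc n x := mem_tensorDeg_of_subDeg (by
    rw [h.ops_Δc]
    exact (incl_inj N n x).symm ▸ h.Δc_mem n _ x.2)
  deg_δc n x := mem_tensorDeg_of_subDeg (by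
    rw [h.ops_δc]
    exact (incl_inj N n x).symm ▸ h.δc_mem n _ x.2)
  deg_Δo n y := mem_tensorDeg_of_subDeg (by
    rw [h.ops_Δo]
    exact (incl_inj P n y).symm ▸ h.Δo_mem n _ y.2)
  deg_ρ n y := by
    rw [add_zero]
    obtain ⟨x, hx, he⟩ := h.ρ_mem n y.1 y.2
    refine ⟨⟨x, hx⟩, incl_injective N ?_⟩
    rw [h.ops_ρ]
    exact (congrArg M.ρ (incl_inj P n y)).trans (he.symm.trans (incl_inj N n ⟨x, hx⟩).symm)
  relC x := Cooperations.RelC.of_map (M := M) (M' := h.ops) (fun n => (N n).subtype)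
    (incl_injective N) h.ops_Δc h.ops_δc x (h.relC_incl x)
  relO y := Cooperations.RelO.of_map (M := M) (M' := h.ops) (fun n => (N n).subtype)
    (incl_injective N) (fun n => (P n).subtype) (incl_injective P) h.ops_Δc h.ops_δc h.ops_Δo
    h.ops_ρ y (h.relO_incl y)

/-! ### The cofree `S`-coalgebra -/

/-- The cofree `S`-coalgebra `S(V, A)` cogenerated by a pair of graded vector spaces, in
desuspended form: the largest `S`-coalgebra contained in the coalgebra of all trees. (The
canonical map from a conilpotent `S`-coalgebra to the trees has an `S`-coalgebra as its image,
so it factors uniquely through this one.) -/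
def cofree {K : Type v} [Field K] (V A : GrSpace.{v, u} K) : SCoalgebra.{v, u} K :=
  (trees V A).isSub_max.toSCoalgebra

theorem leaf_mem {K : Type v} [Field K] (V A : GrSpace.{v, u} K) :
    (∀ i (x : V i), treeC V (.leaf i) (i - 2) rfl x ∈ (trees V A).maxC (i - 2)) ∧
    (∀ i (a : A i), treeO V A (.leaf i) (i - 1) rfl a ∈ (trees V A).maxO (i - 1)) := by
  let N : ∀ n, Submodule K ((trees V A).C n) := fun n =>
    LinearMap.ker ((trees V A).Δc ∘ₗ inj (trees V A).C n) ⊓ LinearMap.ker ((trees V A).δc ∘ₗ inj (trees V A).C n)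
  let P : ∀ n, Submodule K ((trees V A).D n) := fun n =>
    LinearMap.ker ((trees V A).Δo ∘ₗ inj (trees V A).D n) ⊓ LinearMap.ker ((trees V A).ρ ∘ₗ inj (trees V A).D n)
  have h : (trees V A).IsSub N P := by
    have a1 : ∀ n, ∀ x ∈ N n, (trees V A).Δc (inj (trees V A).C n x) = 0 := fun n x hx => hx.1
    have a2 : ∀ n, ∀ x ∈ N n, (trees V A).δc (inj (trees V A).C n x) = 0 := fun n x hx => hx.2
    have a3 : ∀ n, ∀ x ∈ P n, (trees V A).Δo (inj (trees V A).D n x) = 0 := fun n x hx => hx.1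
    have a4 : ∀ n, ∀ x ∈ P n, (trees V A).ρ (inj (trees V A).D n x) = 0 := fun n x hx => hx.2
    refine ⟨fun n x hx => ?_, fun n x hx => ?_, fun n x hx => ?_, fun n x hx => ?_,
      fun n x hx => ?_, fun n x hx => ?_⟩
    · rw [a1 n x hx]; exact Submodule.zero_mem _
    · rw [a2 n x hx]; exact Submodule.zero_mem _
    · rw [a3 n x hx]; exact Submodule.zero_mem _
    · rw [a4 n x hx]; exact Submodule.zero_mem _
    · constructor <;> simp only [a1 n x hx, a2 n x hx, map_zero, add_zero]
    · constructor <;> simp only [a3 n x hx, a4 n x hx, map_zero]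
  exact ⟨fun i x => h.le_maxC _
      ⟨treesΔc_tree V (.leaf i) _ rfl x, treesδc_tree V (.leaf i) _ rfl x⟩,
    fun i x => h.le_maxO _
      ⟨treesΔo_tree V A (.leaf i) _ rfl x, treesρ_tree V A (.leaf i) _ rfl x⟩⟩

/-- The inclusion of the cogenerators `s⁻² V` into `S(V, A)`, as a map on `V`. -/
def cogenC {K : Type v} [Field K] (V A : GrSpace.{v, u} K) (i : ℤ) :
    V i →ₗ[K] Tot (cofree V A).C :=
  inj (cofree V A).C (i - 2) ∘ₗ
    (treeC V (.leaf i) (i - 2) rfl).codRestrict ((trees V A).maxC (i - 2)) ((leaf_mem V A).1 i)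

/-- The inclusion of the cogenerators `s⁻¹ A` into `S(V, A)`, as a map on `A`. -/
def cogenO {K : Type v} [Field K] (V A : GrSpace.{v, u} K) (i : ℤ) :
    A i →ₗ[K] Tot (cofree V A).D :=
  inj (cofree V A).D (i - 1) ∘ₗ
    (treeO V A (.leaf i) (i - 1) rfl).codRestrict ((trees V A).maxO (i - 1))
      ((leaf_mem V A).2 i)

/-! ### `Ger⁺_∞`-algebras -/

/-- A `Ger⁺_∞`-algebra structure on a pair of cochain complexes `(V, A)`: a codifferential of
degree `1` on the cofree `S`-coalgebra `S(V, A)` which extends the differentials of `V` and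
`A`. -/
structure GerPlusStructure {K : Type v} [Field K] (V A : CochainComplex (ModuleCat.{u} K) ℤ)
    extends Codifferential (cofree V.X A.X) where
  extends_dV : ∀ (i : ℤ) (x : V.X i),
    Qc (cogenC V.X A.X i x) = cogenC V.X A.X (i + 1) (V.d i (i + 1) x)
  extends_dA : ∀ (i : ℤ) (a : A.X i),
    Qo (cogenO V.X A.X i a) = cogenO V.X A.X (i + 1) (A.d i (i + 1) a)

/-- A `Ger⁺_∞`-morphism `(V, A) → (V', A')`: a morphism `S(V, A) → S(V', A')` of
`S`-coalgebras which is compatible with the codifferentials. -/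
structure GerPlusMorphism {K : Type v} [Field K]
    {V A V' A' : CochainComplex (ModuleCat.{u} K) ℤ}
    (Q : GerPlusStructure V A) (Q' : GerPlusStructure V' A')
    extends SCoalgebra.Hom (cofree V.X A.X) (cofree V'.X A'.X) where
  comm_c : Tc ∘ₗ Q.Qc = Q'.Qc ∘ₗ Tc
  comm_o : To ∘ₗ Q.Qo = Q'.Qo ∘ₗ To

/-- The restrictions of a `Ger⁺_∞`-morphism to `V` and to `A` are the given chain maps. -/
structure GerPlusMorphism.Extends {K : Type v} [Field K]
    {V A V' A' : CochainComplex (ModuleCat.{u} K) ℤ}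
    {Q : GerPlusStructure V A} {Q' : GerPlusStructure V' A'} (T : GerPlusMorphism Q Q')
    (f : V ⟶ V') (g : A ⟶ A') : Prop where
  onV : ∀ (i : ℤ) (x : V.X i), T.Tc (cogenC V.X A.X i x) = cogenC V'.X A'.X i (f.f i x)
  onA : ∀ (i : ℤ) (a : A.X i), T.To (cogenO V.X A.X i a) = cogenO V'.X A'.X i (g.f i a)

/-- A `Ger⁺_∞`-morphism is a quasi-isomorphism if its restrictions `V → V'` and `A → A'` are
quasi-isomorphisms of cochain complexes. -/
def GerPlusMorphism.IsQuasiIso {K : Type v} [Field K]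
    {V A V' A' : CochainComplex (ModuleCat.{u} K) ℤ}
    {Q : GerPlusStructure V A} {Q' : GerPlusStructure V' A'} (T : GerPlusMorphism Q Q') : Prop :=
  ∃ (f : V ⟶ V') (g : A ⟶ A'), T.Extends f g ∧ QuasiIso f ∧ QuasiIso g

end GerPlus

end

noncomputable section

namespace GerPlus

/-! ### Complexes of vector spaces -/

section Complexes

variable {K : Type v} [Field K]

/-! The proof is homotopy transfer by an implicit equation. Over a field a quasi-isomorphism is a
homotopy equivalence, so there are a chain map `p : V' → V` and a homotopy `h` on `V'` with `f p - 1
= d h + h d`, and likewise `s` and `k` for `g` (`exists_homotopyInverse`). Maps into a cofree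
coalgebra are governed by their corestrictions, the composites with the projection `pr` to the
cogenerators. Write `pr Q' = d pr + m`, so that `m` vanishes on cogenerators. On color `c` the
morphism and the codifferential are prescribed by `pr T = f pr + h m T`, `pr Q = d pr + p m T`, and
on color `o` by the same formulas with `g`, `k`, `s`. The first equation can be solved by recursion:
since `m` kills cogenerators, `m T` at a tree only involves `T` on its branches.

From `Q'² = 0` one gets `m Q' = -d m`, and a short computation yields `pr (T Q - Q' T) = h m (T Q -
Q' T)` and, once `T Q = Q' T` is known, `pr Q² = 0` (`transfer_identity`). Now `T Q - Q' T` is a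
coderivation along `T`, and `Q²` is a coderivation. By induction over a conilpotent filtration all
cooperations may be assumed to vanish on the value at a given element. This value is then a
cogenerator, `m` vanishes on it, so its projection is zero and the value itself is zero
(`eq_zero_of_conilpotent`, `IsCoopHom.comm_of_primitive`, `IsCoder.comp_self_eq_zero`).

The relations of an `S`-coalgebra never have to be solved. The recursions take place in the
coalgebra of trees, where there are no relations and every corestriction of the right degree
integrates (`isCoopHom_map`, `isCoder_coder`); `m` is extended to all trees by an arbitrary graded
retraction. The return to the cofree `S`-coalgebra uses its maximality among the `S`-coalgebras
inside the trees. The image of an `S`-coalgebra under a morphism is again one, and so is the sum of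
an `S`-coalgebra and its image under a coderivation, because the relations are compatible with
morphisms and coderivations (`IsCoopHom.isSubTot_range`, `IsCoder.isSubTot`). Hence the tree maps
restrict (`IsCoopHom.exists_cofree`, `IsCoder.exists_cofree`). -/

theorem exists_pseudoinverse {E F : Type u} [AddCommGroup E] [AddCommGroup F] [Module K E]
    [Module K F] (d : E →ₗ[K] F) : ∃ s : F →ₗ[K] E, ∀ x, d (s (d x)) = d x := by
  obtain ⟨t, ht⟩ := d.rangeRestrict.exists_rightInverse_of_surjective d.range_rangeRestrict
  obtain ⟨r, hr⟩ := (LinearMap.range d).subtype.exists_leftInverse_of_injective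
    (LinearMap.range d).ker_subtype
  -- Here `r` projects `F` onto the image of `d`, and `t` is a section of `d` over that image.
  refine ⟨t ∘ₗ r, fun x => ?_⟩
  have h1 : r (d x) = d.rangeRestrict x := LinearMap.congr_fun hr (d.rangeRestrict x)
  have h2 := congrArg Subtype.val (LinearMap.congr_fun ht (d.rangeRestrict x))
  rw [LinearMap.comp_apply, h1]
  exact h2

/-- An acyclic complex of vector spaces is contractible. -/
theorem nonempty_contraction (L : CochainComplex (ModuleCat.{u} K) ℤ) (hL : L.Acyclic) :
    Nonempty (Homotopy (𝟙 L) 0) := by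
  choose s hs using fun i j => exists_pseudoinverse (L.d i j).hom
  -- The factor `1 - s d` maps into the cycles, since `d s d = d`. Pseudo-inverses alone would not
  -- give a contraction: `d s` is the identity only on boundaries.
  let t : ∀ i j, (ComplexShape.up ℤ).Rel j i → (L.X i ⟶ L.X j) := fun i j _ =>
    ModuleCat.ofHom (s j i ∘ₗ (LinearMap.id - s i (i + 1) ∘ₗ (L.d i (i + 1)).hom))
  have key : Homotopy.nullHomotopicMap' t = 𝟙 L := by
    ext i : 1
    obtain ⟨j, rfl⟩ : ∃ j, i = j + 1 := ⟨i - 1, by ring⟩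
    rw [Homotopy.nullHomotopicMap'_f (k₂ := j) (k₁ := j + 1) (k₀ := j + 1 + 1) rfl rfl]
    ext x
    -- The element `x - s d x` is a cycle, hence a boundary by acyclicity, and `d s` fixes it. This
    -- leaves `d t x + t d x = (x - s d x) + s d x`.
    obtain ⟨y, hy⟩ : ∃ y, L.d j (j + 1) y = x - s (j + 1) (j + 1 + 1) (L.d (j + 1) (j + 1 + 1) x) := by
      have h := (L.exactAt_iff' j (j + 1) (j + 1 + 1) (by simp) (by simp)).1 (hL (j + 1))
      refine (ShortComplex.moduleCat_exact_iff _).1 h _ ?_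
      change (L.d (j + 1) (j + 1 + 1)).hom _ = 0
      rw [map_sub]
      exact sub_eq_zero.2 (hs (j + 1) (j + 1 + 1) x).symm
    have h2 : L.d j (j + 1) (s j (j + 1) (L.d j (j + 1) y)) = L.d j (j + 1) y := hs j (j + 1) y
    rw [hy] at h2
    have h3 : L.d (j + 1 + 1) (j + 1 + 1 + 1) (L.d (j + 1) (j + 1 + 1) x) = 0 := by
      rw [← ModuleCat.comp_apply, L.d_comp_d]; rfl
    change s (j + 1) (j + 1 + 1) (L.d (j + 1) (j + 1 + 1) x -
      s (j + 1 + 1) (j + 1 + 1 + 1) (L.d (j + 1 + 1) (j + 1 + 1 + 1) (L.d (j + 1) (j + 1 + 1) x))) +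
      L.d j (j + 1) (s j (j + 1) (x - s (j + 1) (j + 1 + 1) (L.d (j + 1) (j + 1 + 1) x))) = x
    rw [h2, h3, map_zero, sub_zero]
    abel
  exact ⟨(Homotopy.ofEq key.symm).trans (Homotopy.nullHomotopy' t)⟩

/-- A map into an acyclic complex factors through a contractible one, hence is null-homotopic. The
point is that quasi-isomorphisms between K-projective complexes are homotopy equivalences. -/
theorem isKProjective_of_field (L : CochainComplex (ModuleCat.{u} K) ℤ) : L.IsKProjective where
  nonempty_homotopy_zero {M} f hM := by
    obtain ⟨c⟩ := nonempty_contraction M hM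
    exact ⟨(Homotopy.ofEq (Category.comp_id f).symm).trans
      ((c.compLeft f).trans (Homotopy.ofEq Limits.comp_zero))⟩

/-- The differential on the total space of a complex. -/
def totD (V : CochainComplex (ModuleCat.{u} K) ℤ) : Tot V.X →ₗ[K] Tot V.X :=
  DirectSum.toModule K ℤ _ fun i => inj V.X (i + 1) ∘ₗ (V.d i (i + 1)).hom

theorem totD_inj (V : CochainComplex (ModuleCat.{u} K) ℤ) (i : ℤ) (x : V.X i) :
    totD V (inj V.X i x) = inj V.X (i + 1) (V.d i (i + 1) x) :=
  DirectSum.toModule_lof K _ _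

theorem totD_comp_totD (V : CochainComplex (ModuleCat.{u} K) ℤ) : totD V ∘ₗ totD V = 0 := by
  refine DirectSum.linearMap_ext _ fun i => LinearMap.ext fun x => ?_
  change totD V (totD V (inj V.X i x)) = 0
  rw [totD_inj, totD_inj, ← ModuleCat.comp_apply, V.d_comp_d]
  exact map_zero _

theorem hasDegree_totD (V : CochainComplex (ModuleCat.{u} K) ℤ) : HasDegree 1 (totD V) :=
  fun i x => ⟨_, totD_inj V i x⟩

/-- A chain map on total spaces. -/
def totMap {V V' : CochainComplex (ModuleCat.{u} K) ℤ} (f : V ⟶ V') :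
    Tot V.X →ₗ[K] Tot V'.X :=
  DirectSum.lmap fun i => (f.f i).hom

theorem totMap_inj {V V' : CochainComplex (ModuleCat.{u} K) ℤ} (f : V ⟶ V') (i : ℤ)
    (x : V.X i) : totMap f (inj V.X i x) = inj V'.X i (f.f i x) :=
  DirectSum.lmap_lof (fun i => (f.f i).hom) i x

theorem hasDegree_totMap {V V' : CochainComplex (ModuleCat.{u} K) ℤ} (f : V ⟶ V') :
    HasDegree 0 (totMap f) := by
  intro i x
  rw [add_zero]
  exact ⟨_, totMap_inj f i x⟩

theorem totMap_totD {V V' : CochainComplex (ModuleCat.{u} K) ℤ} (f : V ⟶ V') (x : Tot V.X) :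
    totMap f (totD V x) = totD V' (totMap f x) := by
  refine LinearMap.congr_fun (f := totMap f ∘ₗ totD V) (g := totD V' ∘ₗ totMap f)
    (DirectSum.linearMap_ext _ fun i => LinearMap.ext fun x => ?_) x
  change totMap f (totD V (inj V.X i x)) = totD V' (totMap f (inj V.X i x))
  rw [totD_inj, totMap_inj, totMap_inj, totD_inj, ← ModuleCat.comp_apply, ← ModuleCat.comp_apply,
    f.comm]

/-- A quasi-isomorphism of complexes of vector spaces is a homotopy equivalence; on total
spaces, this gives a chain map `p` and an operator `h` with `f p - 1 = d h + h d`. -/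
theorem exists_homotopyInverse {V V' : CochainComplex (ModuleCat.{u} K) ℤ} (f : V ⟶ V')
    (hf : QuasiIso f) : ∃ (p : Tot V'.X →ₗ[K] Tot V.X) (h : Tot V'.X →ₗ[K] Tot V'.X),
      HasDegree 0 p ∧ HasDegree (-1) h ∧ (∀ x, totD V (p x) = p (totD V' x)) ∧
      ∀ x, totMap f (p x) = totD V' (h x) + h (totD V' x) + x := by
  have := isKProjective_of_field V
  have := isKProjective_of_field V'
  obtain ⟨e, rfl⟩ := (CochainComplex.IsKProjective.quasiIso_iff f).1 hf
  -- Only the homotopy on the target `V'` is kept; the one on `V` plays no role in the transfer.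
  let H := e.homotopyInvHomId
  let h : Tot V'.X →ₗ[K] Tot V'.X :=
    DirectSum.toModule K ℤ _ fun i => inj V'.X (i - 1) ∘ₗ (H.hom i (i - 1)).hom
  have hh : ∀ i j (_ : j + 1 = i) (x : V'.X i), h (inj V'.X i x) = inj V'.X j (H.hom i j x) := by
    rintro i j hj x
    obtain rfl : j = i - 1 := by omega
    exact DirectSum.toModule_lof K _ _
  refine ⟨totMap e.inv, h, hasDegree_totMap _, fun i x => ⟨_, hh i (i + -1) (by ring) x⟩,
    fun x => (totMap_totD _ x).symm, fun x => ?_⟩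
  refine LinearMap.congr_fun (f := totMap e.hom ∘ₗ totMap e.inv)
    (g := totD V' ∘ₗ h + h ∘ₗ totD V' + LinearMap.id)
    (DirectSum.linearMap_ext _ fun i => LinearMap.ext fun x => ?_) x
  change totMap e.hom (totMap e.inv (inj V'.X i x)) = totD V' (h (inj V'.X i x)) +
    h (totD V' (inj V'.X i x)) + inj V'.X i x
  obtain ⟨j, rfl⟩ : ∃ j, i = j + 1 := ⟨i - 1, by ring⟩
  rw [totMap_inj, totMap_inj, totD_inj, hh (j + 1) j rfl, hh (j + 1 + 1) (j + 1) rfl, totD_inj]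
  have hc := H.comm (j + 1)
  rw [dNext_eq H.hom (show (ComplexShape.up ℤ).Rel (j + 1) (j + 1 + 1) from rfl),
    prevD_eq H.hom (show (ComplexShape.up ℤ).Rel j (j + 1) from rfl)] at hc
  have hx := LinearMap.congr_fun (congrArg ModuleCat.Hom.hom hc) x
  simp only [← map_add]
  congr 1
  refine hx.trans ?_
  change H.hom (j + 1 + 1) (j + 1) (V'.d (j + 1) (j + 1 + 1) x) +
    V'.d j (j + 1) (H.hom (j + 1) j x) + x = _
  rw [add_comm (H.hom _ _ _)]

end Complexes

/-! ### Homogeneous maps and Koszul signs -/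

section Signs

variable {K : Type v} [Field K]

theorem tot_ext {C : GrSpace.{v, u} K} {E : Type*} [AddCommMonoid E] [Module K E]
    {f g : Tot C →ₗ[K] E} (h : ∀ n x, f (inj C n x) = g (inj C n x)) (x : Tot C) :
    f x = g x :=
  LinearMap.congr_fun (DirectSum.linearMap_ext _ fun n => LinearMap.ext fun x => h n x) x

theorem tmul_ext {E F G : Type*} [AddCommMonoid E] [AddCommMonoid F] [AddCommMonoid G]
    [Module K E] [Module K F] [Module K G] {f g : E ⊗[K] F →ₗ[K] G}
    (h : ∀ x y, f (x ⊗ₜ y) = g (x ⊗ₜ y)) (z : E ⊗[K] F) : f z = g z :=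
  LinearMap.congr_fun (TensorProduct.ext' h) z

theorem tot_tmul_ext {C D : GrSpace.{v, u} K} {E : Type*} [AddCommMonoid E] [Module K E]
    {f g : Tot C ⊗[K] Tot D →ₗ[K] E}
    (h : ∀ i a j b, f (inj C i a ⊗ₜ inj D j b) = g (inj C i a ⊗ₜ inj D j b))
    (z : Tot C ⊗[K] Tot D) : f z = g z := by
  refine tmul_ext (fun x y => ?_) z
  refine tot_ext (f := f ∘ₗ (TensorProduct.mk K _ _).flip y)
    (g := g ∘ₗ (TensorProduct.mk K _ _).flip y) (fun i a => ?_) x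
  exact tot_ext (f := f ∘ₗ TensorProduct.mk K _ _ (inj C i a))
    (g := g ∘ₗ TensorProduct.mk K _ _ (inj C i a)) (fun j b => h i a j b) y

theorem HasDegree.exists_eq {C D : GrSpace.{v, u} K} {d : ℤ} {f : Tot C →ₗ[K] Tot D}
    (hf : HasDegree d f) {n m : ℤ} (h : n + d = m) (x : C n) :
    ∃ y : D m, f (inj C n x) = inj D m y := by
  subst h
  exact hf n x

theorem HasDegree.comp {C D E : GrSpace.{v, u} K} {a b c : ℤ} {f : Tot C →ₗ[K] Tot D}
    {g : Tot D →ₗ[K] Tot E} (hg : HasDegree b g) (hf : HasDegree a f) (h : a + b = c) :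
    HasDegree c (g ∘ₗ f) := by
  intro n x
  obtain ⟨y, hy⟩ := hf n x
  obtain ⟨z, hz⟩ := hg.exists_eq (m := n + c) (by omega) y
  exact ⟨z, by rw [LinearMap.comp_apply, hy, hz]⟩

theorem HasDegree.add {C D : GrSpace.{v, u} K} {d : ℤ} {f g : Tot C →ₗ[K] Tot D}
    (hf : HasDegree d f) (hg : HasDegree d g) : HasDegree d (f + g) := by
  intro n x
  obtain ⟨y, hy⟩ := hf n x
  obtain ⟨z, hz⟩ := hg n x
  exact ⟨y + z, by rw [LinearMap.add_apply, hy, hz, map_add]⟩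

theorem HasDegree.sub {C D : GrSpace.{v, u} K} {d : ℤ} {f g : Tot C →ₗ[K] Tot D}
    (hf : HasDegree d f) (hg : HasDegree d g) : HasDegree d (f - g) := by
  intro n x
  obtain ⟨y, hy⟩ := hf n x
  obtain ⟨z, hz⟩ := hg n x
  exact ⟨y - z, by rw [LinearMap.sub_apply, hy, hz, map_sub]⟩

theorem hasDegree_id {C : GrSpace.{v, u} K} : HasDegree 0 (LinearMap.id : Tot C →ₗ[K] Tot C) := by
  intro n x
  rw [add_zero]
  exact ⟨x, rfl⟩

theorem hasDegree_lmap {C D : GrSpace.{v, u} K} (f : ∀ n, C n →ₗ[K] D n) :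
    HasDegree 0 (DirectSum.lmap f : Tot C →ₗ[K] Tot D) := by
  intro n x
  rw [add_zero]
  exact ⟨f n x, DirectSum.lmap_lof f n x⟩

/-- The naturality lemmas `swap_map`, `swap12_map` and `cyc_map` are phrased for `DirectSum.lmap`.
This makes them available for every map of degree 0. -/
theorem HasDegree.exists_lmap {C D : GrSpace.{v, u} K} {f : Tot C →ₗ[K] Tot D}
    (hf : HasDegree 0 f) : ∃ g : ∀ n, C n →ₗ[K] D n, f = DirectSum.lmap g := by
  refine ⟨fun n => DirectSum.component K ℤ (fun n => D n) n ∘ₗ f ∘ₗ inj C n,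
    LinearMap.ext (tot_ext fun n x => ?_)⟩
  obtain ⟨y, hy⟩ := hf.exists_eq (add_zero n) x
  rw [DirectSum.lmap_lof, hy]
  change inj D n y = inj D n (DirectSum.component K ℤ (fun n => D n) n (f (inj C n x)))
  rw [hy, DirectSum.component.lof_self]

/-- Homogeneous maps commute with taking components, up to the shift. It serves to show that images
of homogeneous maps are homogeneous subspaces. -/
theorem HasDegree.apply_component {C D : GrSpace.{v, u} K} {d : ℤ} {f : Tot C →ₗ[K] Tot D}
    (hf : HasDegree d f) {n m : ℤ} (h : n + d = m) (x : Tot C) :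
    f (inj C n (x n)) = inj D m (f x m) := by
  refine tot_ext (f := f ∘ₗ inj C n ∘ₗ DirectSum.component K ℤ (fun n => C n) n)
    (g := inj D m ∘ₗ DirectSum.component K ℤ (fun n => D n) m ∘ₗ f) (fun k y => ?_) x
  change f (inj C n (DirectSum.component K ℤ (fun n => C n) n (inj C k y))) =
    inj D m (DirectSum.component K ℤ (fun n => D n) m (f (inj C k y)))
  obtain ⟨z, hz⟩ := hf k y
  rw [hz]
  by_cases hk : k = n
  · subst hk; subst h
    rw [DirectSum.component.lof_self, DirectSum.component.lof_self, hz]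
  · rw [DirectSum.component.of, DirectSum.component.of, dif_neg hk, dif_neg (by omega), map_zero,
      map_zero, map_zero]

/-- The sign `(-1) ^ n` in `K`. -/
def ksign (K : Type v) [Field K] (n : ℤ) : K := ((n.negOnePow : ℤ) : K)

theorem ksign_add (m n : ℤ) : ksign K (m + n) = ksign K m * ksign K n := by
  simp [ksign, Int.negOnePow_add]

theorem ksign_one : ksign K 1 = -1 := by simp [ksign]

theorem ksign_mul_self (n : ℤ) : ksign K n * ksign K n = 1 := by
  rw [← ksign_add, ksign, Int.negOnePow_even _ ⟨n, rfl⟩]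
  simp

theorem sgn_inj (C : GrSpace.{v, u} K) (n : ℤ) (x : C n) :
    sgn C (inj C n x) = ksign K n • inj C n x := by
  refine (DirectSum.toModule_lof K _ _).trans ?_
  rw [LinearMap.smul_apply, ksign, Int.cast_smul_eq_zsmul]

theorem swap_inj (C D : GrSpace.{v, u} K) (i j : ℤ) (a : C i) (b : D j) :
    swap C D (inj C i a ⊗ₜ inj D j b) = ksign K (i * j) • (inj D j b ⊗ₜ inj C i a) := by
  rw [swap, LinearEquiv.coe_coe,
    TensorProduct.gradedComm_of_tmul_of K (fun n => C n) (fun n => D n) i j a b,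
    mul_comm j i, Units.smul_def]
  exact (Int.cast_smul_eq_zsmul K ((i * j).negOnePow : ℤ) (inj D j b ⊗ₜ[K] inj C i a)).symm

theorem sgn_sgn (C : GrSpace.{v, u} K) (x : Tot C) : sgn C (sgn C x) = x := by
  refine tot_ext (f := sgn C ∘ₗ sgn C) (g := LinearMap.id) (fun n x => ?_) x
  change sgn C (sgn C (inj C n x)) = inj C n x
  rw [sgn_inj, map_smul, sgn_inj, smul_smul, ksign_mul_self, one_smul]

theorem HasDegree.map_sgn {C D : GrSpace.{v, u} K} {d : ℤ} {f : Tot C →ₗ[K] Tot D}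
    (hf : HasDegree d f) (x : Tot C) : sgn D (f x) = ksign K d • f (sgn C x) := by
  refine tot_ext (f := sgn D ∘ₗ f) (g := ksign K d • (f ∘ₗ sgn C)) (fun n x => ?_) x
  change sgn D (f (inj C n x)) = ksign K d • f (sgn C (inj C n x))
  obtain ⟨y, hy⟩ := hf n x
  rw [sgn_inj, map_smul, hy, sgn_inj, smul_smul, ksign_add, mul_comm]

theorem HasDegree.map_sgn_zero {C D : GrSpace.{v, u} K} {f : Tot C →ₗ[K] Tot D}
    (hf : HasDegree 0 f) (x : Tot C) : sgn D (f x) = f (sgn C x) := by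
  rw [hf.map_sgn, ksign, Int.negOnePow_zero]
  simp

theorem HasDegree.map_sgn_one {C D : GrSpace.{v, u} K} {f : Tot C →ₗ[K] Tot D}
    (hf : HasDegree 1 f) (x : Tot C) : sgn D (f x) = - f (sgn C x) := by
  rw [hf.map_sgn, ksign_one, neg_one_smul]

/-- The sign of a homogeneous tensor. -/
theorem sgn_sgn_of_mem_tensorDeg {C D : GrSpace.{v, u} K} {n : ℤ} {z : Tot C ⊗[K] Tot D}
    (hz : z ∈ tensorDeg C D n) : TensorProduct.map (sgn C) (sgn D) z = ksign K n • z := by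
  have h : tensorDeg C D n ≤
      LinearMap.ker (TensorProduct.map (sgn C) (sgn D) - ksign K n • LinearMap.id) := by
    simp only [tensorDeg, iSup_le_iff]
    rintro p q rfl _ ⟨w, rfl⟩
    rw [LinearMap.mem_ker, LinearMap.sub_apply, sub_eq_zero]
    refine tmul_ext (f := TensorProduct.map (sgn C) (sgn D) ∘ₗ TensorProduct.map (inj C p) (inj D q))
      (g := (ksign K (p + q) • LinearMap.id) ∘ₗ TensorProduct.map (inj C p) (inj D q))
      (fun x y => ?_) w
    simp only [LinearMap.comp_apply, TensorProduct.map_tmul, sgn_inj, LinearMap.smul_apply,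
      LinearMap.id_apply, ksign_add, TensorProduct.smul_tmul_smul]
  exact sub_eq_zero.1 (h hz)

/-- The operator `Q ⊗ 1 + 1 ⊗ R` for operators of odd degree, with Koszul sign. -/
def tensorDer {C D : GrSpace.{v, u} K} (Q : Tot C →ₗ[K] Tot C) (R : Tot D →ₗ[K] Tot D) :
    Tot C ⊗[K] Tot D →ₗ[K] Tot C ⊗[K] Tot D :=
  Q.rTensor (Tot D) + TensorProduct.map (sgn C) R

theorem tensorDer_tmul {C D : GrSpace.{v, u} K} (Q : Tot C →ₗ[K] Tot C)
    (R : Tot D →ₗ[K] Tot D) (x : Tot C) (y : Tot D) :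
    tensorDer Q R (x ⊗ₜ y) = Q x ⊗ₜ y + sgn C x ⊗ₜ R y := rfl

/-- The switch exchanges the two summands. The sign carried by the second summand is exactly the
change of the Koszul sign of the switch when one factor is raised by one degree. -/
theorem swap_tensorDer {C D : GrSpace.{v, u} K} {Q : Tot C →ₗ[K] Tot C}
    {R : Tot D →ₗ[K] Tot D} (hQ : HasDegree 1 Q) (hR : HasDegree 1 R)
    (z : Tot C ⊗[K] Tot D) :
    swap C D (tensorDer Q R z) = tensorDer R Q (swap C D z) := by
  refine tot_tmul_ext (f := swap C D ∘ₗ tensorDer Q R) (g := tensorDer R Q ∘ₗ swap C D)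
    (fun i a j b => ?_) z
  obtain ⟨a', ha⟩ := hQ i a
  obtain ⟨b', hb⟩ := hR j b
  simp only [LinearMap.comp_apply, tensorDer_tmul, map_add, swap_inj, map_smul, ha, hb,
    sgn_inj, ← TensorProduct.smul_tmul', smul_add, smul_smul]
  rw [add_comm]
  have e1 : ksign K i * ksign K (i * (j + 1)) = ksign K (i * j) := by
    rw [mul_add, mul_one, ksign_add, mul_comm, mul_assoc, ksign_mul_self, mul_one]
  rw [e1, add_mul, one_mul, ksign_add]

theorem map_tensorDer {C D C' D' : GrSpace.{v, u} K} {f : Tot C →ₗ[K] Tot C'}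
    {g : Tot D →ₗ[K] Tot D'} (hf : HasDegree 0 f)
    {Q : Tot C →ₗ[K] Tot C} {R : Tot D →ₗ[K] Tot D} {Q' : Tot C' →ₗ[K] Tot C'}
    {R' : Tot D' →ₗ[K] Tot D'} (hQ : ∀ x, f (Q x) = Q' (f x)) (hR : ∀ x, g (R x) = R' (g x))
    (z : Tot C ⊗[K] Tot D) :
    TensorProduct.map f g (tensorDer Q R z) = tensorDer Q' R' (TensorProduct.map f g z) := by
  refine tmul_ext (f := TensorProduct.map f g ∘ₗ tensorDer Q R)
    (g := tensorDer Q' R' ∘ₗ TensorProduct.map f g) (fun x y => ?_) z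
  simp only [LinearMap.comp_apply, tensorDer_tmul, map_add, TensorProduct.map_tmul, hQ, hR,
    hf.map_sgn_zero]

/-- The mixed terms cancel because an operator of degree 1 anticommutes with the sign operator.
Hence the square of an odd coderivation is a coderivation without signs, which is why `Q² = 0` can
be tested on cogenerators. -/
theorem tensorDer_tensorDer {C D : GrSpace.{v, u} K} {Q : Tot C →ₗ[K] Tot C}
    {R : Tot D →ₗ[K] Tot D} (hQ : HasDegree 1 Q) (z : Tot C ⊗[K] Tot D) :
    tensorDer Q R (tensorDer Q R z) = (Q ∘ₗ Q).rTensor (Tot D) z +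
      TensorProduct.map LinearMap.id (R ∘ₗ R) z := by
  refine tmul_ext (f := tensorDer Q R ∘ₗ tensorDer Q R)
    (g := (Q ∘ₗ Q).rTensor (Tot D) + TensorProduct.map LinearMap.id (R ∘ₗ R)) (fun x y => ?_) z
  simp only [LinearMap.comp_apply, tensorDer_tmul, map_add, LinearMap.add_apply,
    LinearMap.rTensor_tmul, TensorProduct.map_tmul, LinearMap.id_apply, hQ.map_sgn_one, sgn_sgn,
    TensorProduct.neg_tmul]
  abel

/-- The operator `Q ⊗ 1 ⊗ 1 + 1 ⊗ Q ⊗ 1 + 1 ⊗ 1 ⊗ Q` on `(C ⊗ C) ⊗ C`. -/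
def tensorDerL {C : GrSpace.{v, u} K} (Q : Tot C →ₗ[K] Tot C) :
    (Tot C ⊗[K] Tot C) ⊗[K] Tot C →ₗ[K] (Tot C ⊗[K] Tot C) ⊗[K] Tot C :=
  (tensorDer Q Q).rTensor (Tot C) +
    TensorProduct.map (TensorProduct.map (sgn C) (sgn C)) Q

/-- The operator `Q ⊗ 1 ⊗ 1 + 1 ⊗ Q ⊗ 1 + 1 ⊗ 1 ⊗ Q` on `C ⊗ (C ⊗ C)`. -/
def tensorDerR {C : GrSpace.{v, u} K} (Q : Tot C →ₗ[K] Tot C) :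
    Tot C ⊗[K] (Tot C ⊗[K] Tot C) →ₗ[K] Tot C ⊗[K] (Tot C ⊗[K] Tot C) :=
  Q.rTensor (Tot C ⊗[K] Tot C) + TensorProduct.map (sgn C) (tensorDer Q Q)

theorem assoc_tensorDerL {C : GrSpace.{v, u} K} (Q : Tot C →ₗ[K] Tot C)
    (z : (Tot C ⊗[K] Tot C) ⊗[K] Tot C) :
    TensorProduct.assoc K _ _ _ (tensorDerL Q z) =
      tensorDerR Q (TensorProduct.assoc K _ _ _ z) := by
  refine LinearMap.congr_fun (f := (TensorProduct.assoc K _ _ _).toLinearMap ∘ₗ tensorDerL Q)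
    (g := tensorDerR Q ∘ₗ (TensorProduct.assoc K _ _ _).toLinearMap)
    (TensorProduct.ext_threefold fun a b c => ?_) z
  simp only [LinearMap.comp_apply, LinearEquiv.coe_coe, tensorDerL, tensorDerR,
    LinearMap.add_apply, LinearMap.rTensor_tmul, TensorProduct.map_tmul,
    TensorProduct.assoc_tmul, tensorDer_tmul, map_add, TensorProduct.add_tmul,
    TensorProduct.tmul_add]
  abel

theorem assoc_symm_tensorDerR {C : GrSpace.{v, u} K} (Q : Tot C →ₗ[K] Tot C)
    (z : Tot C ⊗[K] (Tot C ⊗[K] Tot C)) :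
    (TensorProduct.assoc K _ _ _).symm (tensorDerR Q z) =
      tensorDerL Q ((TensorProduct.assoc K _ _ _).symm z) := by
  rw [LinearEquiv.symm_apply_eq, assoc_tensorDerL, LinearEquiv.apply_symm_apply]

theorem swap_sgn_sgn (C D : GrSpace.{v, u} K) (z : Tot C ⊗[K] Tot D) :
    swap C D (TensorProduct.map (sgn C) (sgn D) z) =
      TensorProduct.map (sgn D) (sgn C) (swap C D z) := by
  refine tot_tmul_ext (f := swap C D ∘ₗ TensorProduct.map (sgn C) (sgn D))
    (g := TensorProduct.map (sgn D) (sgn C) ∘ₗ swap C D) (fun i a j b => ?_) z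
  simp only [LinearMap.comp_apply, TensorProduct.map_tmul, sgn_inj, swap_inj, map_smul,
    ← TensorProduct.smul_tmul', TensorProduct.tmul_smul, smul_smul]
  congr 1
  ring

theorem swap12_tensorDerL {C : GrSpace.{v, u} K} {Q : Tot C →ₗ[K] Tot C} (hQ : HasDegree 1 Q)
    (z : (Tot C ⊗[K] Tot C) ⊗[K] Tot C) :
    swap12 C (tensorDerL Q z) = tensorDerL Q (swap12 C z) := by
  refine tmul_ext (f := swap12 C ∘ₗ tensorDerL Q) (g := tensorDerL Q ∘ₗ swap12 C)
    (fun x y => ?_) z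
  simp only [LinearMap.comp_apply, tensorDerL, swap12, LinearMap.add_apply,
    LinearMap.rTensor_tmul, TensorProduct.map_tmul, map_add, swap_tensorDer hQ hQ, swap_sgn_sgn]

theorem swap23_tensorDerL {C : GrSpace.{v, u} K} {Q : Tot C →ₗ[K] Tot C} (hQ : HasDegree 1 Q)
    (z : (Tot C ⊗[K] Tot C) ⊗[K] Tot C) :
    swap23 C (tensorDerL Q z) = tensorDerL Q (swap23 C z) := by
  have h : ∀ z, (swap C C).lTensor (Tot C) (tensorDerR Q z) =
      tensorDerR Q ((swap C C).lTensor (Tot C) z) := by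
    refine tmul_ext (f := (swap C C).lTensor (Tot C) ∘ₗ tensorDerR Q)
      (g := tensorDerR Q ∘ₗ (swap C C).lTensor (Tot C)) fun x y => ?_
    simp only [LinearMap.comp_apply, tensorDerR, LinearMap.add_apply,
      LinearMap.rTensor_tmul, LinearMap.lTensor_tmul, TensorProduct.map_tmul, map_add,
      swap_tensorDer hQ hQ]
  simp only [swap23, LinearMap.comp_apply, LinearEquiv.coe_coe]
  rw [assoc_tensorDerL, h, assoc_symm_tensorDerR]

theorem cyc_tensorDerL {C : GrSpace.{v, u} K} {Q : Tot C →ₗ[K] Tot C} (hQ : HasDegree 1 Q)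
    (z : (Tot C ⊗[K] Tot C) ⊗[K] Tot C) :
    cyc C (tensorDerL Q z) = tensorDerL Q (cyc C z) := by
  rw [cyc, LinearMap.comp_apply, LinearMap.comp_apply, swap12_tensorDerL hQ, swap23_tensorDerL hQ]

end Signs

/-! ### Morphisms and coderivations -/

section Morphisms

variable {K : Type v} [Field K]

/-- The cooperations have the degrees `0`, `-1`, `0`, `0`. -/
structure Cooperations.IsGraded (M : Cooperations.{v, u} K) : Prop where
  deg_Δc : ∀ (n : ℤ) (x : M.C n), M.Δc (inj M.C n x) ∈ tensorDeg M.C M.C n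
  deg_δc : ∀ (n : ℤ) (x : M.C n), M.δc (inj M.C n x) ∈ tensorDeg M.C M.C (n - 1)
  deg_Δo : ∀ (n : ℤ) (y : M.D n), M.Δo (inj M.D n y) ∈ tensorDeg M.D M.D n
  deg_ρ : HasDegree 0 M.ρ

/-- A pair of degree `0` maps is compatible with the cooperations. -/
structure IsCoopHom (M M' : Cooperations.{v, u} K) (Tc : Tot M.C →ₗ[K] Tot M'.C)
    (To : Tot M.D →ₗ[K] Tot M'.D) : Prop where
  deg_c : HasDegree 0 Tc
  deg_o : HasDegree 0 To
  map_Δc : ∀ x, M'.Δc (Tc x) = TensorProduct.map Tc Tc (M.Δc x)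
  map_δc : ∀ x, M'.δc (Tc x) = TensorProduct.map Tc Tc (M.δc x)
  map_Δo : ∀ y, M'.Δo (To y) = TensorProduct.map To To (M.Δo y)
  map_ρ : ∀ y, M'.ρ (To y) = Tc (M.ρ y)

/-- A pair of degree `1` maps is a coderivation with respect to the cooperations. -/
structure IsCoder (M : Cooperations.{v, u} K) (Qc : Tot M.C →ₗ[K] Tot M.C)
    (Qo : Tot M.D →ₗ[K] Tot M.D) : Prop where
  deg_c : HasDegree 1 Qc
  deg_o : HasDegree 1 Qo
  coder_Δc : ∀ x, M.Δc (Qc x) = tensorDer Qc Qc (M.Δc x)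
  coder_δc : ∀ x, M.δc (Qc x) = -tensorDer Qc Qc (M.δc x)
  coder_Δo : ∀ y, M.Δo (Qo y) = tensorDer Qo Qo (M.Δo y)
  coder_ρ : ∀ y, M.ρ (Qo y) = Qc (M.ρ y)

/-- Each relation at `Tc x` is the image, under the tensor power of `Tc`, of the same relation at
`x`. Pushing a relation forward needs no injectivity, in contrast to `Cooperations.RelC.of_map`. -/
theorem IsCoopHom.relC {M M' : Cooperations.{v, u} K} {Tc : Tot M.C →ₗ[K] Tot M'.C}
    {To : Tot M.D →ₗ[K] Tot M'.D} (h : IsCoopHom M M' Tc To) {x : Tot M.C} (hx : M.RelC x) :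
    M'.RelC (Tc x) := by
  have hΔ : ∀ x, TensorProduct.map Tc Tc (M.Δc x) = M'.Δc (Tc x) := fun x => (h.map_Δc x).symm
  have hδ : ∀ x, TensorProduct.map Tc Tc (M.δc x) = M'.δc (Tc x) := fun x => (h.map_δc x).symm
  have e1 : ∀ z, TensorProduct.map Tc (TensorProduct.map Tc Tc)
        (TensorProduct.map (sgn M.C) M.δc z) = TensorProduct.map (sgn M'.C) M'.δc
        (TensorProduct.map Tc Tc z) := by
    refine tmul_ext (f := TensorProduct.map Tc (TensorProduct.map Tc Tc) ∘ₗ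
        TensorProduct.map (sgn M.C) M.δc)
      (g := TensorProduct.map (sgn M'.C) M'.δc ∘ₗ TensorProduct.map Tc Tc) fun a b => ?_
    simp only [LinearMap.comp_apply, TensorProduct.map_tmul, hδ, h.deg_c.map_sgn_zero]
  obtain ⟨t, ht⟩ := h.deg_c.exists_lmap
  subst ht
  refine ⟨?_, ?_, ?_, ?_, ?_⟩
  · rw [← hΔ, swap_map, hx.comm]
  · rw [← hΔ, map_rTensor hΔ, map_lTensor hΔ, map_map_assoc, hx.assoc]
  · rw [← hδ, swap_map, hx.symm]
  · rw [← hδ, map_rTensor hδ, cyc_map, cyc_map, ← map_add, ← map_add, hx.jacobi, map_zero]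
  · rw [← hδ, ← hΔ, map_rTensor hδ, map_lTensor hΔ, ← e1, map_map_assoc_symm, map_map_assoc_symm,
      swap12_map, ← map_add, hx.leibniz]

theorem IsCoopHom.relO {M M' : Cooperations.{v, u} K} {Tc : Tot M.C →ₗ[K] Tot M'.C}
    {To : Tot M.D →ₗ[K] Tot M'.D} (h : IsCoopHom M M' Tc To) {y : Tot M.D} (hy : M.RelO y) :
    M'.RelO (To y) := by
  have hΔ : ∀ x, TensorProduct.map To To (M.Δo x) = M'.Δo (To x) := fun x => (h.map_Δo x).symm
  have hρ : ∀ x, Tc (M.ρ x) = M'.ρ (To x) := fun x => (h.map_ρ x).symm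
  have e1 : ∀ z, TensorProduct.map Tc Tc (TensorProduct.map M.ρ M.ρ z) =
      TensorProduct.map M'.ρ M'.ρ (TensorProduct.map To To z) := by
    refine tmul_ext (f := TensorProduct.map Tc Tc ∘ₗ TensorProduct.map M.ρ M.ρ)
      (g := TensorProduct.map M'.ρ M'.ρ ∘ₗ TensorProduct.map To To) fun a b => ?_
    simp only [LinearMap.comp_apply, TensorProduct.map_tmul, hρ]
  obtain ⟨hc, ho, hΔc, hδc, -, -⟩ := h
  obtain ⟨t, ht⟩ := hc.exists_lmap
  obtain ⟨s, hs⟩ := ho.exists_lmap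
  subst ht; subst hs
  refine ⟨?_, ?_, ?_, ?_⟩
  · rw [← hΔ, map_rTensor hΔ, map_lTensor hΔ, map_map_assoc, hy.assoc]
  · rw [← hρ, hδc, hy.bracket, map_zero]
  · rw [← hρ, hΔc, hy.mul, e1, hΔ]
  · rw [← hΔ, map_rTensor hρ, map_lTensor hρ, swap_map, hy.central]

/-- On a tensor product, `sgn ⊗ sgn` is the sign operator for the total degree, so a cooperation of
degree `d` commutes with signs up to `(-1) ^ d`. -/
theorem sgn_sgn_of_deg {C : GrSpace.{v, u} K} {d : ℤ} {φ : Tot C →ₗ[K] Tot C ⊗[K] Tot C}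
    (h : ∀ n x, φ (inj C n x) ∈ tensorDeg C C (n + d)) (x : Tot C) :
    TensorProduct.map (sgn C) (sgn C) (φ x) = ksign K d • φ (sgn C x) := by
  refine tot_ext (f := TensorProduct.map (sgn C) (sgn C) ∘ₗ φ)
    (g := ksign K d • (φ ∘ₗ sgn C)) (fun n x => ?_) x
  change TensorProduct.map (sgn C) (sgn C) (φ (inj C n x)) = ksign K d • φ (sgn C (inj C n x))
  rw [sgn_sgn_of_mem_tensorDeg (h n x), sgn_inj, map_smul, smul_smul, ksign_add, mul_comm]

/-- The scalar `s` treats even and odd cooperations together. It occurs once as the sign for passing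
`Q` through `φ` and once for passing the sign operator through `φ`; `s * s = 1` gives both summands
the common factor `s`. -/
theorem rTensor_tensorDer {C : GrSpace.{v, u} K} {φ : Tot C →ₗ[K] Tot C ⊗[K] Tot C}
    {Q : Tot C →ₗ[K] Tot C} {s : K} (hQ : ∀ x, φ (Q x) = s • tensorDer Q Q (φ x))
    (hs : ∀ x, TensorProduct.map (sgn C) (sgn C) (φ x) = s • φ (sgn C x)) (h1 : s * s = 1)
    (z : Tot C ⊗[K] Tot C) :
    φ.rTensor (Tot C) (tensorDer Q Q z) = s • tensorDerL Q (φ.rTensor (Tot C) z) := by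
  refine tmul_ext (f := φ.rTensor (Tot C) ∘ₗ tensorDer Q Q)
    (g := s • (tensorDerL Q ∘ₗ φ.rTensor (Tot C))) (fun a b => ?_) z
  simp only [LinearMap.comp_apply, LinearMap.smul_apply, tensorDer_tmul, map_add,
    LinearMap.rTensor_tmul, tensorDerL, LinearMap.add_apply, TensorProduct.map_tmul, hQ, hs,
    ← TensorProduct.smul_tmul', smul_add, smul_smul, h1, one_smul]

theorem lTensor_tensorDer {C : GrSpace.{v, u} K} {φ : Tot C →ₗ[K] Tot C ⊗[K] Tot C}
    {Q : Tot C →ₗ[K] Tot C} (hQ : ∀ x, φ (Q x) = tensorDer Q Q (φ x)) (z : Tot C ⊗[K] Tot C) :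
    φ.lTensor (Tot C) (tensorDer Q Q z) = tensorDerR Q (φ.lTensor (Tot C) z) := by
  refine tmul_ext (f := φ.lTensor (Tot C) ∘ₗ tensorDer Q Q)
    (g := tensorDerR Q ∘ₗ φ.lTensor (Tot C)) (fun a b => ?_) z
  simp only [LinearMap.comp_apply, tensorDer_tmul, map_add, LinearMap.lTensor_tmul,
    LinearMap.rTensor_tmul, tensorDerR, LinearMap.add_apply, TensorProduct.map_tmul, hQ]

/-- For odd `φ` the operator `id ⊗ φ` is `map (sgn C) φ`. Moving the odd `Q` past it costs a sign in
each summand: in the first from the sign operator, in the second from the coderivation rule. -/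
theorem map_sgn_tensorDer {C : GrSpace.{v, u} K} {φ : Tot C →ₗ[K] Tot C ⊗[K] Tot C}
    {Q : Tot C →ₗ[K] Tot C} (hd : HasDegree 1 Q) (hQ : ∀ x, φ (Q x) = -tensorDer Q Q (φ x))
    (z : Tot C ⊗[K] Tot C) :
    TensorProduct.map (sgn C) φ (tensorDer Q Q z) =
      -tensorDerR Q (TensorProduct.map (sgn C) φ z) := by
  refine tmul_ext (f := TensorProduct.map (sgn C) φ ∘ₗ tensorDer Q Q)
    (g := -(tensorDerR Q ∘ₗ TensorProduct.map (sgn C) φ)) (fun a b => ?_) z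
  simp only [LinearMap.comp_apply, LinearMap.neg_apply, tensorDer_tmul, map_add,
    LinearMap.rTensor_tmul, tensorDerR, LinearMap.add_apply, TensorProduct.map_tmul, hQ,
    hd.map_sgn_one, TensorProduct.neg_tmul, TensorProduct.tmul_neg, neg_add]

/-- Cooperations and permutations commute, up to sign, with the extension of `Qc` to tensor powers.
All terms of one relation receive the same sign, so the relation at `Qc x` is obtained by applying
that extension to the relation at `x`. Only the single element `x` has to satisfy the relations,
which matters because they fail on general trees. -/
theorem IsCoder.relC {M : Cooperations.{v, u} K} (hM : M.IsGraded) {Qc : Tot M.C →ₗ[K] Tot M.C}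
    {Qo : Tot M.D →ₗ[K] Tot M.D} (h : IsCoder M Qc Qo) {x : Tot M.C} (hx : M.RelC x) :
    M.RelC (Qc x) := by
  have rΔ := rTensor_tensorDer (φ := M.Δc) (Q := Qc) (s := (1 : K)) (fun x => by rw [h.coder_Δc, one_smul])
    (fun x => by
      rw [sgn_sgn_of_deg (d := 0) fun n x => by rw [add_zero]; exact hM.deg_Δc n x]
      simp [ksign]) (one_mul 1)
  have rδ := rTensor_tensorDer (φ := M.δc) (Q := Qc) (s := (-1 : K)) 
    (fun x => (h.coder_δc x).trans (neg_one_smul K _).symm)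
    (fun x => by
      rw [sgn_sgn_of_deg (d := -1) fun n x => hM.deg_δc n x]
      simp [ksign]) (by ring)
  have lΔ := lTensor_tensorDer h.coder_Δc
  have lδ := map_sgn_tensorDer h.deg_c h.coder_δc
  simp only [one_smul] at rΔ
  have n2 : ∀ z : (Tot M.C ⊗[K] Tot M.C) ⊗[K] Tot M.C, - -z = z := fun z => neg_neg z
  have n3 : ∀ z w : (Tot M.C ⊗[K] Tot M.C) ⊗[K] Tot M.C, -(z + w) = -z + -w :=
    fun z w => neg_add z w
  have rδ : ∀ z, M.δc.rTensor (Tot M.C) (tensorDer Qc Qc z) =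
      -tensorDerL Qc (M.δc.rTensor (Tot M.C) z) := fun z =>
    (rδ z).trans (neg_one_smul K (M := (Tot M.C ⊗[K] Tot M.C) ⊗[K] Tot M.C) _)
  refine ⟨?_, ?_, ?_, ?_, ?_⟩
  · rw [h.coder_Δc, swap_tensorDer h.deg_c h.deg_c, hx.comm]
  · rw [h.coder_Δc, rΔ, lΔ, assoc_tensorDerL, hx.assoc]
  · rw [h.coder_δc, map_neg, swap_tensorDer h.deg_c h.deg_c, hx.symm]
  -- The cobracket occurs twice in every term, so the two signs cancel.
  · rw [h.coder_δc, map_neg, rδ, n2, cyc_tensorDerL h.deg_c, cyc_tensorDerL h.deg_c,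
      ← map_add, ← map_add, hx.jacobi, map_zero]
  -- The cobracket occurs exactly once in every term, so both sides change sign.
  · rw [h.coder_δc, h.coder_Δc, map_neg, map_neg, lΔ, rδ, lδ, map_neg, map_neg,
      assoc_symm_tensorDerR, assoc_symm_tensorDerR, swap12_tensorDerL h.deg_c, hx.leibniz,
      map_add, n3]

theorem IsCoder.relO {M : Cooperations.{v, u} K} (hM : M.IsGraded) {Qc : Tot M.C →ₗ[K] Tot M.C}
    {Qo : Tot M.D →ₗ[K] Tot M.D} (h : IsCoder M Qc Qo) {y : Tot M.D} (hy : M.RelO y) :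
    M.RelO (Qo y) := by
  have rΔ := rTensor_tensorDer (φ := M.Δo) (Q := Qo) (s := (1 : K)) (fun x => by rw [h.coder_Δo, one_smul])
    (fun x => by
      rw [sgn_sgn_of_deg (d := 0) fun n x => by rw [add_zero]; exact hM.deg_Δo n x]
      simp [ksign]) (one_mul 1)
  have lΔ := lTensor_tensorDer h.coder_Δo
  simp only [one_smul] at rΔ
  refine ⟨?_, ?_, ?_, ?_⟩
  · rw [h.coder_Δo, rΔ, lΔ, assoc_tensorDerL, hy.assoc]
  · rw [h.coder_ρ, h.coder_δc, hy.bracket, map_zero, neg_zero]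
  · rw [h.coder_ρ, h.coder_Δc, hy.mul, h.coder_Δo,
      map_tensorDer hM.deg_ρ h.coder_ρ h.coder_ρ]
  · rw [h.coder_Δo, LinearMap.rTensor, LinearMap.lTensor,
      map_tensorDer (g := LinearMap.id) (R' := Qo) hM.deg_ρ h.coder_ρ (fun _ => rfl),
      map_tensorDer (f := LinearMap.id) (Q' := Qo) hasDegree_id (fun _ => rfl) h.coder_ρ,
      swap_tensorDer h.deg_o h.deg_c]
    exact congrArg _ hy.central

/-! ### Subcoalgebras of the total space -/

/-- The projection of a tensor product onto its degree `n` component. -/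
def tensorProj (C D : GrSpace.{v, u} K) (n : ℤ) :
    Tot C ⊗[K] Tot D →ₗ[K] Tot C ⊗[K] Tot D :=
  TensorProduct.lift (DirectSum.toModule K ℤ _ fun p =>
    (TensorProduct.mk K (Tot C) (Tot D)).compl₂
      (inj D (n - p) ∘ₗ DirectSum.component K ℤ (fun n => D n) (n - p)) ∘ₗ inj C p)

theorem tensorProj_inj_tmul (C D : GrSpace.{v, u} K) (n p : ℤ) (a : C p) (b : Tot D) :
    tensorProj C D n (inj C p a ⊗ₜ b) = inj C p a ⊗ₜ inj D (n - p) (b (n - p)) := by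
  rw [tensorProj, TensorProduct.lift.tmul, DirectSum.toModule_lof]
  rfl

theorem tensorProj_of_mem {C D : GrSpace.{v, u} K} {n : ℤ} {z : Tot C ⊗[K] Tot D}
    (hz : z ∈ tensorDeg C D n) : tensorProj C D n z = z := by
  have h : tensorDeg C D n ≤ LinearMap.ker (tensorProj C D n - LinearMap.id) := by
    simp only [tensorDeg, iSup_le_iff]
    rintro p q rfl _ ⟨w, rfl⟩
    rw [LinearMap.mem_ker, LinearMap.sub_apply, sub_eq_zero]
    refine tmul_ext (f := tensorProj C D (p + q) ∘ₗ TensorProduct.map (inj C p) (inj D q))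
      (g := TensorProduct.map (inj C p) (inj D q)) (fun x y => ?_) w
    rw [LinearMap.comp_apply, TensorProduct.map_tmul, tensorProj_inj_tmul,
      show p + q - p = q by ring]
    congr 2
    exact DirectSum.component.lof_self K (M := fun n => D n) q y
  exact sub_eq_zero.1 (h hz)

theorem tmul_mem_subDeg {C : GrSpace.{v, u} K} {N : ∀ n, Submodule K (C n)} {p q n : ℤ}
    (h : p + q = n) {a : C p} {b : C q} (ha : a ∈ N p) (hb : b ∈ N q) :
    inj C p a ⊗ₜ[K] inj C q b ∈ subDeg N n := by
  refine ⟨inj (sub N) p ⟨a, ha⟩ ⊗ₜ inj (sub N) q ⟨b, hb⟩, ?_, ?_⟩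
  · exact Submodule.mem_iSup_of_mem p (Submodule.mem_iSup_of_mem q
      (Submodule.mem_iSup_of_mem h ⟨⟨a, ha⟩ ⊗ₜ ⟨b, hb⟩, rfl⟩))
  · rw [TensorProduct.map_tmul, incl_inj, incl_inj]

/-- A subspace of the total space which contains the components of its elements. -/
def IsHomog {C : GrSpace.{v, u} K} (R : Submodule K (Tot C)) : Prop :=
  ∀ x ∈ R, ∀ n, inj C n (x n) ∈ R

/-- The projection to degree `n` fixes `z`. On `a ⊗ b` with `a, b ∈ R` it gives the sum of the `a_p
⊗ b_{n-p}`, and these components lie in `R` by homogeneity. -/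
theorem mem_subDeg_of_mem_range {C : GrSpace.{v, u} K} {R : Submodule K (Tot C)}
    (hR : IsHomog R) {n : ℤ} {z : Tot C ⊗[K] Tot C} (hz : z ∈ tensorDeg C C n)
    (hz' : z ∈ LinearMap.range (TensorProduct.map R.subtype R.subtype)) :
    z ∈ subDeg (fun n => R.comap (inj C n)) n := by
  classical
  rw [← tensorProj_of_mem hz]
  obtain ⟨w, rfl⟩ := hz'
  -- Homogeneity of the whole tensor is not inherited by its summands; from here on the projection
  -- carries that information.
  clear hz
  induction w using TensorProduct.induction_on with
  | zero => simp only [map_zero]; exact Submodule.zero_mem _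
  | add a b ha hb => simp only [map_add]; exact Submodule.add_mem _ ha hb
  | tmul a b =>
    rw [TensorProduct.map_tmul, Submodule.subtype_apply, Submodule.subtype_apply,
      ← DirectSum.sum_support_of a.1, TensorProduct.sum_tmul, map_sum]
    refine Submodule.sum_mem _ fun p _ => ?_
    have e := tensorProj_inj_tmul C C n p (a.1 p) b.1
    refine (congrArg (· ∈ subDeg (fun n => R.comap (inj C n)) n) e).mpr ?_
    exact tmul_mem_subDeg (N := fun n => R.comap (inj C n)) (by ring) (hR _ a.2 p)
      (hR _ b.2 (n - p))

/-- A pair of homogeneous subspaces which is closed under the cooperations and on which the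
relations hold. -/
structure IsSubTot (M : Cooperations.{v, u} K) (R : Submodule K (Tot M.C))
    (P : Submodule K (Tot M.D)) : Prop where
  homog_c : IsHomog R
  homog_o : IsHomog P
  Δc_mem : ∀ x ∈ R, M.Δc x ∈ LinearMap.range (TensorProduct.map R.subtype R.subtype)
  δc_mem : ∀ x ∈ R, M.δc x ∈ LinearMap.range (TensorProduct.map R.subtype R.subtype)
  Δo_mem : ∀ y ∈ P, M.Δo y ∈ LinearMap.range (TensorProduct.map P.subtype P.subtype)
  ρ_mem : ∀ y ∈ P, M.ρ y ∈ R
  relC : ∀ x ∈ R, M.RelC x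
  relO : ∀ y ∈ P, M.RelO y

theorem IsSubTot.isSub {M : Cooperations.{v, u} K} (hM : M.IsGraded) {R : Submodule K (Tot M.C)}
    {P : Submodule K (Tot M.D)} (h : IsSubTot M R P) :
    M.IsSub (fun n => R.comap (inj M.C n)) (fun n => P.comap (inj M.D n)) where
  Δc_mem n x hx := mem_subDeg_of_mem_range h.homog_c (hM.deg_Δc n x) (h.Δc_mem _ hx)
  δc_mem n x hx := mem_subDeg_of_mem_range h.homog_c (hM.deg_δc n x) (h.δc_mem _ hx)
  Δo_mem n y hy := mem_subDeg_of_mem_range h.homog_o (hM.deg_Δo n y) (h.Δo_mem _ hy)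
  ρ_mem n y hy := by
    obtain ⟨x, hx⟩ := hM.deg_ρ.exists_eq (add_zero n) y
    exact ⟨x, by rw [SetLike.mem_coe, Submodule.mem_comap, ← hx]; exact h.ρ_mem _ hy, hx.symm⟩
  relC n x hx := h.relC _ hx
  relO n y hy := h.relO _ hy

theorem mem_range_incl {C : GrSpace.{v, u} K} {N : ∀ n, Submodule K (C n)} {x : Tot C}
    (h : ∀ n, x n ∈ N n) : x ∈ LinearMap.range (incl N) := by
  classical
  rw [← DirectSum.sum_support_of x]
  exact Submodule.sum_mem _ fun n _ => ⟨inj (sub N) n ⟨x n, h n⟩, incl_inj N n ⟨x n, h n⟩⟩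

/-- This is the way into the cofree coalgebra: an element of the trees lies in it as soon as it lies
in some homogeneous pair that is closed under the cooperations and satisfies the relations. -/
theorem IsSubTot.le_range_c {M : Cooperations.{v, u} K} (hM : M.IsGraded)
    {R : Submodule K (Tot M.C)} {P : Submodule K (Tot M.D)} (h : IsSubTot M R P) :
    R ≤ LinearMap.range (incl M.maxC) := fun x hx =>
  mem_range_incl fun n => (h.isSub hM).le_maxC n (h.homog_c x hx n)

theorem IsSubTot.le_range_o {M : Cooperations.{v, u} K} (hM : M.IsGraded)
    {R : Submodule K (Tot M.C)} {P : Submodule K (Tot M.D)} (h : IsSubTot M R P) :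
    P ≤ LinearMap.range (incl M.maxO) := fun x hx =>
  mem_range_incl fun n => (h.isSub hM).le_maxO n (h.homog_o x hx n)

end Morphisms

/-! ### Grafting of trees -/

section Grafting

variable {K : Type v} [Field K] (V A : GrSpace.{v, u} K)

/-- The linear map on decorated trees given by a family of maps on the decorations. -/
def liftC {E : Type*} [AddCommMonoid E] [Module K E] (φ : ∀ t : CTree, t.tens V →ₗ[K] E) :
    Tot (treesC V) →ₗ[K] E :=
  DirectSum.toModule K ℤ _ fun n =>
    DirectSum.toModule K {t : CTree // t.deg = n} _ fun t => φ t.1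

/-- The linear map on decorated trees given by a family of maps on the decorations. -/
def liftO {E : Type*} [AddCommMonoid E] [Module K E] (φ : ∀ t : OTree, t.tens V A →ₗ[K] E) :
    Tot (treesO V A) →ₗ[K] E :=
  DirectSum.toModule K ℤ _ fun n =>
    DirectSum.toModule K {t : OTree // t.deg = n} _ fun t => φ t.1

variable {V A}

theorem liftC_emb {E : Type*} [AddCommMonoid E] [Module K E]
    (φ : ∀ t : CTree, t.tens V →ₗ[K] E) (t : CTree) (x : t.tens V) :
    liftC V φ (embC V t x) = φ t x :=
  (DirectSum.toModule_lof K _ _).trans (DirectSum.toModule_lof K _ _)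

theorem liftO_emb {E : Type*} [AddCommMonoid E] [Module K E]
    (φ : ∀ t : OTree, t.tens V A →ₗ[K] E) (t : OTree) (x : t.tens V A) :
    liftO V A φ (embO V A t x) = φ t x :=
  (DirectSum.toModule_lof K _ _).trans (DirectSum.toModule_lof K _ _)

theorem treesC_le {E : Type*} [AddCommMonoid E] [Module K E] {n : ℤ}
    {f : Tot (treesC V) →ₗ[K] E} {S : Submodule K E}
    (h : ∀ t : CTree, t.deg = n → ∀ x, f (embC V t x) ∈ S) (z : treesC V n) :
    f (inj (treesC V) n z) ∈ S := by
  have h' : ∀ (t : CTree) (ht : t.deg = n) x,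
      f (inj (treesC V) n (treeC V t n ht x)) ∈ S := by
    intro t ht
    cases ht
    exact h t rfl
  change (⨁ t : {t : CTree // t.deg = n}, t.1.tens V) at z
  induction z using DirectSum.induction_on with
  | zero => exact (map_zero (f ∘ₗ inj (treesC V) n)).symm ▸ S.zero_mem
  | add a b ha hb => exact (map_add (f ∘ₗ inj (treesC V) n) a b).symm ▸ S.add_mem ha hb
  | of t x => exact h' t.1 t.2 x

theorem treesO_le {E : Type*} [AddCommMonoid E] [Module K E] {n : ℤ}
    {f : Tot (treesO V A) →ₗ[K] E} {S : Submodule K E}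
    (h : ∀ t : OTree, t.deg = n → ∀ x, f (embO V A t x) ∈ S) (z : treesO V A n) :
    f (inj (treesO V A) n z) ∈ S := by
  have h' : ∀ (t : OTree) (ht : t.deg = n) x,
      f (inj (treesO V A) n (treeO V A t n ht x)) ∈ S := by
    intro t ht
    cases ht
    exact h t rfl
  change (⨁ t : {t : OTree // t.deg = n}, t.1.tens V A) at z
  induction z using DirectSum.induction_on with
  | zero => exact (map_zero (f ∘ₗ inj (treesO V A) n)).symm ▸ S.zero_mem
  | add a b ha hb => exact (map_add (f ∘ₗ inj (treesO V A) n) a b).symm ▸ S.add_mem ha hb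
  | of t x => exact h' t.1 t.2 x

theorem treesC_ext {E : Type*} [AddCommMonoid E] [Module K E] {f g : Tot (treesC V) →ₗ[K] E}
    (h : ∀ t x, f (embC V t x) = g (embC V t x)) (z : Tot (treesC V)) : f z = g z := by
  refine LinearMap.congr_fun (DirectSum.linearMap_ext _ fun n =>
    DirectSum.linearMap_ext (R := K) (ι := {t : CTree // t.deg = n}) (M := fun t => t.1.tens V) ?_) z
  rintro ⟨t, rfl⟩
  exact LinearMap.ext (h t)

theorem treesO_ext {E : Type*} [AddCommMonoid E] [Module K E] {f g : Tot (treesO V A) →ₗ[K] E}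
    (h : ∀ t x, f (embO V A t x) = g (embO V A t x)) (z : Tot (treesO V A)) : f z = g z := by
  refine LinearMap.congr_fun (DirectSum.linearMap_ext _ fun n =>
    DirectSum.linearMap_ext (R := K) (ι := {t : OTree // t.deg = n})
      (M := fun t => t.1.tens V A) ?_) z
  rintro ⟨t, rfl⟩
  exact LinearMap.ext (h t)

theorem treesC_tmul_ext {E : Type*} [AddCommMonoid E] [Module K E]
    {f g : Tot (treesC V) ⊗[K] Tot (treesC V) →ₗ[K] E}
    (h : ∀ l a r b, f (embC V l a ⊗ₜ embC V r b) = g (embC V l a ⊗ₜ embC V r b))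
    (z : Tot (treesC V) ⊗[K] Tot (treesC V)) : f z = g z := by
  refine tmul_ext (fun x y => ?_) z
  refine treesC_ext (f := f ∘ₗ (TensorProduct.mk K _ _).flip y)
    (g := g ∘ₗ (TensorProduct.mk K _ _).flip y) (fun l a => ?_) x
  exact treesC_ext (f := f ∘ₗ TensorProduct.mk K _ _ (embC V l a))
    (g := g ∘ₗ TensorProduct.mk K _ _ (embC V l a)) (fun r b => h l a r b) y

theorem treesO_tmul_ext {E : Type*} [AddCommMonoid E] [Module K E]
    {f g : Tot (treesO V A) ⊗[K] Tot (treesO V A) →ₗ[K] E}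
    (h : ∀ l a r b, f (embO V A l a ⊗ₜ embO V A r b) = g (embO V A l a ⊗ₜ embO V A r b))
    (z : Tot (treesO V A) ⊗[K] Tot (treesO V A)) : f z = g z := by
  refine tmul_ext (fun x y => ?_) z
  refine treesO_ext (f := f ∘ₗ (TensorProduct.mk K _ _).flip y)
    (g := g ∘ₗ (TensorProduct.mk K _ _).flip y) (fun l a => ?_) x
  exact treesO_ext (f := f ∘ₗ TensorProduct.mk K _ _ (embO V A l a))
    (g := g ∘ₗ TensorProduct.mk K _ _ (embO V A l a)) (fun r b => h l a r b) y

variable (V A)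

/-- The trees with a single leaf. -/
def leafC : Tot V →ₗ[K] Tot (treesC V) := DirectSum.toModule K ℤ _ fun i => embC V (.leaf i)

/-- The trees with a single leaf. -/
def leafO : Tot A →ₗ[K] Tot (treesO V A) := DirectSum.toModule K ℤ _ fun i => embO V A (.leaf i)

/-- The decorations of the trees with a single leaf. -/
def cutLeafC : (t : CTree) → t.tens V →ₗ[K] Tot V
  | .leaf i => inj V i
  | .prod _ _ => 0
  | .brac _ _ => 0

/-- The decorations of the trees with a single leaf. -/
def cutLeafO : (t : OTree) → t.tens V A →ₗ[K] Tot A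
  | .leaf i => inj A i
  | .prod _ _ => 0
  | .rho _ => 0

/-- The projection to the cogenerators. -/
def prC : Tot (treesC V) →ₗ[K] Tot V := liftC V (cutLeafC V)

/-- The projection to the cogenerators. -/
def prO : Tot (treesO V A) →ₗ[K] Tot A := liftO V A (cutLeafO V A)

/-- Grafting two trees to a vertex for `Δc`. -/
def graftΔc : Tot (treesC V) ⊗[K] Tot (treesC V) →ₗ[K] Tot (treesC V) :=
  TensorProduct.lift (liftC V fun l => LinearMap.flip (liftC V fun r =>
    LinearMap.flip ((TensorProduct.mk K (l.tens V) (r.tens V)).compr₂ (embC V (.prod l r)))))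

/-- Grafting two trees to a vertex for `δc`. -/
def graftδc : Tot (treesC V) ⊗[K] Tot (treesC V) →ₗ[K] Tot (treesC V) :=
  TensorProduct.lift (liftC V fun l => LinearMap.flip (liftC V fun r =>
    LinearMap.flip ((TensorProduct.mk K (l.tens V) (r.tens V)).compr₂ (embC V (.brac l r)))))

/-- Grafting two trees to a vertex for `Δo`. -/
def graftΔo : Tot (treesO V A) ⊗[K] Tot (treesO V A) →ₗ[K] Tot (treesO V A) :=
  TensorProduct.lift (liftO V A fun l => LinearMap.flip (liftO V A fun r =>
    LinearMap.flip ((TensorProduct.mk K (l.tens V A) (r.tens V A)).compr₂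
      (embO V A (.prod l r)))))

/-- Grafting a tree to a vertex for `ρ`. -/
def graftρ : Tot (treesC V) →ₗ[K] Tot (treesO V A) := liftC V fun t => embO V A (.rho t)

variable {V A}

theorem leafC_inj (i : ℤ) (x : V i) : leafC V (inj V i x) = embC V (.leaf i) x :=
  DirectSum.toModule_lof K _ _

theorem leafO_inj (i : ℤ) (x : A i) : leafO V A (inj A i x) = embO V A (.leaf i) x :=
  DirectSum.toModule_lof K _ _

theorem graftΔc_emb (l : CTree) (a : l.tens V) (r : CTree) (b : r.tens V) :
    graftΔc V (embC V l a ⊗ₜ embC V r b) = embC V (.prod l r) (a ⊗ₜ[K] b) := by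
  rw [graftΔc, TensorProduct.lift.tmul, liftC_emb, LinearMap.flip_apply, liftC_emb]
  rfl

theorem graftδc_emb (l : CTree) (a : l.tens V) (r : CTree) (b : r.tens V) :
    graftδc V (embC V l a ⊗ₜ embC V r b) = embC V (.brac l r) (a ⊗ₜ[K] b) := by
  rw [graftδc, TensorProduct.lift.tmul, liftC_emb, LinearMap.flip_apply, liftC_emb]
  rfl

theorem graftΔo_emb (l : OTree) (a : l.tens V A) (r : OTree) (b : r.tens V A) :
    graftΔo V A (embO V A l a ⊗ₜ embO V A r b) = embO V A (.prod l r) (a ⊗ₜ[K] b) := by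
  rw [graftΔo, TensorProduct.lift.tmul, liftO_emb, LinearMap.flip_apply, liftO_emb]
  rfl

theorem graftρ_emb (t : CTree) (x : t.tens V) :
    graftρ V A (embC V t x) = embO V A (.rho t) x := liftC_emb _ t x

theorem embC_prod (l r : CTree) (x : l.tens V ⊗[K] r.tens V) :
    embC V (.prod l r) x = graftΔc V (TensorProduct.map (embC V l) (embC V r) x) :=
  tmul_ext (f := embC V (.prod l r))
    (g := graftΔc V ∘ₗ TensorProduct.map (embC V l) (embC V r))
    (fun a b => (graftΔc_emb l a r b).symm) x

theorem embC_brac (l r : CTree) (x : l.tens V ⊗[K] r.tens V) :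
    embC V (.brac l r) x = graftδc V (TensorProduct.map (embC V l) (embC V r) x) :=
  tmul_ext (f := embC V (.brac l r))
    (g := graftδc V ∘ₗ TensorProduct.map (embC V l) (embC V r))
    (fun a b => (graftδc_emb l a r b).symm) x

theorem embO_prod (l r : OTree) (x : l.tens V A ⊗[K] r.tens V A) :
    embO V A (.prod l r) x = graftΔo V A (TensorProduct.map (embO V A l) (embO V A r) x) :=
  tmul_ext (f := embO V A (.prod l r))
    (g := graftΔo V A ∘ₗ TensorProduct.map (embO V A l) (embO V A r))
    (fun a b => (graftΔo_emb l a r b).symm) x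

theorem treesΔc_emb (t : CTree) (x : t.tens V) : treesΔc V (embC V t x) = cutΔc V t x :=
  treesΔc_tree V t _ rfl x

theorem treesδc_emb (t : CTree) (x : t.tens V) : treesδc V (embC V t x) = cutδc V t x :=
  treesδc_tree V t _ rfl x

theorem treesΔo_emb (t : OTree) (x : t.tens V A) : treesΔo V A (embO V A t x) = cutΔo V A t x :=
  treesΔo_tree V A t _ rfl x

theorem treesρ_emb (t : OTree) (x : t.tens V A) : treesρ V A (embO V A t x) = cutρ V A t x :=
  treesρ_tree V A t _ rfl x

/-- With the identities that follow, `prC`, `treesΔc`, `treesδc` and `leafC`, `graftΔc`, `graftδc`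
become the projections and inclusions of a direct sum decomposition of the trees by the type of the
root. Color `o` has the analogous decomposition. -/
theorem prC_leafC (x : Tot V) : prC V (leafC V x) = x :=
  tot_ext (f := prC V ∘ₗ leafC V) (g := LinearMap.id)
    (fun i x => (congrArg _ (leafC_inj i x)).trans (liftC_emb (cutLeafC V) (.leaf i) x)) x

theorem treesΔc_leafC (x : Tot V) : treesΔc V (leafC V x) = 0 :=
  tot_ext (f := treesΔc V ∘ₗ leafC V) (g := 0)
    (fun i x => (congrArg _ (leafC_inj i x)).trans (treesΔc_emb (.leaf i) x)) x

theorem treesδc_leafC (x : Tot V) : treesδc V (leafC V x) = 0 :=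
  tot_ext (f := treesδc V ∘ₗ leafC V) (g := 0)
    (fun i x => (congrArg _ (leafC_inj i x)).trans (treesδc_emb (.leaf i) x)) x

theorem prC_graftΔc (z : Tot (treesC V) ⊗[K] Tot (treesC V)) : prC V (graftΔc V z) = 0 :=
  treesC_tmul_ext (f := prC V ∘ₗ graftΔc V) (g := 0)
    (fun l a r b => (congrArg _ (graftΔc_emb l a r b)).trans (liftC_emb (cutLeafC V) (.prod l r) (a ⊗ₜ[K] b))) z

theorem treesΔc_graftΔc (z : Tot (treesC V) ⊗[K] Tot (treesC V)) :
    treesΔc V (graftΔc V z) = z :=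
  treesC_tmul_ext (f := treesΔc V ∘ₗ graftΔc V) (g := LinearMap.id)
    (fun l a r b => (congrArg _ (graftΔc_emb l a r b)).trans (treesΔc_emb (.prod l r) (a ⊗ₜ[K] b))) z

theorem treesδc_graftΔc (z : Tot (treesC V) ⊗[K] Tot (treesC V)) :
    treesδc V (graftΔc V z) = 0 :=
  treesC_tmul_ext (f := treesδc V ∘ₗ graftΔc V) (g := 0)
    (fun l a r b => (congrArg _ (graftΔc_emb l a r b)).trans (treesδc_emb (.prod l r) (a ⊗ₜ[K] b))) z

theorem prC_graftδc (z : Tot (treesC V) ⊗[K] Tot (treesC V)) : prC V (graftδc V z) = 0 :=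
  treesC_tmul_ext (f := prC V ∘ₗ graftδc V) (g := 0)
    (fun l a r b => (congrArg _ (graftδc_emb l a r b)).trans (liftC_emb (cutLeafC V) (.brac l r) (a ⊗ₜ[K] b))) z

theorem treesΔc_graftδc (z : Tot (treesC V) ⊗[K] Tot (treesC V)) :
    treesΔc V (graftδc V z) = 0 :=
  treesC_tmul_ext (f := treesΔc V ∘ₗ graftδc V) (g := 0)
    (fun l a r b => (congrArg _ (graftδc_emb l a r b)).trans (treesΔc_emb (.brac l r) (a ⊗ₜ[K] b))) z

theorem treesδc_graftδc (z : Tot (treesC V) ⊗[K] Tot (treesC V)) :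
    treesδc V (graftδc V z) = z :=
  treesC_tmul_ext (f := treesδc V ∘ₗ graftδc V) (g := LinearMap.id)
    (fun l a r b => (congrArg _ (graftδc_emb l a r b)).trans (treesδc_emb (.brac l r) (a ⊗ₜ[K] b))) z

theorem prO_leafO (x : Tot A) : prO V A (leafO V A x) = x :=
  tot_ext (f := prO V A ∘ₗ leafO V A) (g := LinearMap.id)
    (fun i x => (congrArg _ (leafO_inj i x)).trans (liftO_emb (cutLeafO V A) (.leaf i) x)) x

theorem treesΔo_leafO (x : Tot A) : treesΔo V A (leafO V A x) = 0 :=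
  tot_ext (f := treesΔo V A ∘ₗ leafO V A) (g := 0)
    (fun i x => (congrArg _ (leafO_inj i x)).trans (treesΔo_emb (.leaf i) x)) x

theorem treesρ_leafO (x : Tot A) : treesρ V A (leafO V A x) = 0 :=
  tot_ext (f := treesρ V A ∘ₗ leafO V A) (g := 0)
    (fun i x => (congrArg _ (leafO_inj i x)).trans (treesρ_emb (.leaf i) x)) x

theorem prO_graftΔo (z : Tot (treesO V A) ⊗[K] Tot (treesO V A)) :
    prO V A (graftΔo V A z) = 0 :=
  treesO_tmul_ext (f := prO V A ∘ₗ graftΔo V A) (g := 0)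
    (fun l a r b => (congrArg _ (graftΔo_emb l a r b)).trans (liftO_emb (cutLeafO V A) (.prod l r) (a ⊗ₜ[K] b))) z

theorem treesΔo_graftΔo (z : Tot (treesO V A) ⊗[K] Tot (treesO V A)) :
    treesΔo V A (graftΔo V A z) = z :=
  treesO_tmul_ext (f := treesΔo V A ∘ₗ graftΔo V A) (g := LinearMap.id)
    (fun l a r b => (congrArg _ (graftΔo_emb l a r b)).trans (treesΔo_emb (.prod l r) (a ⊗ₜ[K] b))) z

theorem treesρ_graftΔo (z : Tot (treesO V A) ⊗[K] Tot (treesO V A)) :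
    treesρ V A (graftΔo V A z) = 0 :=
  treesO_tmul_ext (f := treesρ V A ∘ₗ graftΔo V A) (g := 0)
    (fun l a r b => (congrArg _ (graftΔo_emb l a r b)).trans (treesρ_emb (.prod l r) (a ⊗ₜ[K] b))) z

theorem prO_graftρ (z : Tot (treesC V)) : prO V A (graftρ V A z) = 0 :=
  treesC_ext (f := prO V A ∘ₗ graftρ V A) (g := 0)
    (fun t x => (congrArg _ (graftρ_emb t x)).trans (liftO_emb (cutLeafO V A) (.rho t) x)) z

theorem treesΔo_graftρ (z : Tot (treesC V)) : treesΔo V A (graftρ V A z) = 0 :=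
  treesC_ext (f := treesΔo V A ∘ₗ graftρ V A) (g := 0)
    (fun t x => (congrArg _ (graftρ_emb t x)).trans (treesΔo_emb (.rho t) x)) z

theorem treesρ_graftρ (z : Tot (treesC V)) : treesρ V A (graftρ V A z) = z :=
  treesC_ext (f := treesρ V A ∘ₗ graftρ V A) (g := LinearMap.id)
    (fun t x => (congrArg _ (graftρ_emb t x)).trans (treesρ_emb (.rho t) x)) z

/-- Maps on trees are determined by their values on leaves and on grafted trees. -/
theorem treesC_ext_graft {E : Type*} [AddCommMonoid E] [Module K E]
    {f g : Tot (treesC V) →ₗ[K] E} (h0 : ∀ x, f (leafC V x) = g (leafC V x))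
    (h1 : ∀ z, f (graftΔc V z) = g (graftΔc V z)) (h2 : ∀ z, f (graftδc V z) = g (graftδc V z))
    (z : Tot (treesC V)) : f z = g z := by
  refine treesC_ext (fun t x => ?_) z
  cases t with
  | leaf i => exact (congrArg f (leafC_inj i x)).symm.trans ((h0 _).trans (congrArg g (leafC_inj i x)))
  | prod l r => exact (congrArg f (embC_prod l r x)).trans ((h1 _).trans (congrArg g (embC_prod l r x)).symm)
  | brac l r => exact (congrArg f (embC_brac l r x)).trans ((h2 _).trans (congrArg g (embC_brac l r x)).symm)

/-- Maps on trees are determined by their values on leaves and on grafted trees. -/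
theorem treesO_ext_graft {E : Type*} [AddCommMonoid E] [Module K E]
    {f g : Tot (treesO V A) →ₗ[K] E} (h0 : ∀ x, f (leafO V A x) = g (leafO V A x))
    (h1 : ∀ z, f (graftΔo V A z) = g (graftΔo V A z))
    (h2 : ∀ z, f (graftρ V A z) = g (graftρ V A z)) (z : Tot (treesO V A)) : f z = g z := by
  refine treesO_ext (fun t x => ?_) z
  cases t with
  | leaf i => exact (congrArg f (leafO_inj i x)).symm.trans ((h0 _).trans (congrArg g (leafO_inj i x)))
  | prod l r => exact (congrArg f (embO_prod l r x)).trans ((h1 _).trans (congrArg g (embO_prod l r x)).symm)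
  | rho t => exact (congrArg f (graftρ_emb t x)).symm.trans ((h2 _).trans (congrArg g (graftρ_emb t x)))

/-- A tree is a leaf or is grafted at its root from what cutting produces. In particular an element
on which both cooperations vanish is a cogenerator. -/
theorem treesC_decomp (z : Tot (treesC V)) :
    z = leafC V (prC V z) + graftΔc V (treesΔc V z) + graftδc V (treesδc V z) := by
  refine treesC_ext_graft (f := LinearMap.id) (g := leafC V ∘ₗ prC V + graftΔc V ∘ₗ treesΔc V +
    graftδc V ∘ₗ treesδc V) (fun x => ?_) (fun z => ?_) (fun z => ?_) z <;>
  simp only [LinearMap.id_apply, LinearMap.add_apply, LinearMap.comp_apply, prC_leafC,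
    treesΔc_leafC, treesδc_leafC, prC_graftΔc, treesΔc_graftΔc, treesδc_graftΔc,
    prC_graftδc, treesΔc_graftδc, treesδc_graftδc, map_zero, add_zero, zero_add]

theorem treesO_decomp (z : Tot (treesO V A)) :
    z = leafO V A (prO V A z) + graftΔo V A (treesΔo V A z) + graftρ V A (treesρ V A z) := by
  refine treesO_ext_graft (f := LinearMap.id) (g := leafO V A ∘ₗ prO V A +
    graftΔo V A ∘ₗ treesΔo V A + graftρ V A ∘ₗ treesρ V A) (fun x => ?_) (fun z => ?_)
    (fun z => ?_) z <;>
  simp only [LinearMap.id_apply, LinearMap.add_apply, LinearMap.comp_apply, prO_leafO,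
    treesΔo_leafO, treesρ_leafO, prO_graftΔo, treesΔo_graftΔo, treesρ_graftΔo,
    prO_graftρ, treesΔo_graftρ, treesρ_graftρ, map_zero, add_zero, zero_add]

/-! ### Degrees -/

theorem hasDegree_iff {C D : GrSpace.{v, u} K} {d : ℤ} {f : Tot C →ₗ[K] Tot D} :
    HasDegree d f ↔ ∀ n x, f (inj C n x) ∈ LinearMap.range (inj D (n + d)) :=
  forall₂_congr fun _ _ => exists_congr fun _ => eq_comm

theorem hasDegree_liftC {D : GrSpace.{v, u} K} {d : ℤ} {φ : ∀ t : CTree, t.tens V →ₗ[K] Tot D}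
    (h : ∀ t x, φ t x ∈ LinearMap.range (inj D (t.deg + d))) : HasDegree d (liftC V φ) := by
  refine hasDegree_iff.2 fun n z => treesC_le (f := liftC V φ) ?_ z
  intro t ht x
  subst ht
  exact (liftC_emb φ t x).symm ▸ h t x

theorem hasDegree_liftO {D : GrSpace.{v, u} K} {d : ℤ}
    {φ : ∀ t : OTree, t.tens V A →ₗ[K] Tot D}
    (h : ∀ t x, φ t x ∈ LinearMap.range (inj D (t.deg + d))) : HasDegree d (liftO V A φ) := by
  refine hasDegree_iff.2 fun n z => treesO_le (f := liftO V A φ) ?_ z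
  intro t ht x
  subst ht
  exact (liftO_emb φ t x).symm ▸ h t x

/-- `Tot V` keeps the original degrees of `V`, whereas the trees are built on `s⁻² V`. All later
shifts come from here and from `hasDegree_leafO`: a corestriction to `V` or `A` gains 2 or 1, so
that of a degree 1 coderivation has degree 3 or 2. -/
theorem hasDegree_leafC : HasDegree (-2) (leafC V) := fun i x =>
  ⟨treeC V (.leaf i) (i - 2) rfl x, leafC_inj i x⟩

theorem hasDegree_leafO : HasDegree (-1) (leafO V A) := fun i x =>
  ⟨treeO V A (.leaf i) (i - 1) rfl x, leafO_inj i x⟩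

theorem hasDegree_prC : HasDegree 2 (prC V) := by
  refine hasDegree_liftC fun t x => ?_
  cases t with
  | leaf i =>
    rw [show (CTree.leaf i).deg + 2 = i by simp [CTree.deg]]
    exact ⟨x, rfl⟩
  | prod l r => exact Submodule.zero_mem _
  | brac l r => exact Submodule.zero_mem _

theorem hasDegree_prO : HasDegree 1 (prO V A) := by
  refine hasDegree_liftO fun t x => ?_
  cases t with
  | leaf i =>
    rw [show (OTree.leaf i).deg + 1 = i by simp [OTree.deg]]
    exact ⟨x, rfl⟩
  | prod l r => exact Submodule.zero_mem _
  | rho t => exact Submodule.zero_mem _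

theorem hasDegree_graftρ : HasDegree 0 (graftρ V A) := by
  refine hasDegree_liftC fun t x => ?_
  rw [add_zero]
  exact ⟨treeO V A (.rho t) t.deg rfl x, rfl⟩

theorem tmul_mem_tensorDeg {C D : GrSpace.{v, u} K} {p q n : ℤ} (h : p + q = n) {x : Tot C}
    {y : Tot D} (hx : x ∈ LinearMap.range (inj C p)) (hy : y ∈ LinearMap.range (inj D q)) :
    x ⊗ₜ[K] y ∈ tensorDeg C D n := by
  obtain ⟨a, rfl⟩ := hx
  obtain ⟨b, rfl⟩ := hy
  exact Submodule.mem_iSup_of_mem p (Submodule.mem_iSup_of_mem q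
    (Submodule.mem_iSup_of_mem h ⟨a ⊗ₜ b, rfl⟩))

theorem map_mem_tensorDeg {C D : GrSpace.{v, u} K} {E F : Type*} [AddCommMonoid E]
    [AddCommMonoid F] [Module K E] [Module K F] {p q n : ℤ} (h : p + q = n) {f : E →ₗ[K] Tot C}
    {g : F →ₗ[K] Tot D} (hf : ∀ x, f x ∈ LinearMap.range (inj C p))
    (hg : ∀ y, g y ∈ LinearMap.range (inj D q)) (z : E ⊗[K] F) :
    TensorProduct.map f g z ∈ tensorDeg C D n := by
  induction z using TensorProduct.induction_on with
  | zero => exact (map_zero (TensorProduct.map f g)).symm ▸ Submodule.zero_mem _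
  | add a b ha hb => exact (map_add (TensorProduct.map f g) a b).symm ▸ Submodule.add_mem _ ha hb
  | tmul a b => exact tmul_mem_tensorDeg h (hf a) (hg b)

theorem tensorDeg_induction {C D : GrSpace.{v, u} K} {E : Type*} [AddCommMonoid E] [Module K E]
    {n : ℤ} {f : Tot C ⊗[K] Tot D →ₗ[K] E} {S : Submodule K E}
    (h : ∀ p q, p + q = n → ∀ a b, f (inj C p a ⊗ₜ inj D q b) ∈ S) {z : Tot C ⊗[K] Tot D}
    (hz : z ∈ tensorDeg C D n) : f z ∈ S := by
  suffices tensorDeg C D n ≤ S.comap f from this hz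
  simp only [tensorDeg, iSup_le_iff]
  rintro p q hpq _ ⟨w, rfl⟩
  induction w using TensorProduct.induction_on with
  | zero => simp only [map_zero]; exact Submodule.zero_mem _
  | add a b ha hb => simp only [map_add]; exact Submodule.add_mem _ ha hb
  | tmul a b => exact h p q hpq a b

theorem graftΔc_mem {n : ℤ} {z : Tot (treesC V) ⊗[K] Tot (treesC V)}
    (hz : z ∈ tensorDeg (treesC V) (treesC V) n) :
    graftΔc V z ∈ LinearMap.range (inj (treesC V) n) := by
  refine tensorDeg_induction (fun p q hpq a b => ?_) hz
  refine treesC_le (f := graftΔc V ∘ₗ (TensorProduct.mk K _ _).flip (inj (treesC V) q b)) ?_ a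
  intro l ht x
  subst ht
  refine treesC_le (f := graftΔc V ∘ₗ TensorProduct.mk K _ _ (embC V l x)) ?_ b
  intro r ht y
  subst ht
  exact ⟨treeC V (.prod l r) n hpq (x ⊗ₜ[K] y), by subst hpq; exact (graftΔc_emb l x r y).symm⟩

theorem graftδc_mem {n : ℤ} {z : Tot (treesC V) ⊗[K] Tot (treesC V)}
    (hz : z ∈ tensorDeg (treesC V) (treesC V) n) :
    graftδc V z ∈ LinearMap.range (inj (treesC V) (n + 1)) := by
  refine tensorDeg_induction (fun p q hpq a b => ?_) hz
  refine treesC_le (f := graftδc V ∘ₗ (TensorProduct.mk K _ _).flip (inj (treesC V) q b)) ?_ a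
  intro l ht x
  subst ht
  refine treesC_le (f := graftδc V ∘ₗ TensorProduct.mk K _ _ (embC V l x)) ?_ b
  intro r ht y
  subst ht
  subst hpq
  exact ⟨treeC V (.brac l r) _ rfl (x ⊗ₜ[K] y), (graftδc_emb l x r y).symm⟩

theorem graftΔo_mem {n : ℤ} {z : Tot (treesO V A) ⊗[K] Tot (treesO V A)}
    (hz : z ∈ tensorDeg (treesO V A) (treesO V A) n) :
    graftΔo V A z ∈ LinearMap.range (inj (treesO V A) n) := by
  refine tensorDeg_induction (fun p q hpq a b => ?_) hz
  refine treesO_le (f := graftΔo V A ∘ₗ (TensorProduct.mk K _ _).flip (inj (treesO V A) q b)) ?_ a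
  intro l ht x
  subst ht
  refine treesO_le (f := graftΔo V A ∘ₗ TensorProduct.mk K _ _ (embO V A l x)) ?_ b
  intro r ht y
  subst ht
  subst hpq
  exact ⟨treeO V A (.prod l r) _ rfl (x ⊗ₜ[K] y), (graftΔo_emb l x r y).symm⟩

theorem embC_mem (t : CTree) (x : t.tens V) :
    embC V t x ∈ LinearMap.range (inj (treesC V) t.deg) := ⟨_, rfl⟩

theorem embO_mem (t : OTree) (x : t.tens V A) :
    embO V A t x ∈ LinearMap.range (inj (treesO V A) t.deg) := ⟨_, rfl⟩

theorem trees_isGraded (V A : GrSpace.{v, u} K) : (trees V A).IsGraded where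
  deg_Δc n z := by
    refine treesC_le (f := treesΔc V) ?_ z
    intro t ht x
    subst ht
    rw [treesΔc_emb]
    cases t with
    | leaf i => exact Submodule.zero_mem _
    | prod l r => exact map_mem_tensorDeg rfl (embC_mem l) (embC_mem r) x
    | brac l r => exact Submodule.zero_mem _
  deg_δc n z := by
    refine treesC_le (f := treesδc V) ?_ z
    intro t ht x
    subst ht
    rw [treesδc_emb]
    cases t with
    | leaf i => exact Submodule.zero_mem _
    | prod l r => exact Submodule.zero_mem _
    | brac l r =>
      exact map_mem_tensorDeg (by simp [CTree.deg]) (embC_mem l) (embC_mem r) x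
  deg_Δo n z := by
    refine treesO_le (f := treesΔo V A) ?_ z
    intro t ht x
    subst ht
    rw [treesΔo_emb]
    cases t with
    | leaf i => exact Submodule.zero_mem _
    | prod l r => exact map_mem_tensorDeg rfl (embO_mem l) (embO_mem r) x
    | rho t => exact Submodule.zero_mem _
  deg_ρ := by
    refine hasDegree_liftO (φ := cutρ V A) fun t x => ?_
    rw [add_zero]
    cases t with
    | leaf i => exact Submodule.zero_mem _
    | prod l r => exact Submodule.zero_mem _
    | rho t => exact embC_mem t x

end Grafting

/-! ### Morphisms and coderivations of trees -/

section TreeMaps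

variable {K : Type v} [Field K]

theorem HasDegree.mem_range {C D : GrSpace.{v, u} K} {d : ℤ} {f : Tot C →ₗ[K] Tot D}
    (hf : HasDegree d f) {n m : ℤ} (h : n + d = m) {x : Tot C}
    (hx : x ∈ LinearMap.range (inj C n)) : f x ∈ LinearMap.range (inj D m) := by
  obtain ⟨x, rfl⟩ := hx
  obtain ⟨y, hy⟩ := hf.exists_eq h x
  exact ⟨y, hy.symm⟩

variable {V A V' A' : GrSpace.{v, u} K}

/-- The map `1 + φ`, where `φ` has values in the cogenerators. -/
def perturbC (φ : Tot (treesC V) →ₗ[K] Tot V) : Tot (treesC V) →ₗ[K] Tot (treesC V) :=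
  LinearMap.id + leafC V ∘ₗ φ

/-- The map `1 + ψ`, where `ψ` has values in the cogenerators. -/
def perturbO (ψ : Tot (treesO V A) →ₗ[K] Tot A) : Tot (treesO V A) →ₗ[K] Tot (treesO V A) :=
  LinearMap.id + leafO V A ∘ₗ ψ

/-- The recursion for `mapC`. -/
def treeMapC (F : Tot V →ₗ[K] Tot V') (φ : Tot (treesC V') →ₗ[K] Tot V') :
    (t : CTree) → t.tens V →ₗ[K] Tot (treesC V')
  | .leaf i => leafC V' ∘ₗ F ∘ₗ inj V i
  | .prod l r => perturbC φ ∘ₗ graftΔc V' ∘ₗ TensorProduct.map (treeMapC F φ l) (treeMapC F φ r)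
  | .brac l r => perturbC φ ∘ₗ graftδc V' ∘ₗ TensorProduct.map (treeMapC F φ l) (treeMapC F φ r)

/-- The morphism `T` of cooperations with `pr T = F pr + φ T`. -/
def mapC (F : Tot V →ₗ[K] Tot V') (φ : Tot (treesC V') →ₗ[K] Tot V') :
    Tot (treesC V) →ₗ[K] Tot (treesC V') := liftC V (treeMapC F φ)

/-- The recursion for `mapO`. -/
def treeMapO (F : Tot V →ₗ[K] Tot V') (φ : Tot (treesC V') →ₗ[K] Tot V')
    (G : Tot A →ₗ[K] Tot A') (ψ : Tot (treesO V' A') →ₗ[K] Tot A') :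
    (t : OTree) → t.tens V A →ₗ[K] Tot (treesO V' A')
  | .leaf i => leafO V' A' ∘ₗ G ∘ₗ inj A i
  | .prod l r => perturbO ψ ∘ₗ graftΔo V' A' ∘ₗ
      TensorProduct.map (treeMapO F φ G ψ l) (treeMapO F φ G ψ r)
  | .rho t => perturbO ψ ∘ₗ graftρ V' A' ∘ₗ treeMapC F φ t

/-- The morphism `T` of cooperations with `pr T = G pr + ψ T`. -/
def mapO (F : Tot V →ₗ[K] Tot V') (φ : Tot (treesC V') →ₗ[K] Tot V')
    (G : Tot A →ₗ[K] Tot A') (ψ : Tot (treesO V' A') →ₗ[K] Tot A') :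
    Tot (treesO V A) →ₗ[K] Tot (treesO V' A') := liftO V A (treeMapO F φ G ψ)

/-- The recursion for `coderC`. -/
def treeCoderC (q : Tot (treesC V) →ₗ[K] Tot V) : (t : CTree) → t.tens V →ₗ[K] Tot (treesC V)
  | .leaf i => leafC V ∘ₗ q ∘ₗ embC V (.leaf i)
  | .prod l r => (leafC V ∘ₗ q) ∘ₗ graftΔc V ∘ₗ TensorProduct.map (embC V l) (embC V r) +
      graftΔc V ∘ₗ (TensorProduct.map (treeCoderC q l) (embC V r) +
        TensorProduct.map (sgn _ ∘ₗ embC V l) (treeCoderC q r))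
  | .brac l r => (leafC V ∘ₗ q) ∘ₗ graftδc V ∘ₗ TensorProduct.map (embC V l) (embC V r) -
      graftδc V ∘ₗ (TensorProduct.map (treeCoderC q l) (embC V r) +
        TensorProduct.map (sgn _ ∘ₗ embC V l) (treeCoderC q r))

/-- The coderivation `Q` of degree `1` with `pr Q = q`. -/
def coderC (q : Tot (treesC V) →ₗ[K] Tot V) : Tot (treesC V) →ₗ[K] Tot (treesC V) :=
  liftC V (treeCoderC q)

/-- The recursion for `coderO`. -/
def treeCoderO (q : Tot (treesC V) →ₗ[K] Tot V) (r : Tot (treesO V A) →ₗ[K] Tot A) :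
    (t : OTree) → t.tens V A →ₗ[K] Tot (treesO V A)
  | .leaf i => leafO V A ∘ₗ r ∘ₗ embO V A (.leaf i)
  | .prod s t => (leafO V A ∘ₗ r) ∘ₗ graftΔo V A ∘ₗ TensorProduct.map (embO V A s) (embO V A t) +
      graftΔo V A ∘ₗ (TensorProduct.map (treeCoderO q r s) (embO V A t) +
        TensorProduct.map (sgn _ ∘ₗ embO V A s) (treeCoderO q r t))
  | .rho t => (leafO V A ∘ₗ r) ∘ₗ graftρ V A ∘ₗ embC V t + graftρ V A ∘ₗ treeCoderC q t

/-- The coderivation `Q` of degree `1` with `pr Q = r`. -/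
def coderO (q : Tot (treesC V) →ₗ[K] Tot V) (r : Tot (treesO V A) →ₗ[K] Tot A) :
    Tot (treesO V A) →ₗ[K] Tot (treesO V A) :=
  liftO V A (treeCoderO q r)

/-! ### Morphisms of tree coalgebras with prescribed corestriction -/

section

variable (F : Tot V →ₗ[K] Tot V') (φ : Tot (treesC V') →ₗ[K] Tot V')
    (G : Tot A →ₗ[K] Tot A') (ψ : Tot (treesO V' A') →ₗ[K] Tot A')

theorem mapC_emb (t : CTree) (x : t.tens V) : mapC F φ (embC V t x) = treeMapC F φ t x :=
  liftC_emb _ t x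

theorem mapO_emb (t : OTree) (x : t.tens V A) :
    mapO F φ G ψ (embO V A t x) = treeMapO F φ G ψ t x :=
  liftO_emb _ t x

theorem mapC_leafC (x : Tot V) : mapC F φ (leafC V x) = leafC V' (F x) :=
  tot_ext (f := mapC F φ ∘ₗ leafC V) (g := leafC V' ∘ₗ F)
    (fun i x => (congrArg _ (leafC_inj i x)).trans (mapC_emb F φ (.leaf i) x)) x

theorem mapC_graftΔc (z : Tot (treesC V) ⊗[K] Tot (treesC V)) :
    mapC F φ (graftΔc V z) =
      perturbC φ (graftΔc V' (TensorProduct.map (mapC F φ) (mapC F φ) z)) := by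
  refine treesC_tmul_ext (f := mapC F φ ∘ₗ graftΔc V)
    (g := perturbC φ ∘ₗ graftΔc V' ∘ₗ TensorProduct.map (mapC F φ) (mapC F φ))
    (fun l a r b => ((congrArg _ (graftΔc_emb l a r b)).trans
      (mapC_emb F φ (.prod l r) (a ⊗ₜ[K] b))).trans ?_) z
  simp only [LinearMap.comp_apply, TensorProduct.map_tmul, mapC_emb]
  rfl

theorem mapC_graftδc (z : Tot (treesC V) ⊗[K] Tot (treesC V)) :
    mapC F φ (graftδc V z) =
      perturbC φ (graftδc V' (TensorProduct.map (mapC F φ) (mapC F φ) z)) := by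
  refine treesC_tmul_ext (f := mapC F φ ∘ₗ graftδc V)
    (g := perturbC φ ∘ₗ graftδc V' ∘ₗ TensorProduct.map (mapC F φ) (mapC F φ))
    (fun l a r b => ((congrArg _ (graftδc_emb l a r b)).trans
      (mapC_emb F φ (.brac l r) (a ⊗ₜ[K] b))).trans ?_) z
  simp only [LinearMap.comp_apply, TensorProduct.map_tmul, mapC_emb]
  rfl

theorem mapO_leafO (x : Tot A) : mapO F φ G ψ (leafO V A x) = leafO V' A' (G x) :=
  tot_ext (f := mapO F φ G ψ ∘ₗ leafO V A) (g := leafO V' A' ∘ₗ G)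
    (fun i x => (congrArg _ (leafO_inj i x)).trans (mapO_emb F φ G ψ (.leaf i) x)) x

theorem mapO_graftΔo (z : Tot (treesO V A) ⊗[K] Tot (treesO V A)) :
    mapO F φ G ψ (graftΔo V A z) =
      perturbO ψ (graftΔo V' A' (TensorProduct.map (mapO F φ G ψ) (mapO F φ G ψ) z)) := by
  refine treesO_tmul_ext (f := mapO F φ G ψ ∘ₗ graftΔo V A)
    (g := perturbO ψ ∘ₗ graftΔo V' A' ∘ₗ TensorProduct.map (mapO F φ G ψ) (mapO F φ G ψ))
    (fun l a r b => ((congrArg _ (graftΔo_emb l a r b)).trans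
      (mapO_emb F φ G ψ (.prod l r) (a ⊗ₜ[K] b))).trans ?_) z
  simp only [LinearMap.comp_apply, TensorProduct.map_tmul, mapO_emb]
  rfl

theorem mapO_graftρ (z : Tot (treesC V)) :
    mapO F φ G ψ (graftρ V A z) = perturbO ψ (graftρ V' A' (mapC F φ z)) := by
  refine treesC_ext (f := mapO F φ G ψ ∘ₗ graftρ V A)
    (g := perturbO ψ ∘ₗ graftρ V' A' ∘ₗ mapC F φ)
    (fun t x => ((congrArg _ (graftρ_emb t x)).trans
      (mapO_emb F φ G ψ (.rho t) x)).trans ?_) z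
  simp only [LinearMap.comp_apply, mapC_emb]
  rfl

theorem perturbC_apply (z : Tot (treesC V')) : perturbC φ z = z + leafC V' (φ z) := rfl

theorem perturbO_apply (z : Tot (treesO V' A')) : perturbO ψ z = z + leafO V' A' (ψ z) := rfl

variable {F φ G ψ}

/-- Since `φ` kills leaves, `φ (1 + φ) = φ`: the leaf added at the root does not change the value of
`φ`. So the recursion over branches solves an equation in which `T` appears on both sides. -/
theorem prC_mapC (hφ : ∀ x, φ (leafC V' x) = 0) (z : Tot (treesC V)) :
    prC V' (mapC F φ z) = F (prC V z) + φ (mapC F φ z) := by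
  refine treesC_ext_graft (f := prC V' ∘ₗ mapC F φ) (g := F ∘ₗ prC V + φ ∘ₗ mapC F φ)
    (fun x => ?_) (fun z => ?_) (fun z => ?_) z <;>
  simp only [LinearMap.add_apply, LinearMap.comp_apply, mapC_leafC, mapC_graftΔc, mapC_graftδc,
    perturbC_apply, map_add, prC_leafC, prC_graftΔc, prC_graftδc, hφ, map_zero, add_zero, zero_add]

theorem prO_mapO (hψ : ∀ x, ψ (leafO V' A' x) = 0) (z : Tot (treesO V A)) :
    prO V' A' (mapO F φ G ψ z) = G (prO V A z) + ψ (mapO F φ G ψ z) := by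
  refine treesO_ext_graft (f := prO V' A' ∘ₗ mapO F φ G ψ)
    (g := G ∘ₗ prO V A + ψ ∘ₗ mapO F φ G ψ) (fun x => ?_) (fun z => ?_) (fun z => ?_) z <;>
  simp only [LinearMap.add_apply, LinearMap.comp_apply, mapO_leafO, mapO_graftΔo, mapO_graftρ,
    perturbO_apply, map_add, prO_leafO, prO_graftΔo, prO_graftρ, hψ, map_zero, add_zero, zero_add]

theorem hasDegree_perturbC (hφ : HasDegree 2 φ) : HasDegree 0 (perturbC φ) :=
  hasDegree_id.add (hasDegree_leafC.comp hφ (by norm_num))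

theorem hasDegree_perturbO (hψ : HasDegree 1 ψ) : HasDegree 0 (perturbO ψ) :=
  hasDegree_id.add (hasDegree_leafO.comp hψ (by norm_num))

theorem treeMapC_mem (hF : HasDegree 0 F) (hφ : HasDegree 2 φ) (t : CTree) (x : t.tens V) :
    treeMapC F φ t x ∈ LinearMap.range (inj (treesC V') t.deg) := by
  induction t with
  | leaf i =>
    exact hasDegree_leafC.mem_range rfl (hF.mem_range (add_zero i) (LinearMap.mem_range_self _ x))
  | prod l r hl hr =>
    exact (hasDegree_perturbC hφ).mem_range (add_zero _)
      (graftΔc_mem (map_mem_tensorDeg rfl hl hr x))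
  | brac l r hl hr =>
    exact (hasDegree_perturbC hφ).mem_range (add_zero _)
      (graftδc_mem (map_mem_tensorDeg rfl hl hr x))

theorem treeMapO_mem (hF : HasDegree 0 F) (hφ : HasDegree 2 φ) (hG : HasDegree 0 G)
    (hψ : HasDegree 1 ψ) (t : OTree) (x : t.tens V A) :
    treeMapO F φ G ψ t x ∈ LinearMap.range (inj (treesO V' A') t.deg) := by
  induction t with
  | leaf i =>
    exact hasDegree_leafO.mem_range rfl (hG.mem_range (add_zero i) (LinearMap.mem_range_self _ x))
  | prod l r hl hr =>
    exact (hasDegree_perturbO hψ).mem_range (add_zero _)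
      (graftΔo_mem (map_mem_tensorDeg rfl hl hr x))
  | rho t =>
    exact (hasDegree_perturbO hψ).mem_range (add_zero _)
      (hasDegree_graftρ.mem_range (add_zero _) (treeMapC_mem hF hφ t x))

/-- Cutting undoes grafting and annihilates the added leaves, so nothing is required of `φ` and `ψ`
beyond their degrees. -/
theorem isCoopHom_map (hF : HasDegree 0 F) (hφ : HasDegree 2 φ) (hG : HasDegree 0 G)
    (hψ : HasDegree 1 ψ) :
    IsCoopHom (trees V A) (trees V' A') (mapC F φ) (mapO F φ G ψ) where
  deg_c := hasDegree_liftC fun t x => by rw [add_zero]; exact treeMapC_mem hF hφ t x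
  deg_o := hasDegree_liftO fun t x => by rw [add_zero]; exact treeMapO_mem hF hφ hG hψ t x
  map_Δc := by
    refine treesC_ext_graft (f := treesΔc V' ∘ₗ mapC F φ)
      (g := TensorProduct.map (mapC F φ) (mapC F φ) ∘ₗ treesΔc V)
      (fun x => ?_) (fun z => ?_) (fun z => ?_) <;>
    simp only [LinearMap.comp_apply, mapC_leafC, mapC_graftΔc, mapC_graftδc, perturbC_apply,
      map_add, treesΔc_leafC, treesΔc_graftΔc, treesΔc_graftδc, map_zero, add_zero]
  map_δc := by
    refine treesC_ext_graft (f := treesδc V' ∘ₗ mapC F φ)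
      (g := TensorProduct.map (mapC F φ) (mapC F φ) ∘ₗ treesδc V)
      (fun x => ?_) (fun z => ?_) (fun z => ?_) <;>
    simp only [LinearMap.comp_apply, mapC_leafC, mapC_graftΔc, mapC_graftδc, perturbC_apply,
      map_add, treesδc_leafC, treesδc_graftΔc, treesδc_graftδc, map_zero, add_zero]
  map_Δo := by
    refine treesO_ext_graft (f := treesΔo V' A' ∘ₗ mapO F φ G ψ)
      (g := TensorProduct.map (mapO F φ G ψ) (mapO F φ G ψ) ∘ₗ treesΔo V A)
      (fun x => ?_) (fun z => ?_) (fun z => ?_) <;>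
    simp only [LinearMap.comp_apply, mapO_leafO, mapO_graftΔo, mapO_graftρ, perturbO_apply,
      map_add, treesΔo_leafO, treesΔo_graftΔo, treesΔo_graftρ, map_zero, add_zero]
  map_ρ := by
    refine treesO_ext_graft (f := treesρ V' A' ∘ₗ mapO F φ G ψ) (g := mapC F φ ∘ₗ treesρ V A)
      (fun x => ?_) (fun z => ?_) (fun z => ?_) <;>
    simp only [LinearMap.comp_apply, mapO_leafO, mapO_graftΔo, mapO_graftρ, perturbO_apply,
      map_add, treesρ_leafO, treesρ_graftΔo, treesρ_graftρ, map_zero, add_zero]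

end

/-! ### Coderivations of tree coalgebras with prescribed corestriction -/

section

variable (q : Tot (treesC V) →ₗ[K] Tot V) (r : Tot (treesO V A) →ₗ[K] Tot A)

theorem coderC_emb (t : CTree) (x : t.tens V) : coderC q (embC V t x) = treeCoderC q t x :=
  liftC_emb _ t x

theorem coderO_emb (t : OTree) (x : t.tens V A) :
    coderO q r (embO V A t x) = treeCoderO q r t x :=
  liftO_emb _ t x

theorem coderC_leafC (x : Tot V) : coderC q (leafC V x) = leafC V (q (leafC V x)) :=
  tot_ext (f := coderC q ∘ₗ leafC V) (g := leafC V ∘ₗ q ∘ₗ leafC V)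
    (fun i x => ((congrArg _ (leafC_inj i x)).trans (coderC_emb q (.leaf i) x)).trans
      (congrArg (leafC V ∘ₗ q) (leafC_inj i x)).symm) x

theorem coderC_graftΔc (z : Tot (treesC V) ⊗[K] Tot (treesC V)) :
    coderC q (graftΔc V z) = leafC V (q (graftΔc V z)) +
      graftΔc V (tensorDer (coderC q) (coderC q) z) := by
  refine treesC_tmul_ext (f := coderC q ∘ₗ graftΔc V)
    (g := leafC V ∘ₗ q ∘ₗ graftΔc V + graftΔc V ∘ₗ tensorDer (coderC q) (coderC q))
    (fun l a r b => ((congrArg _ (graftΔc_emb l a r b)).trans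
      (coderC_emb q (.prod l r) (a ⊗ₜ[K] b))).trans ?_) z
  simp only [LinearMap.comp_apply, LinearMap.add_apply, tensorDer_tmul, coderC_emb]
  rfl

theorem coderC_graftδc (z : Tot (treesC V) ⊗[K] Tot (treesC V)) :
    coderC q (graftδc V z) = leafC V (q (graftδc V z)) -
      graftδc V (tensorDer (coderC q) (coderC q) z) := by
  refine treesC_tmul_ext (f := coderC q ∘ₗ graftδc V)
    (g := leafC V ∘ₗ q ∘ₗ graftδc V - graftδc V ∘ₗ tensorDer (coderC q) (coderC q))
    (fun l a r b => ((congrArg _ (graftδc_emb l a r b)).trans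
      (coderC_emb q (.brac l r) (a ⊗ₜ[K] b))).trans ?_) z
  simp only [LinearMap.comp_apply, LinearMap.sub_apply, tensorDer_tmul, coderC_emb]
  rfl

theorem coderO_leafO (x : Tot A) : coderO q r (leafO V A x) = leafO V A (r (leafO V A x)) :=
  tot_ext (f := coderO q r ∘ₗ leafO V A) (g := leafO V A ∘ₗ r ∘ₗ leafO V A)
    (fun i x => ((congrArg _ (leafO_inj i x)).trans (coderO_emb q r (.leaf i) x)).trans
      (congrArg (leafO V A ∘ₗ r) (leafO_inj i x)).symm) x

theorem coderO_graftΔo (z : Tot (treesO V A) ⊗[K] Tot (treesO V A)) :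
    coderO q r (graftΔo V A z) = leafO V A (r (graftΔo V A z)) +
      graftΔo V A (tensorDer (coderO q r) (coderO q r) z) := by
  refine treesO_tmul_ext (f := coderO q r ∘ₗ graftΔo V A)
    (g := leafO V A ∘ₗ r ∘ₗ graftΔo V A + graftΔo V A ∘ₗ tensorDer (coderO q r) (coderO q r))
    (fun s a t b => ((congrArg _ (graftΔo_emb s a t b)).trans
      (coderO_emb q r (.prod s t) (a ⊗ₜ[K] b))).trans ?_) z
  simp only [LinearMap.comp_apply, LinearMap.add_apply, tensorDer_tmul, coderO_emb]
  rfl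

theorem coderO_graftρ (z : Tot (treesC V)) :
    coderO q r (graftρ V A z) = leafO V A (r (graftρ V A z)) + graftρ V A (coderC q z) := by
  refine treesC_ext (f := coderO q r ∘ₗ graftρ V A)
    (g := leafO V A ∘ₗ r ∘ₗ graftρ V A + graftρ V A ∘ₗ coderC q)
    (fun t x => ((congrArg _ (graftρ_emb t x)).trans (coderO_emb q r (.rho t) x)).trans ?_) z
  simp only [LinearMap.comp_apply, LinearMap.add_apply, coderC_emb]
  rfl

theorem prC_coderC (z : Tot (treesC V)) : prC V (coderC q z) = q z := by
  refine treesC_ext_graft (f := prC V ∘ₗ coderC q) (g := q)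
    (fun x => ?_) (fun z => ?_) (fun z => ?_) z <;>
  simp only [LinearMap.comp_apply, coderC_leafC, coderC_graftΔc, coderC_graftδc, map_add, map_sub,
    prC_leafC, prC_graftΔc, prC_graftδc, add_zero, sub_zero]

theorem prO_coderO (z : Tot (treesO V A)) : prO V A (coderO q r z) = r z := by
  refine treesO_ext_graft (f := prO V A ∘ₗ coderO q r) (g := r)
    (fun x => ?_) (fun z => ?_) (fun z => ?_) z <;>
  simp only [LinearMap.comp_apply, coderO_leafO, coderO_graftΔo, coderO_graftρ, map_add,
    prO_leafO, prO_graftΔo, prO_graftρ, add_zero]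

variable {q r}

theorem embC_mem_sgn (t : CTree) (x : t.tens V) :
    sgn (treesC V) (embC V t x) ∈ LinearMap.range (inj (treesC V) t.deg) := by
  refine ⟨ksign K t.deg • treeC V t t.deg rfl x, ?_⟩
  rw [map_smul]
  exact (sgn_inj _ _ _).symm

theorem embO_mem_sgn (t : OTree) (x : t.tens V A) :
    sgn (treesO V A) (embO V A t x) ∈ LinearMap.range (inj (treesO V A) t.deg) := by
  refine ⟨ksign K t.deg • treeO V A t t.deg rfl x, ?_⟩
  rw [map_smul]
  exact (sgn_inj _ _ _).symm

theorem treeCoderC_mem (hq : HasDegree 3 q) (t : CTree) (x : t.tens V) :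
    treeCoderC q t x ∈ LinearMap.range (inj (treesC V) (t.deg + 1)) := by
  have h0 : ∀ {n : ℤ} {z : Tot (treesC V)}, z ∈ LinearMap.range (inj (treesC V) n) →
      leafC V (q z) ∈ LinearMap.range (inj (treesC V) (n + 1)) := fun hz =>
    hasDegree_leafC.mem_range (by ring) (hq.mem_range rfl hz)
  induction t with
  | leaf i => exact h0 (embC_mem (.leaf i) x)
  | prod l r hl hr =>
    refine Submodule.add_mem _ (h0 (graftΔc_mem (map_mem_tensorDeg rfl (embC_mem l) (embC_mem r) x)))
      (graftΔc_mem (Submodule.add_mem _ ?_ ?_))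
    · exact map_mem_tensorDeg (by simp only [CTree.deg]; ring) hl (embC_mem r) x
    · exact map_mem_tensorDeg (by simp only [CTree.deg]; ring) (embC_mem_sgn l) hr x
  | brac l r hl hr =>
    refine Submodule.sub_mem _ (h0 (graftδc_mem (map_mem_tensorDeg rfl (embC_mem l) (embC_mem r) x)))
      (graftδc_mem (Submodule.add_mem _ ?_ ?_))
    · exact map_mem_tensorDeg (by simp only [CTree.deg]; ring) hl (embC_mem r) x
    · exact map_mem_tensorDeg (by simp only [CTree.deg]; ring) (embC_mem_sgn l) hr x

theorem treeCoderO_mem (hq : HasDegree 3 q) (hr : HasDegree 2 r) (t : OTree) (x : t.tens V A) :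
    treeCoderO q r t x ∈ LinearMap.range (inj (treesO V A) (t.deg + 1)) := by
  have h0 : ∀ {n : ℤ} {z : Tot (treesO V A)}, z ∈ LinearMap.range (inj (treesO V A) n) →
      leafO V A (r z) ∈ LinearMap.range (inj (treesO V A) (n + 1)) := fun hz =>
    hasDegree_leafO.mem_range (by ring) (hr.mem_range rfl hz)
  induction t with
  | leaf i => exact h0 (embO_mem (.leaf i) x)
  | prod s t hs ht =>
    refine Submodule.add_mem _ (h0 (graftΔo_mem (map_mem_tensorDeg rfl (embO_mem s) (embO_mem t) x)))
      (graftΔo_mem (Submodule.add_mem _ ?_ ?_))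
    · exact map_mem_tensorDeg (by simp only [OTree.deg]; ring) hs (embO_mem t) x
    · exact map_mem_tensorDeg (by simp only [OTree.deg]; ring) (embO_mem_sgn s) ht x
  | rho t =>
    exact Submodule.add_mem _ (h0 (hasDegree_graftρ.mem_range (add_zero _) (embC_mem t x)))
      (hasDegree_graftρ.mem_range (add_zero _) (treeCoderC_mem hq t x))

/-- In the absence of relations any pair of corestrictions of the right degrees integrates to a
coderivation: the leaf terms are cut to zero, and cutting the grafted terms returns the coderivation
rule. -/
theorem isCoder_coder (hq : HasDegree 3 q) (hr : HasDegree 2 r) :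
    IsCoder (trees V A) (coderC q) (coderO q r) where
  deg_c := hasDegree_liftC fun t x => treeCoderC_mem hq t x
  deg_o := hasDegree_liftO fun t x => treeCoderO_mem hq hr t x
  coder_Δc := by
    refine treesC_ext_graft (f := treesΔc V ∘ₗ coderC q)
      (g := tensorDer (coderC q) (coderC q) ∘ₗ treesΔc V)
      (fun x => ?_) (fun z => ?_) (fun z => ?_) <;>
    simp only [LinearMap.comp_apply, coderC_leafC, coderC_graftΔc, coderC_graftδc, map_add,
      map_sub, treesΔc_leafC, treesΔc_graftΔc, treesΔc_graftδc, map_zero, zero_add, sub_zero]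
  coder_δc := by
    refine treesC_ext_graft (f := treesδc V ∘ₗ coderC q)
      (g := -(tensorDer (coderC q) (coderC q) ∘ₗ treesδc V))
      (fun x => ?_) (fun z => ?_) (fun z => ?_) <;>
    simp only [LinearMap.neg_apply, LinearMap.comp_apply, coderC_leafC, coderC_graftΔc,
      coderC_graftδc, map_add, map_sub, treesδc_leafC, treesδc_graftΔc, treesδc_graftδc, map_zero,
      add_zero, zero_sub, neg_zero]
  coder_Δo := by
    refine treesO_ext_graft (f := treesΔo V A ∘ₗ coderO q r)
      (g := tensorDer (coderO q r) (coderO q r) ∘ₗ treesΔo V A)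
      (fun x => ?_) (fun z => ?_) (fun z => ?_) <;>
    simp only [LinearMap.comp_apply, coderO_leafO, coderO_graftΔo, coderO_graftρ, map_add,
      treesΔo_leafO, treesΔo_graftΔo, treesΔo_graftρ, map_zero, zero_add, add_zero]
  coder_ρ := by
    refine treesO_ext_graft (f := treesρ V A ∘ₗ coderO q r) (g := coderC q ∘ₗ treesρ V A)
      (fun x => ?_) (fun z => ?_) (fun z => ?_) <;>
    simp only [LinearMap.comp_apply, coderO_leafO, coderO_graftΔo, coderO_graftρ, map_add,
      treesρ_leafO, treesρ_graftΔo, treesρ_graftρ, map_zero, zero_add, add_zero]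

end

end TreeMaps

/-! ### Maps into the cofree coalgebra -/

section Cofree

variable {K : Type v} [Field K]

theorem map_mem_range_subtype {E F G : Type*} [AddCommMonoid E] [AddCommMonoid F]
    [AddCommMonoid G] [Module K E] [Module K F] [Module K G] {R : Submodule K G}
    {f : E →ₗ[K] G} {g : F →ₗ[K] G} (hf : ∀ x, f x ∈ R) (hg : ∀ x, g x ∈ R) (z : E ⊗[K] F) :
    TensorProduct.map f g z ∈ LinearMap.range (TensorProduct.map R.subtype R.subtype) :=
  ⟨TensorProduct.map (f.codRestrict R hf) (g.codRestrict R hg) z,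
    tmul_ext (f := TensorProduct.map R.subtype R.subtype ∘ₗ
      TensorProduct.map (f.codRestrict R hf) (g.codRestrict R hg)) (g := TensorProduct.map f g)
      (fun _ _ => rfl) z⟩

/-- The image of an `S`-coalgebra. -/
theorem IsCoopHom.isSubTot_range {S : SCoalgebra.{v, u} K} {M : Cooperations.{v, u} K}
    {Tc : Tot S.C →ₗ[K] Tot M.C} {To : Tot S.D →ₗ[K] Tot M.D}
    (h : IsCoopHom S.toCooperations M Tc To) :
    IsSubTot M (LinearMap.range Tc) (LinearMap.range To) where
  homog_c := by
    rintro _ ⟨x, rfl⟩ n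
    exact ⟨_, h.deg_c.apply_component (add_zero n) x⟩
  homog_o := by
    rintro _ ⟨x, rfl⟩ n
    exact ⟨_, h.deg_o.apply_component (add_zero n) x⟩
  Δc_mem := by
    rintro _ ⟨x, rfl⟩
    rw [h.map_Δc]
    exact map_mem_range_subtype (LinearMap.mem_range_self Tc) (LinearMap.mem_range_self Tc) _
  δc_mem := by
    rintro _ ⟨x, rfl⟩
    rw [h.map_δc]
    exact map_mem_range_subtype (LinearMap.mem_range_self Tc) (LinearMap.mem_range_self Tc) _
  Δo_mem := by
    rintro _ ⟨x, rfl⟩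
    rw [h.map_Δo]
    exact map_mem_range_subtype (LinearMap.mem_range_self To) (LinearMap.mem_range_self To) _
  ρ_mem := by
    rintro _ ⟨y, rfl⟩
    exact ⟨_, (h.map_ρ y).symm⟩
  relC := by
    rintro _ ⟨x, rfl⟩
    exact h.relC (S.relC x)
  relO := by
    rintro _ ⟨y, rfl⟩
    exact h.relO (S.relO y)

/-- In each summand `Q` acts on at most one factor, so only `i x` and `Q (i x)` occur. The sign
operator is harmless because it can be moved inside `i`. -/
theorem tensorDer_map_mem {C D : GrSpace.{v, u} K} {i : Tot C →ₗ[K] Tot D} (hi : HasDegree 0 i)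
    {Q : Tot D →ₗ[K] Tot D} {R : Submodule K (Tot D)} (h1 : ∀ x, i x ∈ R) (h2 : ∀ x, Q (i x) ∈ R)
    (z : Tot C ⊗[K] Tot C) : tensorDer Q Q (TensorProduct.map i i z) ∈
      LinearMap.range (TensorProduct.map R.subtype R.subtype) := by
  have e : tensorDer Q Q (TensorProduct.map i i z) = TensorProduct.map (Q ∘ₗ i) i z +
      TensorProduct.map (i ∘ₗ sgn C) (Q ∘ₗ i) z := by
    refine tmul_ext (f := tensorDer Q Q ∘ₗ TensorProduct.map i i)
      (g := TensorProduct.map (Q ∘ₗ i) i + TensorProduct.map (i ∘ₗ sgn C) (Q ∘ₗ i))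
      (fun x y => ?_) z
    simp only [LinearMap.comp_apply, LinearMap.add_apply, TensorProduct.map_tmul,
      tensorDer_tmul, hi.map_sgn_zero]
  rw [e]
  exact Submodule.add_mem _ (map_mem_range_subtype (f := Q ∘ₗ i) h2 h1 z)
    (map_mem_range_subtype (f := i ∘ₗ sgn C) (g := Q ∘ₗ i) (fun x => h1 _) h2 z)

/-- The sum of the image of a coalgebra and its image under a coderivation. -/
theorem IsCoder.isSubTot {S : SCoalgebra.{v, u} K} {M : Cooperations.{v, u} K} (hM : M.IsGraded)
    {i : Tot S.C →ₗ[K] Tot M.C} {j : Tot S.D →ₗ[K] Tot M.D}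
    (h : IsCoopHom S.toCooperations M i j)
    {Qc : Tot M.C →ₗ[K] Tot M.C} {Qo : Tot M.D →ₗ[K] Tot M.D} (hQ : IsCoder M Qc Qo) :
    IsSubTot M (LinearMap.range i ⊔ LinearMap.range (Qc ∘ₗ i))
      (LinearMap.range j ⊔ LinearMap.range (Qo ∘ₗ j)) := by
  have c1 : ∀ x, i x ∈ LinearMap.range i ⊔ LinearMap.range (Qc ∘ₗ i) := fun x =>
    Submodule.mem_sup_left ⟨x, rfl⟩
  have c2 : ∀ x, Qc (i x) ∈ LinearMap.range i ⊔ LinearMap.range (Qc ∘ₗ i) := fun x =>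
    Submodule.mem_sup_right ⟨x, rfl⟩
  have o1 : ∀ x, j x ∈ LinearMap.range j ⊔ LinearMap.range (Qo ∘ₗ j) := fun x =>
    Submodule.mem_sup_left ⟨x, rfl⟩
  have o2 : ∀ x, Qo (j x) ∈ LinearMap.range j ⊔ LinearMap.range (Qo ∘ₗ j) := fun x =>
    Submodule.mem_sup_right ⟨x, rfl⟩
  have dc := tensorDer_map_mem h.deg_c c1 c2
  have dO := tensorDer_map_mem h.deg_o o1 o2
  have memc : ∀ x ∈ LinearMap.range i ⊔ LinearMap.range (Qc ∘ₗ i),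
      ∃ a b, x = i a + Qc (i b) := by
    intro x hx
    obtain ⟨_, ⟨a, rfl⟩, _, ⟨b, rfl⟩, rfl⟩ := Submodule.mem_sup.1 hx
    exact ⟨a, b, rfl⟩
  have memo : ∀ x ∈ LinearMap.range j ⊔ LinearMap.range (Qo ∘ₗ j),
      ∃ a b, x = j a + Qo (j b) := by
    intro x hx
    obtain ⟨_, ⟨a, rfl⟩, _, ⟨b, rfl⟩, rfl⟩ := Submodule.mem_sup.1 hx
    exact ⟨a, b, rfl⟩
  refine ⟨?_, ?_, ?_, ?_, ?_, ?_, ?_, ?_⟩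
  · intro x hx n
    obtain ⟨a, b, rfl⟩ := memc x hx
    -- The degree `n` component of `Qc (i b)` is `Qc (i b')` for the degree `n - 1` component `b'`
    -- of `b`.
    rw [DirectSum.add_apply, map_add, ← h.deg_c.apply_component (add_zero n) a,
      ← hQ.deg_c.apply_component (sub_add_cancel n 1) (i b),
      ← h.deg_c.apply_component (add_zero (n - 1)) b]
    exact Submodule.add_mem _ (c1 _) (c2 _)
  · intro x hx n
    obtain ⟨a, b, rfl⟩ := memo x hx
    rw [DirectSum.add_apply, map_add, ← h.deg_o.apply_component (add_zero n) a,
      ← hQ.deg_o.apply_component (sub_add_cancel n 1) (j b),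
      ← h.deg_o.apply_component (add_zero (n - 1)) b]
    exact Submodule.add_mem _ (o1 _) (o2 _)
  · intro x hx
    obtain ⟨a, b, rfl⟩ := memc x hx
    -- The coproduct of `Qc (i b)` has at most one `Qc` in each term, so the sum is already closed
    -- under cooperations and no iterates of `Qc` are needed.
    rw [map_add, hQ.coder_Δc, h.map_Δc, h.map_Δc]
    exact Submodule.add_mem _ (map_mem_range_subtype c1 c1 _) (dc _)
  · intro x hx
    obtain ⟨a, b, rfl⟩ := memc x hx
    rw [map_add, hQ.coder_δc, h.map_δc, h.map_δc]
    exact Submodule.add_mem _ (map_mem_range_subtype c1 c1 _) (Submodule.neg_mem _ (dc _))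
  · intro x hx
    obtain ⟨a, b, rfl⟩ := memo x hx
    rw [map_add, hQ.coder_Δo, h.map_Δo, h.map_Δo]
    exact Submodule.add_mem _ (map_mem_range_subtype o1 o1 _) (dO _)
  · intro x hx
    obtain ⟨a, b, rfl⟩ := memo x hx
    rw [map_add, hQ.coder_ρ, h.map_ρ, h.map_ρ]
    exact Submodule.add_mem _ (c1 _) (c2 _)
  · intro x hx
    obtain ⟨a, b, rfl⟩ := memc x hx
    exact (h.relC (S.relC a)).add (hQ.relC hM (h.relC (S.relC b)))
  · intro x hx
    obtain ⟨a, b, rfl⟩ := memo x hx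
    exact (h.relO (S.relO a)).add (hQ.relO hM (h.relO (S.relO b)))

/-! ### The cofree `S`-coalgebra inside the trees, and restriction of tree maps to it -/

variable (V A : GrSpace.{v, u} K)

/-- The inclusion of the cofree `S`-coalgebra into the trees. -/
def cofreeC : Tot (cofree V A).C →ₗ[K] Tot (treesC V) := incl (trees V A).maxC

/-- The inclusion of the cofree `S`-coalgebra into the trees. -/
def cofreeO : Tot (cofree V A).D →ₗ[K] Tot (treesO V A) := incl (trees V A).maxO

variable {V A}

theorem cofreeC_injective : Function.Injective (cofreeC V A) := incl_injective _

theorem cofreeO_injective : Function.Injective (cofreeO V A) := incl_injective _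

theorem cofreeC_tmul_injective :
    Function.Injective (TensorProduct.map (cofreeC V A) (cofreeC V A)) := incl_incl_injective _ _

theorem cofreeO_tmul_injective :
    Function.Injective (TensorProduct.map (cofreeO V A) (cofreeO V A)) := incl_incl_injective _ _

theorem isCoopHom_cofree :
    IsCoopHom (cofree V A).toCooperations (trees V A) (cofreeC V A) (cofreeO V A) where
  deg_c := hasDegree_lmap _
  deg_o := hasDegree_lmap _
  map_Δc x := ((trees V A).isSub_max.ops_Δc x).symm
  map_δc x := ((trees V A).isSub_max.ops_δc x).symm
  map_Δo y := ((trees V A).isSub_max.ops_Δo y).symm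
  map_ρ y := ((trees V A).isSub_max.ops_ρ y).symm

theorem cofreeC_cogenC (i : ℤ) (x : V i) :
    cofreeC V A (cogenC V A i x) = leafC V (inj V i x) :=
  (incl_inj _ _ _).trans (leafC_inj i x).symm

theorem cofreeO_cogenO (i : ℤ) (a : A i) :
    cofreeO V A (cogenO V A i a) = leafO V A (inj A i a) :=
  (incl_inj _ _ _).trans (leafO_inj i a).symm

/-- Complements are chosen degree by degree. The retraction serves to read off degrees after an
inclusion and to extend operations from the cofree coalgebra to all trees; no compatibility with
cooperations is needed. -/
theorem exists_retraction {C : GrSpace.{v, u} K} (N : ∀ n, Submodule K (C n)) :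
    ∃ r : Tot C →ₗ[K] Tot (sub N), HasDegree 0 r ∧ ∀ x, r (incl N x) = x := by
  choose r hr using fun n => (N n).subtype.exists_leftInverse_of_injective (N n).ker_subtype
  refine ⟨DirectSum.lmap (fun n => (r n : C n →ₗ[K] sub N n)), hasDegree_lmap _,
    tot_ext (f := DirectSum.lmap (fun n => (r n : C n →ₗ[K] sub N n)) ∘ₗ incl N)
    (g := LinearMap.id) fun n x => ?_⟩
  rw [LinearMap.comp_apply, incl_inj]
  refine (DirectSum.lmap_lof (fun n => (r n : C n →ₗ[K] sub N n)) n x.1).trans ?_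
  exact congrArg _ (LinearMap.congr_fun (hr n) x)

theorem exists_retractionC : ∃ r : Tot (treesC V) →ₗ[K] Tot (cofree V A).C,
    HasDegree 0 r ∧ ∀ x, r (cofreeC V A x) = x := exists_retraction (trees V A).maxC

theorem exists_retractionO : ∃ r : Tot (treesO V A) →ₗ[K] Tot (cofree V A).D,
    HasDegree 0 r ∧ ∀ x, r (cofreeO V A x) = x := exists_retraction (trees V A).maxO

/-- A linear map of degree `d` into a graded space which has values in a graded subspace. -/
theorem HasDegree.of_comp {C D E : GrSpace.{v, u} K} {d : ℤ} {f : Tot C →ₗ[K] Tot D}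
    {i : Tot D →ₗ[K] Tot E} {r : Tot E →ₗ[K] Tot D} (hr : HasDegree 0 r) (hi : ∀ x, r (i x) = x)
    (h : HasDegree d (i ∘ₗ f)) : HasDegree d f := by
  have e : f = r ∘ₗ i ∘ₗ f := LinearMap.ext fun x => (hi (f x)).symm
  rw [e]
  exact hr.comp h (add_zero d)

/-- A morphism of tree coalgebras induces a morphism of cofree `S`-coalgebras. -/
theorem IsCoopHom.exists_cofree {V' A' : GrSpace.{v, u} K}
    {Tc : Tot (treesC V) →ₗ[K] Tot (treesC V')} {To : Tot (treesO V A) →ₗ[K] Tot (treesO V' A')}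
    (h : IsCoopHom (trees V A) (trees V' A') Tc To) :
    ∃ T : SCoalgebra.Hom (cofree V A) (cofree V' A'),
      (∀ x, cofreeC V' A' (T.Tc x) = Tc (cofreeC V A x)) ∧
      ∀ y, cofreeO V' A' (T.To y) = To (cofreeO V A y) := by
  have hi := isCoopHom_cofree (V := V) (A := A)
  have hi' := isCoopHom_cofree (V := V') (A := A')
  have hT : IsCoopHom (cofree V A).toCooperations (trees V' A') (Tc ∘ₗ cofreeC V A)
      (To ∘ₗ cofreeO V A) :=
    { deg_c := h.deg_c.comp hi.deg_c (add_zero 0)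
      deg_o := h.deg_o.comp hi.deg_o (add_zero 0)
      map_Δc := fun x => by
        rw [LinearMap.comp_apply, h.map_Δc, hi.map_Δc, TensorProduct.map_comp]; rfl
      map_δc := fun x => by
        rw [LinearMap.comp_apply, h.map_δc, hi.map_δc, TensorProduct.map_comp]; rfl
      map_Δo := fun x => by
        rw [LinearMap.comp_apply, h.map_Δo, hi.map_Δo, TensorProduct.map_comp]; rfl
      map_ρ := fun y => by
        rw [LinearMap.comp_apply, h.map_ρ, hi.map_ρ]; rfl }
  -- The image of the cofree coalgebra is an `S`-coalgebra inside the target trees, hence contained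
  -- in the largest one.
  have hc : ∀ x, Tc (cofreeC V A x) ∈ LinearMap.range (cofreeC V' A') := fun x =>
    hT.isSubTot_range.le_range_c (trees_isGraded V' A') ⟨x, rfl⟩
  have ho : ∀ y, To (cofreeO V A y) ∈ LinearMap.range (cofreeO V' A') := fun y =>
    hT.isSubTot_range.le_range_o (trees_isGraded V' A') ⟨y, rfl⟩
  let Sc := restrict (cofreeC V A) (cofreeC V' A') cofreeC_injective Tc hc
  let So := restrict (cofreeO V A) (cofreeO V' A') cofreeO_injective To ho
  have sc : ∀ x, cofreeC V' A' (Sc x) = Tc (cofreeC V A x) := restrict_spec _ _ _ _ _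
  have so : ∀ y, cofreeO V' A' (So y) = To (cofreeO V A y) := restrict_spec _ _ _ _ _
  have tc : ∀ z, TensorProduct.map (cofreeC V' A') (cofreeC V' A') (TensorProduct.map Sc Sc z) =
      TensorProduct.map Tc Tc (TensorProduct.map (cofreeC V A) (cofreeC V A) z) :=
    tmul_ext (f := TensorProduct.map (cofreeC V' A') (cofreeC V' A') ∘ₗ TensorProduct.map Sc Sc)
      (g := TensorProduct.map Tc Tc ∘ₗ TensorProduct.map (cofreeC V A) (cofreeC V A))
      fun x y => by simp only [LinearMap.comp_apply, TensorProduct.map_tmul, sc]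
  have tO : ∀ z, TensorProduct.map (cofreeO V' A') (cofreeO V' A') (TensorProduct.map So So z) =
      TensorProduct.map To To (TensorProduct.map (cofreeO V A) (cofreeO V A) z) :=
    tmul_ext (f := TensorProduct.map (cofreeO V' A') (cofreeO V' A') ∘ₗ TensorProduct.map So So)
      (g := TensorProduct.map To To ∘ₗ TensorProduct.map (cofreeO V A) (cofreeO V A))
      fun x y => by simp only [LinearMap.comp_apply, TensorProduct.map_tmul, so]
  obtain ⟨rc, hrc, hrc'⟩ := exists_retractionC (V := V') (A := A')
  obtain ⟨ro, hro, hro'⟩ := exists_retractionO (V := V') (A := A')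
  refine ⟨⟨Sc, So, .of_comp hrc hrc' ?_, .of_comp hro hro' ?_, LinearMap.ext fun x => ?_,
    LinearMap.ext fun x => ?_, LinearMap.ext fun x => ?_, LinearMap.ext fun x => ?_⟩, sc, so⟩
  · rw [show cofreeC V' A' ∘ₗ Sc = Tc ∘ₗ cofreeC V A from LinearMap.ext sc]
    exact hT.deg_c
  · rw [show cofreeO V' A' ∘ₗ So = To ∘ₗ cofreeO V A from LinearMap.ext so]
    exact hT.deg_o
  · refine cofreeC_tmul_injective ?_
    rw [LinearMap.comp_apply, ← hi'.map_Δc, sc, h.map_Δc, hi.map_Δc]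
    exact (tc _).symm
  · refine cofreeC_tmul_injective ?_
    rw [LinearMap.comp_apply, ← hi'.map_δc, sc, h.map_δc, hi.map_δc]
    exact (tc _).symm
  · refine cofreeO_tmul_injective ?_
    rw [LinearMap.comp_apply, ← hi'.map_Δo, so, h.map_Δo, hi.map_Δo]
    exact (tO _).symm
  · refine cofreeC_injective (V := V') (A := A') ?_
    rw [LinearMap.comp_apply, ← hi'.map_ρ, so, h.map_ρ, hi.map_ρ]
    exact (sc _).symm

/-- A coderivation of the tree coalgebra induces a coderivation of the cofree `S`-coalgebra. -/
theorem IsCoder.exists_cofree {Qc : Tot (treesC V) →ₗ[K] Tot (treesC V)}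
    {Qo : Tot (treesO V A) →ₗ[K] Tot (treesO V A)} (h : IsCoder (trees V A) Qc Qo) :
    ∃ Rc Ro, IsCoder (cofree V A).toCooperations Rc Ro ∧
      (∀ x, cofreeC V A (Rc x) = Qc (cofreeC V A x)) ∧
      ∀ y, cofreeO V A (Ro y) = Qo (cofreeO V A y) := by
  have hi := isCoopHom_cofree (V := V) (A := A)
  have hS := h.isSubTot (trees_isGraded V A) hi
  -- The cofree coalgebra plus its image under the coderivation is an `S`-coalgebra inside the
  -- trees, so by maximality it is no larger than the cofree coalgebra.
  have hc : ∀ x, Qc (cofreeC V A x) ∈ LinearMap.range (cofreeC V A) := fun x =>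
    hS.le_range_c (trees_isGraded V A) (Submodule.mem_sup_right ⟨x, rfl⟩)
  have ho : ∀ y, Qo (cofreeO V A y) ∈ LinearMap.range (cofreeO V A) := fun y =>
    hS.le_range_o (trees_isGraded V A) (Submodule.mem_sup_right ⟨y, rfl⟩)
  let Rc := restrict (cofreeC V A) (cofreeC V A) cofreeC_injective Qc hc
  let Ro := restrict (cofreeO V A) (cofreeO V A) cofreeO_injective Qo ho
  have sc : ∀ x, cofreeC V A (Rc x) = Qc (cofreeC V A x) := restrict_spec _ _ _ _ _
  have so : ∀ y, cofreeO V A (Ro y) = Qo (cofreeO V A y) := restrict_spec _ _ _ _ _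
  have tc := map_tensorDer hi.deg_c sc sc
  have tO := map_tensorDer hi.deg_o so so
  obtain ⟨rc, hrc, hrc'⟩ := exists_retractionC (V := V) (A := A)
  obtain ⟨ro, hro, hro'⟩ := exists_retractionO (V := V) (A := A)
  refine ⟨Rc, Ro, ⟨.of_comp hrc hrc' ?_, .of_comp hro hro' ?_, fun x => ?_, fun x => ?_,
    fun x => ?_, fun x => ?_⟩, sc, so⟩
  · rw [show cofreeC V A ∘ₗ Rc = Qc ∘ₗ cofreeC V A from LinearMap.ext sc]
    exact h.deg_c.comp hi.deg_c (zero_add 1)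
  · rw [show cofreeO V A ∘ₗ Ro = Qo ∘ₗ cofreeO V A from LinearMap.ext so]
    exact h.deg_o.comp hi.deg_o (zero_add 1)
  · refine cofreeC_tmul_injective ?_
    rw [← hi.map_Δc, sc, h.coder_Δc, hi.map_Δc]
    exact (tc _).symm
  · refine cofreeC_tmul_injective ?_
    rw [← hi.map_δc, sc, h.coder_δc, hi.map_δc, map_neg]
    exact congrArg Neg.neg (tc _).symm
  · refine cofreeO_tmul_injective ?_
    rw [← hi.map_Δo, so, h.coder_Δo, hi.map_Δo]
    exact (tO _).symm
  · refine cofreeC_injective (V := V) (A := A) ?_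
    rw [← hi.map_ρ, so, h.coder_ρ, hi.map_ρ]
    exact (sc _).symm

end Cofree

/-! ### Conilpotency -/

section Conilpotent

variable {K : Type v} [Field K]

/-- The number of vertices and leaves. -/
def CTree.size : CTree → ℕ
  -- Leaves count, so stage 0 of the filtration is zero and the conilpotency induction starts
  -- trivially.
  | leaf _ => 1
  | prod l r => l.size + r.size + 1
  | brac l r => l.size + r.size + 1

/-- The number of vertices and leaves. -/
def OTree.size : OTree → ℕ
  | leaf _ => 1
  | prod l r => l.size + r.size + 1
  | rho t => t.size + 1

variable (V A : GrSpace.{v, u} K)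

/-- The span of the trees of bounded size. -/
def filtC (n : ℕ) : Submodule K (Tot (treesC V)) :=
  ⨆ (t : CTree) (_ : t.size ≤ n), LinearMap.range (embC V t)

/-- The span of the trees of bounded size. -/
def filtO (n : ℕ) : Submodule K (Tot (treesO V A)) :=
  ⨆ (t : OTree) (_ : t.size ≤ n), LinearMap.range (embO V A t)

variable {V A}

theorem embC_mem_filtC {t : CTree} {n : ℕ} (h : t.size ≤ n) (x : t.tens V) :
    embC V t x ∈ filtC V n :=
  Submodule.mem_iSup_of_mem t (Submodule.mem_iSup_of_mem h ⟨x, rfl⟩)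

theorem embO_mem_filtO {t : OTree} {n : ℕ} (h : t.size ≤ n) (x : t.tens V A) :
    embO V A t x ∈ filtO V A n :=
  Submodule.mem_iSup_of_mem t (Submodule.mem_iSup_of_mem h ⟨x, rfl⟩)

theorem filtC_le {n : ℕ} {S : Submodule K (Tot (treesC V))}
    (h : ∀ t : CTree, t.size ≤ n → ∀ x, embC V t x ∈ S) : filtC V n ≤ S :=
  iSup₂_le fun t ht => by rintro _ ⟨x, rfl⟩; exact h t ht x

theorem filtO_le {n : ℕ} {S : Submodule K (Tot (treesO V A))}
    (h : ∀ t : OTree, t.size ≤ n → ∀ x, embO V A t x ∈ S) : filtO V A n ≤ S :=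
  iSup₂_le fun t ht => by rintro _ ⟨x, rfl⟩; exact h t ht x

theorem exists_mem_filtC (z : Tot (treesC V)) : ∃ n, z ∈ filtC V n := by
  have hm : Monotone (filtC V) := fun m n h => filtC_le fun t ht x => embC_mem_filtC (ht.trans h) x
  have h : z ∈ ⨆ n, filtC V n := by
    rw [← Submodule.Quotient.mk_eq_zero]
    exact treesC_ext (f := (⨆ n, filtC V n).mkQ) (g := 0) (fun t x =>
      (Submodule.Quotient.mk_eq_zero _).2 (Submodule.mem_iSup_of_mem t.size
        (embC_mem_filtC le_rfl x))) z
  exact (Submodule.mem_iSup_of_directed _ hm.directed_le).1 h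

theorem exists_mem_filtO (z : Tot (treesO V A)) : ∃ n, z ∈ filtO V A n := by
  have hm : Monotone (filtO V A) := fun m n h =>
    filtO_le fun t ht x => embO_mem_filtO (ht.trans h) x
  have h : z ∈ ⨆ n, filtO V A n := by
    rw [← Submodule.Quotient.mk_eq_zero]
    exact treesO_ext (f := (⨆ n, filtO V A n).mkQ) (g := 0) (fun t x =>
      (Submodule.Quotient.mk_eq_zero _).2 (Submodule.mem_iSup_of_mem t.size
        (embO_mem_filtO le_rfl x))) z
  exact (Submodule.mem_iSup_of_directed _ hm.directed_le).1 h

/-- The branches at the root are strictly smaller than the tree. This drop in the filtration is the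
conilpotency of the tree coalgebra. -/
theorem treesΔc_filtC {n : ℕ} {z : Tot (treesC V)} (hz : z ∈ filtC V (n + 1)) :
    treesΔc V z ∈ LinearMap.range
      (TensorProduct.map (filtC V n).subtype (filtC V n).subtype) := by
  refine filtC_le (S := (LinearMap.range
    (TensorProduct.map (filtC V n).subtype (filtC V n).subtype)).comap (treesΔc V)) (fun t ht x => ?_) hz
  rw [Submodule.mem_comap, treesΔc_emb]
  cases t with
  | leaf i => exact Submodule.zero_mem _
  | prod l r =>
    simp only [CTree.size] at ht
    exact map_mem_range_subtype (embC_mem_filtC (by omega)) (embC_mem_filtC (by omega)) x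
  | brac l r => exact Submodule.zero_mem _

theorem treesδc_filtC {n : ℕ} {z : Tot (treesC V)} (hz : z ∈ filtC V (n + 1)) :
    treesδc V z ∈ LinearMap.range
      (TensorProduct.map (filtC V n).subtype (filtC V n).subtype) := by
  refine filtC_le (S := (LinearMap.range
    (TensorProduct.map (filtC V n).subtype (filtC V n).subtype)).comap (treesδc V)) (fun t ht x => ?_) hz
  rw [Submodule.mem_comap, treesδc_emb]
  cases t with
  | leaf i => exact Submodule.zero_mem _
  | prod l r => exact Submodule.zero_mem _
  | brac l r =>
    simp only [CTree.size] at ht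
    exact map_mem_range_subtype (embC_mem_filtC (by omega)) (embC_mem_filtC (by omega)) x

theorem treesΔo_filtO {n : ℕ} {z : Tot (treesO V A)} (hz : z ∈ filtO V A (n + 1)) :
    treesΔo V A z ∈ LinearMap.range
      (TensorProduct.map (filtO V A n).subtype (filtO V A n).subtype) := by
  refine filtO_le (S := (LinearMap.range
    (TensorProduct.map (filtO V A n).subtype (filtO V A n).subtype)).comap (treesΔo V A)) (fun t ht x => ?_) hz
  rw [Submodule.mem_comap, treesΔo_emb]
  cases t with
  | leaf i => exact Submodule.zero_mem _
  | prod l r =>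
    simp only [OTree.size] at ht
    exact map_mem_range_subtype (embO_mem_filtO (by omega)) (embO_mem_filtO (by omega)) x
  | rho t => exact Submodule.zero_mem _

theorem filtC_zero {z : Tot (treesC V)} (hz : z ∈ filtC V 0) : z = 0 := by
  refine (Submodule.mem_bot K).1 (filtC_le (fun t ht x => ?_) hz)
  cases t <;> simp [CTree.size] at ht

theorem filtO_zero {z : Tot (treesO V A)} (hz : z ∈ filtO V A 0) : z = 0 := by
  refine (Submodule.mem_bot K).1 (filtO_le (fun t ht x => ?_) hz)
  cases t <;> simp [OTree.size] at ht

/-- If `E` vanishes on `F ∩ B`, then `E ⊗ G` and `G ⊗ E` vanish on `(F ⊗ F) ∩ (B ⊗ B)`. -/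
theorem map_eq_zero_of_mem {B T Y Z : Type*} [AddCommGroup B] [AddCommGroup T] [AddCommGroup Y]
    [AddCommGroup Z] [Module K B] [Module K T] [Module K Y] [Module K Z] {i : B →ₗ[K] T}
    (hi : Function.Injective i) {F : Submodule K T} {E : B →ₗ[K] Y} (hE : ∀ x, i x ∈ F → E x = 0)
    (G : B →ₗ[K] Z) {z : B ⊗[K] B}
    (hz : TensorProduct.map i i z ∈ LinearMap.range (TensorProduct.map F.subtype F.subtype)) :
    TensorProduct.map E G z = 0 ∧ TensorProduct.map G E z = 0 := by
  obtain ⟨s, hs⟩ := i.exists_leftInverse_of_injective (LinearMap.ker_eq_bot.2 hi)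
  -- The quotient of `B` by the preimage of `F` embeds into `T / F`, and over a field the embedding
  -- has a retraction `r`.
  have hinj : LinearMap.ker ((F.comap i).mapQ F i le_rfl) = ⊥ := by
    refine LinearMap.ker_eq_bot'.2 fun w hw => ?_
    obtain ⟨x, rfl⟩ := (F.comap i).mkQ_surjective w
    exact (Submodule.Quotient.mk_eq_zero _).2 ((Submodule.Quotient.mk_eq_zero F).1 hw)
  obtain ⟨r, hr⟩ := ((F.comap i).mapQ F i le_rfl).exists_leftInverse_of_injective hinj
  -- This extends `E` to all of `T` so that it vanishes on `F`. Since `G` also extends, through the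
  -- left inverse `s`, both tensor maps factor through `T ⊗ T` and can be evaluated on the
  -- representative in `F ⊗ F`; the intersection of `F ⊗ F` with `B ⊗ B` need not be computed.
  let E' : T →ₗ[K] Y := (F.comap i).liftQ E hE ∘ₗ r ∘ₗ F.mkQ
  have h1 : ∀ x, E' (i x) = E x := fun x =>
    congrArg ((F.comap i).liftQ E hE) (LinearMap.congr_fun hr ((F.comap i).mkQ x))
  have h2 : E' ∘ₗ F.subtype = 0 := by
    ext x
    have e : F.mkQ x = 0 := (Submodule.Quotient.mk_eq_zero F).2 x.2
    change (F.comap i).liftQ E hE (r (F.mkQ x)) = 0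
    rw [e, map_zero, map_zero]
  have h1' : E' ∘ₗ i = E := LinearMap.ext h1
  have h3 : (G ∘ₗ s) ∘ₗ i = G := by rw [LinearMap.comp_assoc, hs, LinearMap.comp_id]
  obtain ⟨w, hw⟩ := hz
  constructor
  · rw [← h1', ← h3, TensorProduct.map_comp, LinearMap.comp_apply, ← hw, ← LinearMap.comp_apply,
      ← TensorProduct.map_comp, h2, TensorProduct.map_zero_left, LinearMap.zero_apply]
  · rw [← h1', ← h3, TensorProduct.map_comp, LinearMap.comp_apply, ← hw, ← LinearMap.comp_apply,
      ← TensorProduct.map_comp, h2, TensorProduct.map_zero_right, LinearMap.zero_apply]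

/-- Conilpotency: maps on the cofree coalgebra vanish if their values at an element are
determined by their values on the cooperations. -/
theorem eq_zero_of_conilpotent {Yc Yo Zc Zo : Type*} [AddCommGroup Yc] [AddCommGroup Yo]
    [AddCommGroup Zc] [AddCommGroup Zo] [Module K Yc] [Module K Yo] [Module K Zc] [Module K Zo]
    {Ec : Tot (cofree V A).C →ₗ[K] Yc} {Eo : Tot (cofree V A).D →ₗ[K] Yo}
    (Gc Gc' : Tot (cofree V A).C →ₗ[K] Zc) (Go Go' : Tot (cofree V A).D →ₗ[K] Zo)
    (hc : ∀ x, TensorProduct.map Ec Gc ((cofree V A).Δc x) = 0 →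
      TensorProduct.map Gc' Ec ((cofree V A).Δc x) = 0 →
      TensorProduct.map Ec Gc ((cofree V A).δc x) = 0 →
      TensorProduct.map Gc' Ec ((cofree V A).δc x) = 0 → Ec x = 0)
    (ho : ∀ y, TensorProduct.map Eo Go ((cofree V A).Δo y) = 0 →
      TensorProduct.map Go' Eo ((cofree V A).Δo y) = 0 → Ec ((cofree V A).ρ y) = 0 → Eo y = 0) :
    Ec = 0 ∧ Eo = 0 := by
  have hi := isCoopHom_cofree (V := V) (A := A)
  -- The cofree coalgebra gets the filtration induced from the trees. At stage `n + 1` the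
  -- cooperations take values in stage `n`, where `Ec` vanishes by induction, which gives the four
  -- hypotheses of `hc`.
  have kc : ∀ n x, cofreeC V A x ∈ filtC V n → Ec x = 0 := by
    intro n
    induction n with
    | zero =>
      intro x hx
      rw [cofreeC_injective ((filtC_zero hx).trans (map_zero (cofreeC V A)).symm), map_zero]
    | succ n ih =>
      intro x hx
      have m1 := treesΔc_filtC hx
      have m2 := treesδc_filtC hx
      have e1 : treesΔc V (cofreeC V A x) = _ := hi.map_Δc x
      have e2 : treesδc V (cofreeC V A x) = _ := hi.map_δc x
      rw [e1] at m1
      rw [e2] at m2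
      exact hc x (map_eq_zero_of_mem cofreeC_injective ih Gc m1).1
        (map_eq_zero_of_mem cofreeC_injective ih Gc' m1).2
        (map_eq_zero_of_mem cofreeC_injective ih Gc m2).1
        (map_eq_zero_of_mem cofreeC_injective ih Gc' m2).2
  have kc' : ∀ x, Ec x = 0 := fun x => (exists_mem_filtC (cofreeC V A x)).elim fun n => kc n x
  -- Color `c` is finished first, so `ρ` needs no control of sizes: `Ec` already vanishes
  -- everywhere.
  have ko : ∀ n y, cofreeO V A y ∈ filtO V A n → Eo y = 0 := by
    intro n
    induction n with
    | zero =>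
      intro y hy
      rw [cofreeO_injective ((filtO_zero hy).trans (map_zero (cofreeO V A)).symm), map_zero]
    | succ n ih =>
      intro y hy
      have m1 := treesΔo_filtO hy
      have e1 : treesΔo V A (cofreeO V A y) = _ := hi.map_Δo y
      rw [e1] at m1
      exact ho y (map_eq_zero_of_mem cofreeO_injective ih Go m1).1
        (map_eq_zero_of_mem cofreeO_injective ih Go' m1).2 (kc' _)
  exact ⟨LinearMap.ext kc', LinearMap.ext fun y =>
    (exists_mem_filtO (cofreeO V A y)).elim fun n => ko n y⟩

/-- An element of the cofree coalgebra is a cogenerator if the cooperations vanish on it. -/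
theorem cofreeC_eq_leafC {x : Tot (cofree V A).C} (h1 : (cofree V A).Δc x = 0)
    (h2 : (cofree V A).δc x = 0) : cofreeC V A x = leafC V (prC V (cofreeC V A x)) := by
  have hi := isCoopHom_cofree (V := V) (A := A)
  have e1 : treesΔc V (cofreeC V A x) = 0 := by
    have := hi.map_Δc x
    rw [h1, map_zero] at this
    exact this
  have e2 : treesδc V (cofreeC V A x) = 0 := by
    have := hi.map_δc x
    rw [h2, map_zero] at this
    exact this
  have := treesC_decomp (cofreeC V A x)
  rwa [e1, e2, map_zero, map_zero, add_zero, add_zero] at this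

theorem cofreeO_eq_leafO {y : Tot (cofree V A).D} (h1 : (cofree V A).Δo y = 0)
    (h2 : (cofree V A).ρ y = 0) : cofreeO V A y = leafO V A (prO V A (cofreeO V A y)) := by
  have hi := isCoopHom_cofree (V := V) (A := A)
  have e1 : treesΔo V A (cofreeO V A y) = 0 := by
    have := hi.map_Δo y
    rw [h1, map_zero] at this
    exact this
  have e2 : treesρ V A (cofreeO V A y) = 0 := by
    have := hi.map_ρ y
    rw [h2, map_zero] at this
    exact this
  have := treesO_decomp (cofreeO V A y)
  rwa [e1, e2, map_zero, map_zero, add_zero, add_zero] at this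

end Conilpotent

/-! ### Homotopy transfer -/

section Transfer

variable {K : Type v} [Field K]

/-- The identities which make transferred structures work, on one color: `S` and `S'` are
coalgebras in trees `T` and `T'` with cogenerators `W` and `W'`. -/
theorem transfer_identity {S S' T T' W W' : Type*} [AddCommGroup S] [AddCommGroup S']
    [AddCommGroup T] [AddCommGroup T'] [AddCommGroup W] [AddCommGroup W'] [Module K S]
    [Module K S'] [Module K T] [Module K T'] [Module K W] [Module K W']
    {i : S →ₗ[K] T} {i' : S' →ₗ[K] T'} {pr : T →ₗ[K] W} {pr' : T' →ₗ[K] W'}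
    {d : W →ₗ[K] W} {d' : W' →ₗ[K] W'} {F : W →ₗ[K] W'} {p : W' →ₗ[K] W} {h : W' →ₗ[K] W'}
    {m : T' →ₗ[K] W'} {M : T →ₗ[K] T'} {Q : T →ₗ[K] T} {MS : S →ₗ[K] S'} {QS : S →ₗ[K] S}
    {QS' : S' →ₗ[K] S'}
    (hd : ∀ x, d (d x) = 0) (hd' : ∀ x, d' (d' x) = 0) (hF : ∀ x, F (d x) = d' (F x))
    (hp : ∀ x, d (p x) = p (d' x)) (hh : ∀ x, F (p x) = d' (h x) + h (d' x) + x)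
    (hQ' : ∀ x, QS' (QS' x) = 0) (hm : ∀ x, m (i' x) = pr' (i' (QS' x)) - d' (pr' (i' x)))
    (hM : ∀ x, i' (MS x) = M (i x)) (hQ : ∀ x, i (QS x) = Q (i x))
    (hprM : ∀ z, pr' (M z) = F (pr z) + h (m (M z)))
    (hprQ : ∀ z, pr (Q z) = d (pr z) + p (m (M z))) (x : S) :
    pr' (i' (MS (QS x) - QS' (MS x))) = h (m (i' (MS (QS x) - QS' (MS x)))) ∧
      (MS (QS x) = QS' (MS x) → pr (i (QS (QS x))) = 0) := by
  have e1 : d' (m (i' (MS x))) = d' (pr' (i' (QS' (MS x)))) := by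
    rw [hm, map_sub, hd', sub_zero]
  -- This is `Q'² = 0` read on cogenerators: `m Q' = -d' m`.
  have e2 : m (i' (QS' (MS x))) = -d' (m (i' (MS x))) := by
    rw [e1, hm, hQ', map_zero, map_zero, zero_sub]
  constructor
  · have e3 : pr' (i' (QS' (MS x))) = m (i' (MS x)) + d' (pr' (i' (MS x))) := by
      rw [hm, sub_add_cancel]
    -- The homotopy relation replaces `F p m T` by `d' h m T + h d' m T + m T`. The terms of `pr' Q'
    -- T` cancel, and the remaining `h d' m T` is `-h m Q' T` by `e2`.
    rw [map_sub, map_sub, map_sub, map_sub, e2, e3, hM, hM, hprM, hprM, hQ, hprQ]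
    simp only [map_add, map_neg, hF, hh]
    abel
  · intro hx
    -- What remains of `pr Q²` is `d p m T + p m T Q`. Commutation turns `m T Q` into `m Q' T = -d'
    -- m T`, and `p` is a chain map.
    rw [hQ, hprQ, hQ, hprQ, map_add, hd, ← hQ, ← hM, ← hM, hx, e2, hp, map_neg, zero_add,
      add_neg_cancel]

end Transfer

/-! ### Uniqueness on cogenerators -/

section Uniqueness

variable {K : Type v} [Field K] {V A V' A' : GrSpace.{v, u} K}

/-- A primitive element is a leaf, and then `H` kills it, so its only component vanishes. The lemma
is applied with `H = h m` for the commutation of `T` with the codifferentials, and with `H = 0` for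
`Q² = 0`. -/
theorem eq_zero_of_primitiveC {x : Tot (cofree V A).C} (h1 : (cofree V A).Δc x = 0)
    (h2 : (cofree V A).δc x = 0) {H : Tot (treesC V) →ₗ[K] Tot V} (hH : ∀ v, H (leafC V v) = 0)
    (hx : prC V (cofreeC V A x) = H (cofreeC V A x)) : x = 0 := by
  have e := cofreeC_eq_leafC h1 h2
  rw [hx, (congrArg H e).trans (hH _), map_zero] at e
  exact cofreeC_injective (e.trans (map_zero (cofreeC V A)).symm)

theorem eq_zero_of_primitiveO {y : Tot (cofree V A).D} (h1 : (cofree V A).Δo y = 0)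
    (h2 : (cofree V A).ρ y = 0) {H : Tot (treesO V A) →ₗ[K] Tot A}
    (hH : ∀ a, H (leafO V A a) = 0) (hy : prO V A (cofreeO V A y) = H (cofreeO V A y)) :
    y = 0 := by
  have e := cofreeO_eq_leafO h1 h2
  rw [hy, (congrArg H e).trans (hH _), map_zero] at e
  exact cofreeO_injective (e.trans (map_zero (cofreeO V A)).symm)

/-- This is the coderivation rule along `T` for the defect `T Q - Q' T`; the companions of the
defect are `T` on the right and `T` with a sign on the left. -/
theorem map_tensorDer_sub {C C' : GrSpace.{v, u} K} {T : Tot C →ₗ[K] Tot C'}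
    (hT : HasDegree 0 T) (Q : Tot C →ₗ[K] Tot C) (Q' : Tot C' →ₗ[K] Tot C')
    (z : Tot C ⊗[K] Tot C) :
    TensorProduct.map T T (tensorDer Q Q z) - tensorDer Q' Q' (TensorProduct.map T T z) =
      TensorProduct.map (T ∘ₗ Q - Q' ∘ₗ T) T z +
        TensorProduct.map (T ∘ₗ sgn C) (T ∘ₗ Q - Q' ∘ₗ T) z := by
  refine tmul_ext (f := TensorProduct.map T T ∘ₗ tensorDer Q Q -
      tensorDer Q' Q' ∘ₗ TensorProduct.map T T)
    (g := TensorProduct.map (T ∘ₗ Q - Q' ∘ₗ T) T +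
      TensorProduct.map (T ∘ₗ sgn C) (T ∘ₗ Q - Q' ∘ₗ T)) (fun x y => ?_) z
  simp only [LinearMap.comp_apply, LinearMap.sub_apply, LinearMap.add_apply, tensorDer_tmul,
    map_add, TensorProduct.map_tmul, hT.map_sgn_zero, TensorProduct.sub_tmul,
    TensorProduct.tmul_sub]
  abel

/-- A morphism commutes with two coderivations if it does so on cogenerators. -/
theorem IsCoopHom.comm_of_primitive {Tc : Tot (cofree V A).C →ₗ[K] Tot (cofree V' A').C}
    {To : Tot (cofree V A).D →ₗ[K] Tot (cofree V' A').D}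
    (hT : IsCoopHom (cofree V A).toCooperations (cofree V' A').toCooperations Tc To)
    {Qc : Tot (cofree V A).C →ₗ[K] Tot (cofree V A).C}
    {Qo : Tot (cofree V A).D →ₗ[K] Tot (cofree V A).D}
    (hQ : IsCoder (cofree V A).toCooperations Qc Qo)
    {Qc' : Tot (cofree V' A').C →ₗ[K] Tot (cofree V' A').C}
    {Qo' : Tot (cofree V' A').D →ₗ[K] Tot (cofree V' A').D}
    (hQ' : IsCoder (cofree V' A').toCooperations Qc' Qo')
    (hc : ∀ x, (cofree V' A').Δc (Tc (Qc x) - Qc' (Tc x)) = 0 →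
      (cofree V' A').δc (Tc (Qc x) - Qc' (Tc x)) = 0 → Tc (Qc x) - Qc' (Tc x) = 0)
    (ho : ∀ y, (cofree V' A').Δo (To (Qo y) - Qo' (To y)) = 0 →
      (cofree V' A').ρ (To (Qo y) - Qo' (To y)) = 0 → To (Qo y) - Qo' (To y) = 0) :
    Tc ∘ₗ Qc - Qc' ∘ₗ Tc = 0 ∧ To ∘ₗ Qo - Qo' ∘ₗ To = 0 := by
  refine eq_zero_of_conilpotent Tc (Tc ∘ₗ sgn _) To (To ∘ₗ sgn _) (fun x a1 a2 b1 b2 => hc x ?_ ?_)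
    fun y a1 a2 b => ho y ?_ ?_
  · rw [map_sub, hT.map_Δc, hQ'.coder_Δc, hQ.coder_Δc, hT.map_Δc, map_tensorDer_sub hT.deg_c, a1,
      a2, add_zero]
  · rw [map_sub, hT.map_δc, hQ'.coder_δc, hQ.coder_δc, hT.map_δc, map_neg, sub_neg_eq_add,
      neg_add_eq_sub, ← neg_sub, map_tensorDer_sub hT.deg_c, b1, b2, add_zero, neg_zero]
  · rw [map_sub, hT.map_Δo, hQ'.coder_Δo, hQ.coder_Δo, hT.map_Δo, map_tensorDer_sub hT.deg_o, a1,
      a2, add_zero]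
  · rw [map_sub, hT.map_ρ, hQ'.coder_ρ, hQ.coder_ρ, hT.map_ρ]
    exact b

/-- A coderivation has square zero if it does so on cogenerators. -/
theorem IsCoder.comp_self_eq_zero {Qc : Tot (cofree V A).C →ₗ[K] Tot (cofree V A).C}
    {Qo : Tot (cofree V A).D →ₗ[K] Tot (cofree V A).D}
    (hQ : IsCoder (cofree V A).toCooperations Qc Qo)
    (hc : ∀ x, (cofree V A).Δc (Qc (Qc x)) = 0 → (cofree V A).δc (Qc (Qc x)) = 0 → Qc (Qc x) = 0)
    (ho : ∀ y, (cofree V A).Δo (Qo (Qo y)) = 0 → (cofree V A).ρ (Qo (Qo y)) = 0 →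
      Qo (Qo y) = 0) :
    Qc ∘ₗ Qc = 0 ∧ Qo ∘ₗ Qo = 0 := by
  -- The companions are identities without signs because `Q²` is even.
  refine eq_zero_of_conilpotent LinearMap.id LinearMap.id LinearMap.id LinearMap.id
    (fun x a1 a2 b1 b2 => hc x ?_ ?_) fun y a1 a2 b => ho y ?_ ?_
  · rw [hQ.coder_Δc, hQ.coder_Δc, tensorDer_tensorDer hQ.deg_c, a2, add_zero]
    exact a1
  · rw [hQ.coder_δc, hQ.coder_δc, map_neg, neg_neg, tensorDer_tensorDer hQ.deg_c, b2, add_zero]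
    exact b1
  · rw [hQ.coder_Δo, hQ.coder_Δo, tensorDer_tensorDer hQ.deg_o, a2, add_zero]
    exact a1
  · rw [hQ.coder_ρ, hQ.coder_ρ]
    exact b

theorem SCoalgebra.Hom.isCoopHom {S S' : SCoalgebra.{v, u} K} (T : S.Hom S') :
    IsCoopHom S.toCooperations S'.toCooperations T.Tc T.To where
  deg_c := T.deg_Tc
  deg_o := T.deg_To
  map_Δc := LinearMap.congr_fun T.map_Δc
  map_δc := LinearMap.congr_fun T.map_δc
  map_Δo := LinearMap.congr_fun T.map_Δo
  map_ρ := LinearMap.congr_fun T.map_ρ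

theorem Codifferential.isCoder {S : SCoalgebra.{v, u} K} (Q : Codifferential S) :
    IsCoder S.toCooperations Q.Qc Q.Qo where
  deg_c := Q.deg_Qc
  deg_o := Q.deg_Qo
  coder_Δc := LinearMap.congr_fun Q.coder_Δc
  coder_δc := LinearMap.congr_fun Q.coder_δc
  coder_Δo := LinearMap.congr_fun Q.coder_Δo
  coder_ρ := LinearMap.congr_fun Q.coder_ρ

/-- A coderivation of square zero as a codifferential. -/
def IsCoder.toCodifferential {S : SCoalgebra.{v, u} K} {Qc : Tot S.C →ₗ[K] Tot S.C}
    {Qo : Tot S.D →ₗ[K] Tot S.D} (h : IsCoder S.toCooperations Qc Qo) (hc : Qc ∘ₗ Qc = 0)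
    (ho : Qo ∘ₗ Qo = 0) : Codifferential S where
  Qc := Qc
  Qo := Qo
  deg_Qc := h.deg_c
  deg_Qo := h.deg_o
  coder_Δc := LinearMap.ext h.coder_Δc
  coder_δc := LinearMap.ext h.coder_δc
  coder_Δo := LinearMap.ext h.coder_Δo
  coder_ρ := LinearMap.ext h.coder_ρ
  sq_c := hc
  sq_o := ho

end Uniqueness

/-! ### The transfer theorem -/

section Main

variable {K : Type v} [Field K] {V A V' A' : CochainComplex (ModuleCat.{u} K) ℤ}

/-- The part of a `Ger⁺_∞`-algebra structure beyond the differential of `V`, extended to all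
trees. -/
theorem GerPlusStructure.exists_higherC (Q : GerPlusStructure V A) :
    ∃ m : Tot (treesC V.X) →ₗ[K] Tot V.X, HasDegree 3 m ∧ (∀ v, m (leafC V.X v) = 0) ∧
      ∀ x, m (cofreeC V.X A.X x) =
        prC V.X (cofreeC V.X A.X (Q.Qc x)) - totD V (prC V.X (cofreeC V.X A.X x)) := by
  -- The recursion defining `T` evaluates `m` on arbitrary trees, so `Qc` is precomposed with a
  -- retraction; on the cofree coalgebra this changes nothing.
  obtain ⟨r, hr, hr'⟩ := exists_retractionC (V := V.X) (A := A.X)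
  have hi := (isCoopHom_cofree (V := V.X) (A := A.X)).deg_c
  refine ⟨prC V.X ∘ₗ cofreeC V.X A.X ∘ₗ Q.Qc ∘ₗ r - totD V ∘ₗ prC V.X,
    (hasDegree_prC.comp (hi.comp (Q.deg_Qc.comp hr (zero_add 1)) (add_zero 1)) (by norm_num)).sub
      ((hasDegree_totD _).comp hasDegree_prC (by norm_num)), fun v => ?_, fun x => ?_⟩
  · refine tot_ext (f := (prC V.X ∘ₗ cofreeC V.X A.X ∘ₗ Q.Qc ∘ₗ r - totD V ∘ₗ prC V.X) ∘ₗ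
      leafC V.X) (g := 0) (fun i x => ?_) v
    simp only [LinearMap.comp_apply, LinearMap.sub_apply, LinearMap.zero_apply]
    -- Leaves lie in the cofree coalgebra, so the retraction fixes them, and there the structure is
    -- just the differential, which has been subtracted.
    rw [← cofreeC_cogenC (A := A.X), hr', Q.extends_dV, cofreeC_cogenC, cofreeC_cogenC, prC_leafC,
      prC_leafC, totD_inj, sub_self]
  · simp only [LinearMap.comp_apply, LinearMap.sub_apply, hr']

/-- The part of a `Ger⁺_∞`-algebra structure beyond the differential of `A`, extended to all
trees. -/
theorem GerPlusStructure.exists_higherO (Q : GerPlusStructure V A) :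
    ∃ m : Tot (treesO V.X A.X) →ₗ[K] Tot A.X, HasDegree 2 m ∧ (∀ a, m (leafO V.X A.X a) = 0) ∧
      ∀ y, m (cofreeO V.X A.X y) =
        prO V.X A.X (cofreeO V.X A.X (Q.Qo y)) - totD A (prO V.X A.X (cofreeO V.X A.X y)) := by
  obtain ⟨r, hr, hr'⟩ := exists_retractionO (V := V.X) (A := A.X)
  have hi := (isCoopHom_cofree (V := V.X) (A := A.X)).deg_o
  refine ⟨prO V.X A.X ∘ₗ cofreeO V.X A.X ∘ₗ Q.Qo ∘ₗ r - totD A ∘ₗ prO V.X A.X,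
    (hasDegree_prO.comp (hi.comp (Q.deg_Qo.comp hr (zero_add 1)) (add_zero 1)) (by norm_num)).sub
      ((hasDegree_totD _).comp hasDegree_prO (by norm_num)), fun v => ?_, fun x => ?_⟩
  · refine tot_ext (f := (prO V.X A.X ∘ₗ cofreeO V.X A.X ∘ₗ Q.Qo ∘ₗ r - totD A ∘ₗ prO V.X A.X) ∘ₗ
      leafO V.X A.X) (g := 0) (fun i x => ?_) v
    simp only [LinearMap.comp_apply, LinearMap.sub_apply, LinearMap.zero_apply]
    rw [← cofreeO_cogenO (V := V.X), hr', Q.extends_dA, cofreeO_cogenO, cofreeO_cogenO, prO_leafO,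
      prO_leafO, totD_inj, sub_self]
  · simp only [LinearMap.comp_apply, LinearMap.sub_apply, hr']

/-- Transfer of a `Ger⁺_∞`-algebra structure along quasi-isomorphisms. -/
theorem GerPlusStructure.exists_transfer (f : V ⟶ V') (g : A ⟶ A') (hf : QuasiIso f)
    (hg : QuasiIso g) (Q' : GerPlusStructure V' A') :
    ∃ (Q : GerPlusStructure V A) (T : GerPlusMorphism Q Q'), T.Extends f g := by
  obtain ⟨p, h, hp, hh, hpd, hph⟩ := exists_homotopyInverse f hf
  obtain ⟨s, k, hs, hk, hsd, hsk⟩ := exists_homotopyInverse g hg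
  obtain ⟨m, hm, hm0, hmQ⟩ := Q'.exists_higherC
  obtain ⟨n, hn, hn0, hnQ⟩ := Q'.exists_higherO
  -- The perturbations `h m` and `k n` are the corrections to the linear parts in the corestrictions
  -- of `T`.
  have hφ : HasDegree 2 (h ∘ₗ m) := hh.comp hm (by norm_num)
  have hψ : HasDegree 1 (k ∘ₗ n) := hk.comp hn (by norm_num)
  have hφ0 : ∀ x, (h ∘ₗ m) (leafC V'.X x) = 0 := fun x => by
    rw [LinearMap.comp_apply, hm0, map_zero]
  have hψ0 : ∀ x, (k ∘ₗ n) (leafO V'.X A'.X x) = 0 := fun x => by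
    rw [LinearMap.comp_apply, hn0, map_zero]
  have hM := isCoopHom_map (hasDegree_totMap f) hφ (hasDegree_totMap g) hψ
  obtain ⟨T, hTc, hTo⟩ := hM.exists_cofree
  -- The corestrictions `d pr + p m T` and `d pr + s n T` of the transferred structure; they refer
  -- to the tree morphism, which does not depend on them.
  let q : Tot (treesC V.X) →ₗ[K] Tot V.X :=
    totD V ∘ₗ prC V.X + p ∘ₗ m ∘ₗ mapC (totMap f) (h ∘ₗ m)
  let r : Tot (treesO V.X A.X) →ₗ[K] Tot A.X :=
    totD A ∘ₗ prO V.X A.X + s ∘ₗ n ∘ₗ mapO (totMap f) (h ∘ₗ m) (totMap g) (k ∘ₗ n)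
  have hq : HasDegree 3 q := ((hasDegree_totD _).comp hasDegree_prC (by norm_num)).add
    (hp.comp (hm.comp hM.deg_c (zero_add 3)) (add_zero 3))
  have hr : HasDegree 2 r := ((hasDegree_totD _).comp hasDegree_prO (by norm_num)).add
    (hs.comp (hn.comp hM.deg_o (zero_add 2)) (add_zero 2))
  obtain ⟨Rc, Ro, hR, hRc, hRo⟩ := (isCoder_coder hq hr).exists_cofree
  have tc := transfer_identity (LinearMap.congr_fun (totD_comp_totD V))
    (LinearMap.congr_fun (totD_comp_totD V')) (totMap_totD f) hpd hph
    (LinearMap.congr_fun Q'.sq_c) hmQ hTc hRc (prC_mapC hφ0) (prC_coderC q)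
  have tO := transfer_identity (LinearMap.congr_fun (totD_comp_totD A))
    (LinearMap.congr_fun (totD_comp_totD A')) (totMap_totD g) hsd hsk
    (LinearMap.congr_fun Q'.sq_o) hnQ hTo hRo (prO_mapO hψ0) (prO_coderO q r)
  -- The commutation has to come before the square-zero condition: the identity `pr Q² = 0` uses it.
  obtain ⟨cc, co⟩ := T.isCoopHom.comm_of_primitive hR Q'.isCoder
    (fun x h1 h2 => eq_zero_of_primitiveC h1 h2 hφ0 (tc x).1)
    (fun y h1 h2 => eq_zero_of_primitiveO h1 h2 hψ0 (tO y).1)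
  have cc' := sub_eq_zero.1 cc
  have co' := sub_eq_zero.1 co
  obtain ⟨sc, so⟩ := hR.comp_self_eq_zero
    (fun x h1 h2 => eq_zero_of_primitiveC h1 h2 (H := 0) (fun _ => rfl)
      ((tc x).2 (LinearMap.congr_fun cc' x)))
    (fun y h1 h2 => eq_zero_of_primitiveO h1 h2 (H := 0) (fun _ => rfl)
      ((tO y).2 (LinearMap.congr_fun co' y)))
  -- `T` sends leaves to leaves and `m` kills leaves, so only the differential survives.
  have mc : ∀ x, q (leafC V.X x) = totD V x := fun x => by
    simp only [q, LinearMap.add_apply, LinearMap.comp_apply, prC_leafC, mapC_leafC, hm0, map_zero,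
      add_zero]
  have mo : ∀ x, r (leafO V.X A.X x) = totD A x := fun x => by
    simp only [r, LinearMap.add_apply, LinearMap.comp_apply, prO_leafO, mapO_leafO, hn0, map_zero,
      add_zero]
  let Q : GerPlusStructure V A :=
    { toCodifferential := hR.toCodifferential sc so
      extends_dV := fun i x => cofreeC_injective <| by
        refine (hRc _).trans ?_
        rw [cofreeC_cogenC, cofreeC_cogenC, coderC_leafC, mc, totD_inj]
      extends_dA := fun i x => cofreeO_injective <| by
        refine (hRo _).trans ?_
        rw [cofreeO_cogenO, cofreeO_cogenO, coderO_leafO, mo, totD_inj] }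
  refine ⟨Q, { toHom := T, comm_c := cc', comm_o := co' },
    fun i x => cofreeC_injective ?_, fun i x => cofreeO_injective ?_⟩
  · refine (hTc _).trans ?_
    rw [cofreeC_cogenC, cofreeC_cogenC, mapC_leafC, totMap_inj]
  · refine (hTo _).trans ?_
    rw [cofreeO_cogenO, cofreeO_cogenO, mapO_leafO, totMap_inj]

end Main

end GerPlus

end

theorem theorem4p8 {K : Type v} [Field K] [CharZero K]
    (V A V' A' : CochainComplex (ModuleCat.{u} K) ℤ)
    (f : V ⟶ V') (g : A ⟶ A') (hf : QuasiIso f) (hg : QuasiIso g)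
    (Q' : GerPlus.GerPlusStructure V' A') :
    ∃ (Q : GerPlus.GerPlusStructure V A) (T : GerPlus.GerPlusMorphism Q Q'),
      T.IsQuasiIso ∧ T.Extends f g := by
  obtain ⟨Q, T, hT⟩ := GerPlus.GerPlusStructure.exists_transfer f g hf hg Q'
  exact ⟨Q, T, ⟨f, g, hT, hf, hg⟩, hT⟩
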